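/- Graphs are finite and may have loops and multiple edges. A graph is Eulerian if it is connected and every vertex has even degree. Let $G$ be an Eulerian graph, let $\gamma : E(G) \to \mathbb{Z}_2$ (a signature of $G$), and let $b$ be a vertex of $G$. A circuit is a non-empty closed trail, that is, a closed walk with no repeated edges (vertices may be repeated); it hits $b$ if it has an edge incident to $b$, and it is non-zero if the sum in $\mathbb{Z}_2$ of the values of $\gamma$ on its edges is $1$. A circuit-decomposition of $G$ is a collection of circuits such that each edge of $G$ is in exactly one of them. The flooding number $\tilde\nu(G,\gamma,b)$ is the maximum size of a circuit-decomposition of $G$ in which every circuit is non-zero and hits $b$, and it is $0$ if there is no such circuit-decomposition. Shifting a signature at a vertex $v$ means adding $1$ to its value on every non-loop edge incident to $v$; a shifting of $\gamma$ is any signature obtained from $\gamma$ by a finite (possibly empty) sequence of shiftings at vertices. For a set $X$ of vertices, $E(X)$ is the set of edges with both ends in $X$, $\delta(X)$ is the set of edges with exactly one end in $X$, and $G-X$ is the graph obtained by deleting the vertices in $X$. For a signature $\gamma'$ and a set $F$ of edges, $\gamma'(F)$ is the number of $e \in F$ with $\gamma'(e)=1$. A set $Y$ of vertices is $\gamma'$-odd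 if the integers $\gamma'(E(Y)\cup\delta(Y))$ and $|\delta(Y)|/2$ have different parities, and $\mathrm{odd}_{\gamma'}(G-X)$ is the number of connected components of $G-X$ whose vertex set is $\gamma'$-odd (with $E(Y)$ and $\delta(Y)$ taken in $G$). Then $$\tilde\nu(G,\gamma,b)=\min_{\gamma',X}\left(\gamma'(E(X))+\tfrac12|\delta(X)|-\mathrm{odd}_{\gamma'}(G-X)\right),$$ where the minimum is taken over all shiftings $\gamma'$ of $\gamma$ and all sets $X$ of vertices of $G$ that contain $b$. -/

import Mathlib

namespace Graph

variable {α β : Type*}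

/-! Graphs are Mathlib's multigraphs `Graph α β`: loops and parallel edges are allowed. A signature
of `G` is given by a function `γ : β → ZMod 2`; only its values on the edges of `G` matter. -/

/-- The degree of `v`; every loop at `v` counts twice. -/
noncomputable def degree (G : Graph α β) (v : α) : ℕ :=
  {e | G.IsNonloopAt e v}.ncard + 2 * {e | G.IsLoopAt e v}.ncard

/-- A graph is connected if it has a vertex and any two vertices are joined by a walk. -/
def IsConnected (G : Graph α β) : Prop :=
  G.vertexSet.Nonempty ∧
    ∀ x ∈ G.vertexSet, ∀ y ∈ G.vertexSet, Relation.ReflTransGen G.Adj x y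

/-- A graph is Eulerian if it is connected and every vertex has even degree. -/
def IsEulerian (G : Graph α β) : Prop :=
  G.IsConnected ∧ ∀ v ∈ G.vertexSet, Even (G.degree v)

/-- `Y` is the vertex set of a (connected) component of `G`. -/
def IsComponentSet (G : Graph α β) (Y : Set α) : Prop :=
  ∃ v ∈ G.vertexSet, Y = {w | Relation.ReflTransGen G.Adj v w}

/-- The set `E(X)` of edges with both ends in `X`. -/
def edgesWithin (G : Graph α β) (X : Set α) : Set β :=
  {e | ∃ x ∈ X, ∃ y ∈ X, G.IsLink e x y}

/-- The set `δ(X)` of edges with exactly one end in `X`. -/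
def edgeBoundary (G : Graph α β) (X : Set α) : Set β :=
  {e | ∃ x ∈ X, ∃ y, y ∉ X ∧ G.IsLink e x y}

/-- An arc of `G`: an edge together with a direction. (The two directions of a loop are identified;
this has no effect on which edge sets are traversed by circuits.) -/
@[ext]
structure Arc (G : Graph α β) where
  /-- The vertex at which the arc begins. -/
  tail : α
  /-- The underlying edge. -/
  edge : β
  /-- The vertex at which the arc ends. -/
  head : α
  isLink : G.IsLink edge tail head

/-- A trail: a non-empty sequence of arcs whose edges are distinct and such that
the head of each arc other than the last is the tail of the next. -/
@[ext]
structure Trail (G : Graph α β) where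
  /-- The sequence of arcs of the trail. -/
  arcs : List G.Arc
  ne_nil : arcs ≠ []
  isChain : arcs.IsChain (fun a a' => a.head = a'.tail)
  nodup : (arcs.map Arc.edge).Nodup

namespace Trail

variable {G : Graph α β}

/-- The tail of a trail is the tail of its first arc. -/
def tail (T : G.Trail) : α := (T.arcs.head T.ne_nil).tail

/-- The head of a trail is the head of its last arc. -/
def head (T : G.Trail) : α := (T.arcs.getLast T.ne_nil).head

/-- The edges of a trail, in order. -/
def edges (T : G.Trail) : List β := T.arcs.map Arc.edge

/-- A circuit is a trail with the same head and tail. -/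
def IsCircuit (T : G.Trail) : Prop := T.head = T.tail

/-- A trail hits `b` if it has an edge incident to `b`. -/
def Hits (T : G.Trail) (b : α) : Prop := ∃ e ∈ T.edges, G.Inc e b

/-- The weight of a trail: the sum of the weights of its edges. -/
def weight (γ : β → ZMod 2) (T : G.Trail) : ZMod 2 := (T.edges.map γ).sum

end Trail

/-- A collection of circuits such that each edge of `G` is in exactly one of them. -/
def IsCircuitDecomposition (G : Graph α β) (𝒞 : Finset G.Trail) : Prop :=
  (∀ C ∈ 𝒞, C.IsCircuit) ∧ ∀ e ∈ G.edgeSet, ∃! C, C ∈ 𝒞 ∧ e ∈ C.edges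

/-- The sizes of the circuit-decompositions all of whose circuits are non-zero and hit `b`. -/
def floodingSizes (G : Graph α β) (γ : β → ZMod 2) (b : α) : Set ℕ :=
  {k | ∃ 𝒞 : Finset G.Trail, G.IsCircuitDecomposition 𝒞 ∧
    (∀ C ∈ 𝒞, C.weight γ ≠ 0 ∧ C.Hits b) ∧ 𝒞.card = k}

/-- The flooding number: the maximum size of a circuit-decomposition in which each circuit is
non-zero and hits `b`, and `0` if there is no such circuit-decomposition. -/
noncomputable def floodingNumber (G : Graph α β) (γ : β → ZMod 2) (b : α) : ℕ :=
  sSup (G.floodingSizes γ b)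

/-- In a graph with finitely many edges, the supremum above is a maximum
as soon as there is a decomposition of the required kind. -/
theorem isGreatest_floodingNumber (G : Graph α β) (hE : G.edgeSet.Finite) (γ : β → ZMod 2) (b : α)
    (h : (G.floodingSizes γ b).Nonempty) :
    IsGreatest (G.floodingSizes γ b) (G.floodingNumber γ b) := by
  have hb : BddAbove (G.floodingSizes γ b) := by
    refine ⟨G.edgeSet.ncard, ?_⟩
    rintro k ⟨𝒞, ⟨-, hu⟩, -, rfl⟩
    rw [← Set.ncard_coe_finset]
    have hmem : ∀ C : G.Trail, (C.arcs.head C.ne_nil).edge ∈ C.edges := fun C =>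
      List.mem_map_of_mem (List.head_mem C.ne_nil)
    have hG : ∀ C : G.Trail, (C.arcs.head C.ne_nil).edge ∈ G.edgeSet := fun C =>
      (C.arcs.head C.ne_nil).isLink.edge_mem
    refine Set.ncard_le_ncard_of_injOn (fun C => (C.arcs.head C.ne_nil).edge)
      (fun C _ => hG C) ?_ hE
    intro C hC D hD hCD
    have hCD' : (C.arcs.head C.ne_nil).edge = (D.arcs.head D.ne_nil).edge := hCD
    exact (hu _ (hG C)).unique ⟨hC, hmem C⟩ ⟨hD, hCD' ▸ hmem D⟩
  exact ⟨Nat.sSup_mem h hb, fun k hk => le_csSup hb hk⟩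

open Classical in
/-- Shifting at `v`: add `1` to the weight of each non-loop edge incident to `v`. -/
noncomputable def shiftAt (G : Graph α β) (v : α) (γ : β → ZMod 2) : β → ZMod 2 :=
  fun e => if G.IsNonloopAt e v then γ e + 1 else γ e

/-- `γ'` is a shifting of `γ`: it is obtained from `γ` by a (finite, possibly empty) sequence of
shiftings at vertices. -/
def IsShifting (G : Graph α β) (γ γ' : β → ZMod 2) : Prop :=
  Relation.ReflTransGen (fun γ₁ γ₂ => ∃ v ∈ G.vertexSet, γ₂ = G.shiftAt v γ₁) γ γ'

/-- `γ(F)`: the number of edges in `F` that are non-zero according to `γ`. -/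
noncomputable def nonzeroCount (γ : β → ZMod 2) (F : Set β) : ℕ :=
  {e ∈ F | γ e ≠ 0}.ncard

/-- `Y` is `γ`-odd if `γ(E(Y) ∪ δ(Y))` and `|δ(Y)| / 2` have different parities.
(In a graph with even degrees, `|δ(Y)|` is even and the division is exact.) -/
def IsOddSet (G : Graph α β) (γ : β → ZMod 2) (Y : Set α) : Prop :=
  ¬ (nonzeroCount γ (G.edgesWithin Y ∪ G.edgeBoundary Y) ≡ (G.edgeBoundary Y).ncard / 2 [MOD 2])

/-- The number of components of `G - X` whose vertex set is `γ`-odd (as a vertex set of `G`). -/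
noncomputable def oddComponents (G : Graph α β) (γ : β → ZMod 2) (X : Set α) : ℕ :=
  {Y | (G.deleteVerts X).IsComponentSet Y ∧ G.IsOddSet γ Y}.ncard

end Graph

/-!
Circuit-decompositions are treated through *floods*. A signed graph is encoded as the multiset of its
labelled edges, and joining two consecutive edges `uv`, `vw` of a trail at an inner vertex `v` replaces
them by one edge `uw` with the sum of the labels (splitting off at `v`). If this is done at all vertices
outside a set `B` of roots, then there remain edges between roots, and the number of those with label
`1` counts the non-zero trails. `Flood B M n` says that `n` non-zero trails can be reached. For an
Eulerian graph and a single root `b`, the largest such `n` is the flooding number: a flood yields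
circuits through `b`, where zero circuits are merged into a non-zero one (`Graph.le_floodingNumber`),
and conversely circuits, or for the value `0` an Euler tour, yield a flood
(`Graph.IsEulerian.flood_floodingNumber`). Several roots are needed for the induction below.

*Upper bound.* The quantity `2 γ'(E(X)) + |δ(X)| - 2 |𝒴|`, for a family `𝒴` of disjoint odd unions of
components of `G - X`, does not increase under splitting off, if `𝒴` is adapted
(`IsOddFamily.split_off`), and it is at least twice the number of non-zero trails when only edges
between roots are left (`Flood.le_cost`).

*Lower bound.* `Flood.exists_certificate` shows by induction that the bound is attained. Edges between
roots and components outside the roots can be treated separately, and a star is easy. If cutting an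
edge outside the roots, at a new root on it, gains nothing for some choice of the labels of the two
halves, then a certificate for the cut multigraph is one for `M`. So suppose that each of these cuts
gains two non-zero trails over the optimum `k`. Call two edges independent if they can be cut
simultaneously with a gain of four. Two facts hold in an optimal situation.
* Independent edges have an exchange property (`Flood.exchange`, `Indep.exchange`). Its proof rests on
  `Flood.common_reduce`: floods for different root sets can be carried out by the same splits, by the
  pigeonhole principle for the three pairings of three edges at a vertex (`Flood.three_way`). This
  reduces the claim to multigraphs with three vertices besides the roots.
* Adjacent edges are not independent (`not_indep_of_adj`): otherwise their halves could be connected in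
  a different way with more than `k` non-zero trails (`Flood.rewire`).

By the exchange property independence spreads along edges outside the roots, and as these connect all
other vertices, a pair of independent edges would lead to an adjacent pair. So there are no
independent edges. But two zero trails would contain such edges (`Flood.exists_indep`). Hence there are
at most `k + 1` trails, so the roots send out at most `2 k + 2` edges, and `X = B` is optimal: if there are
exactly `2 k + 2` edges, then the set of all other vertices is odd by parity.
-/

namespace SignedMultigraph

variable {V : Type*}

/-! ### Floods of labelled multigraphs -/

/-- The number of edges with label `1`. -/
def ones (M : Multiset (Sym2 V × ZMod 2)) : ℕ := (M.map fun e => e.2.val).sum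

@[simp] theorem ones_zero : ones (0 : Multiset (Sym2 V × ZMod 2)) = 0 := rfl

@[simp] theorem ones_cons (e : Sym2 V × ZMod 2) (M : Multiset (Sym2 V × ZMod 2)) :
    ones (e ::ₘ M) = e.2.val + ones M := by simp [ones]

@[simp] theorem ones_add (M N : Multiset (Sym2 V × ZMod 2)) :
    ones (M + N) = ones M + ones N := by simp [ones]

/-- `Flood B M n`: the edges of `M` can be joined up to trails between vertices of `B`, the roots, such
that at least `n` of the trails have weight `1`. An edge `s(u, v)` with label `a` is the pair
`(s(u, v), a)`. Joining the edges `uv` and `vw` at a vertex `v` that is not a root replaces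
them by one edge `uw`, whose label is the sum of theirs; this is called splitting (off) at `v`.
In the end only edges between roots are left, which are the trails. Trails of weight `0` are
allowed. -/
inductive Flood (B : Set V) : Multiset (Sym2 V × ZMod 2) → ℕ → Prop
  | base {M : Multiset (Sym2 V × ZMod 2)} {n : ℕ} (h : ∀ e ∈ M, ∀ v ∈ e.1, v ∈ B)
      (hn : n ≤ ones M) : Flood B M n
  | split {u v w : V} {a c : ZMod 2} {N : Multiset (Sym2 V × ZMod 2)} {n : ℕ} (hv : v ∉ B)
      (h : Flood B ((s(u, w), a + c) ::ₘ N) n) :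
      Flood B ((s(u, v), a) ::ₘ (s(v, w), c) ::ₘ N) n

theorem cons_left_comm (e f : Sym2 V × ZMod 2) (N : Multiset (Sym2 V × ZMod 2)) :
    e ::ₘ f ::ₘ N = f ::ₘ e ::ₘ N := Multiset.cons_swap e f N

namespace Flood

variable {B : Set V} {M N : Multiset (Sym2 V × ZMod 2)} {n : ℕ}

theorem congr (h : Flood B M n) (e : M = N) : Flood B N n := e ▸ h

/-- Splitting with the first edge oriented towards any end and the label given up to equality. -/
theorem of_split {u v w : V} {a c l : ZMod 2} (hv : v ∉ B) (hl : l = a + c)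
    (h : Flood B ((s(u, w), l) ::ₘ N) n) : Flood B ((s(v, u), a) ::ₘ (s(v, w), c) ::ₘ N) n := by
  rw [Sym2.eq_swap (a := v) (b := u)]
  exact split hv (hl ▸ h)

/-- Every edge `vx` at a vertex `v` that is not a root is joined to some other edge at `v`, and these
two edges may be split off first. -/
theorem partner (h : Flood B M n) : ∀ {v x : V} {a : ZMod 2} {N : Multiset (Sym2 V × ZMod 2)},
    v ∉ B → M = (s(v, x), a) ::ₘ N → ∃ y c N', N = (s(v, y), c) ::ₘ N' ∧
      Flood B ((s(x, y), a + c) ::ₘ N') n := by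
  induction h with
  | base h hn =>
    rintro v x a N hv rfl
    exact absurd (h _ (Multiset.mem_cons_self _ _) v (Sym2.mem_mk_left _ _)) hv
  | @split u v₁ w a₁ c₁ N₁ n hv₁ h ih =>
    intro v x a N hv hM
    -- the case in which the chosen edge is one of the two edges split first
    have key : ∀ {u w : V} {a₁ c₁ : ZMod 2},
        Flood B ((s(u, w), a₁ + c₁) ::ₘ N₁) n →
        (∀ {v x : V} {a : ZMod 2} {N : Multiset (Sym2 V × ZMod 2)}, v ∉ B →
          (s(u, w), a₁ + c₁) ::ₘ N₁ = (s(v, x), a) ::ₘ N → ∃ y c N', N = (s(v, y), c) ::ₘ N' ∧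
          Flood B ((s(x, y), a + c) ::ₘ N') n) →
        s(u, v₁) = s(v, x) → a₁ = a → N = (s(v₁, w), c₁) ::ₘ N₁ →
        ∃ y c N', N = (s(v, y), c) ::ₘ N' ∧ Flood B ((s(x, y), a + c) ::ₘ N') n := by
      rintro u w a₁ c₁ h ih hs rfl rfl
      rcases Sym2.eq_iff.1 hs with ⟨rfl, rfl⟩ | ⟨rfl, rfl⟩
      · obtain ⟨y, c, N', rfl, h'⟩ := ih hv rfl
        refine ⟨y, c, (s(v₁, w), c₁) ::ₘ N', cons_left_comm _ _ _, ?_⟩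
        exact of_split (l := a₁ + c₁ + c) hv₁ (by ring) (h'.congr (by rw [Sym2.eq_swap]))
      · exact ⟨w, c₁, N₁, rfl, h⟩
    rcases Multiset.cons_eq_cons.1 hM with ⟨h1, h2⟩ | ⟨-, N₂, h1, h2⟩
    · exact key h ih (congrArg Prod.fst h1) (congrArg Prod.snd h1) h2.symm
    rcases Multiset.cons_eq_cons.1 h1 with ⟨h3, rfl⟩ | ⟨-, N₃, rfl, rfl⟩
    · refine key (u := w) (w := u) (a₁ := c₁) (c₁ := a₁) (h.congr ?_) ?_ ?_ (congrArg Prod.snd h3) ?_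
      · rw [Sym2.eq_swap, add_comm]
      · rw [Sym2.eq_swap, add_comm]; exact ih
      · rw [Sym2.eq_swap]; exact congrArg Prod.fst h3
      · rw [h2, Sym2.eq_swap]
    · subst h2
      obtain ⟨y, c, N', h4, h'⟩ := ih hv (cons_left_comm _ _ _)
      rcases Multiset.cons_eq_cons.1 h4 with ⟨h5, rfl⟩ | ⟨-, N₄, rfl, rfl⟩
      · obtain ⟨h5, rfl⟩ := Prod.ext_iff.1 h5
        rcases Sym2.eq_iff.1 h5 with ⟨rfl, rfl⟩ | ⟨rfl, rfl⟩
        · refine ⟨v₁, a₁, _, rfl, ?_⟩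
          rw [Sym2.eq_swap]
          exact of_split hv₁ (by ring) h'
        · refine ⟨v₁, c₁, (s(u, v₁), a₁) ::ₘ N₃, ?_, ?_⟩
          · rw [cons_left_comm, Sym2.eq_swap (a := v₁)]
          · rw [Sym2.eq_swap, Sym2.eq_swap (a := u)]
            exact of_split hv₁ (by simp only; ring) h'
      · refine ⟨y, c, (s(u, v₁), a₁) ::ₘ (s(v₁, w), c₁) ::ₘ N₄, ?_, ?_⟩
        · simp only [← Multiset.singleton_add]; abel
        · refine (split hv₁ (h'.congr (cons_left_comm _ _ _))).congr ?_
          simp only [← Multiset.singleton_add]; abel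

theorem val_pairing (a c d e : ZMod 2) :
    (a + c).val + (d + e).val ≤ (a + d).val + (c + e).val ∨
      (a + c).val + (d + e).val ≤ (a + e).val + (c + d).val := by
  revert a c d e; decide

/-- One of the two other ways to join up four arms, which end at `p`, `q`, `r`, `t` and have weights
`a`, `c`, `d`, `e`, and of which `p`, `q` and `r`, `t` are currently paired. -/
def Repaired (B : Set V) (n : ℕ) (p q r t : V) (a c d e : ZMod 2)
    (N : Multiset (Sym2 V × ZMod 2)) : Prop :=
  Flood B ((s(p, r), a + d) ::ₘ (s(q, t), c + e) ::ₘ N) n ∨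
    Flood B ((s(p, t), a + e) ::ₘ (s(q, r), c + d) ::ₘ N) n

theorem Repaired.swap_left {p q r t : V} {a c d e : ZMod 2}
    (h : Repaired B n p q r t a c d e N) : Repaired B n q p r t c a d e N := by
  rcases h with h | h
  · exact Or.inr (h.congr (cons_left_comm _ _ _))
  · exact Or.inl (h.congr (cons_left_comm _ _ _))

theorem Repaired.swap_right {p q r t : V} {a c d e : ZMod 2}
    (h : Repaired B n p q r t a c d e N) : Repaired B n p q t r a c e d N := Or.symm h

theorem Repaired.swap {p q r t : V} {a c d e : ZMod 2}
    (h : Repaired B n p q r t a c d e N) : Repaired B n r t p q d e a c N := by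
  rcases h with h | h
  · exact Or.inl (h.congr (by rw [Sym2.eq_swap, add_comm, Sym2.eq_swap (a := t), add_comm c]))
  · refine Or.inr (h.congr ?_)
    rw [Sym2.eq_swap (a := r), add_comm d, Sym2.eq_swap (a := t), add_comm e, cons_left_comm]

/-- Undoing a split at `v` of the arm that ends at `w` into an arm and an edge `vw`. -/
theorem Repaired.of_split {p v w r t : V} {a b c d e : ZMod 2} (hv : v ∉ B)
    (h : Repaired B n p w r t a (b + c) d e N) :
    Repaired B n p v r t a b d e ((s(v, w), c) ::ₘ N) := by
  rcases h with h | h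
  · left
    have := Flood.of_split (u := t) (w := w) (a := b + e) (c := c) (l := b + c + e) hv (by ring)
      ((h.congr (cons_left_comm _ _ _)).congr (by rw [Sym2.eq_swap]))
    refine this.congr ?_
    simp only [← Multiset.singleton_add]; abel
  · right
    have := Flood.of_split (u := r) (w := w) (a := b + d) (c := c) (l := b + c + d) hv (by ring)
      ((h.congr (cons_left_comm _ _ _)).congr (by rw [Sym2.eq_swap]))
    refine this.congr ?_
    simp only [← Multiset.singleton_add]; abel

/-- If four arms can be joined in one of the three possible ways, then also in at least one of the other
two: either the two trails through them are different and `val_pairing` applies, or one trail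
passes through all arms and may be reversed in between. -/
theorem two_of_three (h : Flood B M n) : ∀ {p q r t : V} {a c d e l m : ZMod 2}
    {N : Multiset (Sym2 V × ZMod 2)}, l = a + c → m = d + e →
    M = (s(p, q), l) ::ₘ (s(r, t), m) ::ₘ N → Repaired B n p q r t a c d e N := by
  induction h with
  | @base M n h hn =>
    rintro p q r t a c d e _ _ N rfl rfl rfl
    have hp : p ∈ B := h (s(p, q), a + c) (by simp) p (by simp)
    have hq : q ∈ B := h (s(p, q), a + c) (by simp) q (by simp)
    have hr : r ∈ B := h (s(r, t), d + e) (by simp) r (by simp)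
    have ht : t ∈ B := h (s(r, t), d + e) (by simp) t (by simp)
    have hN : ∀ e ∈ N, ∀ v ∈ e.1, v ∈ B := fun e he => h e (by simp [he])
    simp only [ones_cons] at hn
    rcases val_pairing a c d e with h1 | h1
    · refine Or.inl (base ?_ (by simp only [ones_cons]; omega))
      simp only [Multiset.mem_cons, forall_eq_or_imp, Sym2.mem_iff, forall_eq]
      exact ⟨⟨hp, hr⟩, ⟨hq, ht⟩, hN⟩
    · refine Or.inr (base ?_ (by simp only [ones_cons]; omega))
      simp only [Multiset.mem_cons, forall_eq_or_imp, Sym2.mem_iff, forall_eq]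
      exact ⟨⟨hp, ht⟩, ⟨hq, hr⟩, hN⟩
  | @split u v w a₁ c₁ N₁ n hv h ih =>
    intro p q r t a c d e l m N hl hm hM
    -- exactly one of the two edges that are split is the edge `pq`
    have one : ∀ {u w p q r t : V} {a₁ c₁ a c d e m : ZMod 2} {N : Multiset (Sym2 V × ZMod 2)},
        m = d + e → a₁ = a + c → s(u, v) = s(p, q) →
        (∀ {p q r t : V} {a c d e l m : ZMod 2}, l = a + c → m = d + e →
          s(u, w) = s(p, q) → a₁ + c₁ = l → N₁ = (s(r, t), m) ::ₘ N →
          Repaired B n p q r t a c d e N) →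
        N₁ = (s(r, t), m) ::ₘ N → Repaired B n p q r t a c d e ((s(v, w), c₁) ::ₘ N) := by
      intro u w p q r t a₁ c₁ a c d e m N hm hl hs ih hN
      rcases Sym2.eq_iff.1 hs with ⟨rfl, rfl⟩ | ⟨rfl, rfl⟩
      · exact (ih (a := a) (c := c + c₁) (by rw [hl]; ring) hm rfl rfl hN).of_split hv
      · exact ((ih (a := c) (c := a + c₁) (by rw [hl]; ring) hm rfl rfl hN).of_split hv).swap_left
    -- both edges are split against each other
    have two : ∀ {p q r t : V} {a c d e : ZMod 2}, a₁ = a + c → c₁ = d + e →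
        s(u, v) = s(p, q) → s(v, w) = s(r, t) → Repaired B n p q r t a c d e N₁ := by
      have two' : ∀ {a c d e : ZMod 2}, a₁ = a + c → c₁ = d + e →
          Repaired B n u v v w a c d e N₁ := by
        rintro a c d e rfl rfl
        exact Or.inl (split hv (h.congr (by rw [show a + c + (d + e) = a + d + (c + e) by ring])))
      intro p q r t a c d e h1 h2 h3 h4
      rcases Sym2.eq_iff.1 h3 with ⟨rfl, rfl⟩ | ⟨rfl, rfl⟩ <;>
      rcases Sym2.eq_iff.1 h4 with ⟨rfl, rfl⟩ | ⟨h5, rfl⟩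
      · exact two' h1 h2
      · subst h5; exact (two' h1 (by rw [h2, add_comm])).swap_right
      · exact (two' (by rw [h1, add_comm]) h2).swap_left
      · subst h5
        exact (two' (by rw [h1, add_comm]) (by rw [h2, add_comm])).swap_left.swap_right
    have ih1 : ∀ {p q r t : V} {a c d e l m : ZMod 2} {N : Multiset (Sym2 V × ZMod 2)},
        l = a + c → m = d + e → s(u, w) = s(p, q) → a₁ + c₁ = l → N₁ = (s(r, t), m) ::ₘ N →
        Repaired B n p q r t a c d e N := by
      rintro p q r t a c d e _ _ N rfl rfl h1 h2 rfl
      exact ih rfl rfl (by rw [h1, h2])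
    have ih2 : ∀ {p q r t : V} {a c d e l m : ZMod 2} {N : Multiset (Sym2 V × ZMod 2)},
        l = a + c → m = d + e → s(w, u) = s(p, q) → c₁ + a₁ = l → N₁ = (s(r, t), m) ::ₘ N →
        Repaired B n p q r t a c d e N :=
      fun hl hm h1 h2 => ih1 hl hm (by rw [Sym2.eq_swap, h1]) (by rw [add_comm, h2])
    have hvw : (s(v, w), c₁) = (s(w, v), c₁) := by rw [Sym2.eq_swap]
    have huv : (s(u, v), a₁) = (s(v, u), a₁) := by rw [Sym2.eq_swap]
    rcases Multiset.cons_eq_cons.1 hM with ⟨h1, h2⟩ | ⟨-, N₂, h1, h2⟩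
    · obtain ⟨h1, rfl⟩ := Prod.ext_iff.1 h1
      rcases Multiset.cons_eq_cons.1 h2 with ⟨h3, rfl⟩ | ⟨-, N₃, h3, rfl⟩
      · obtain ⟨h3, rfl⟩ := Prod.ext_iff.1 h3
        exact two hl hm h1 h3
      · exact one hm hl h1 ih1 h3
    rcases Multiset.cons_eq_cons.1 h1 with ⟨h3, rfl⟩ | ⟨-, N₃, h3, rfl⟩
    · obtain ⟨h3, rfl⟩ := Prod.ext_iff.1 h3
      rcases Multiset.cons_eq_cons.1 h2 with ⟨h4, rfl⟩ | ⟨-, N₄, rfl, h4⟩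
      · obtain ⟨h4, rfl⟩ := Prod.ext_iff.1 h4
        exact (two hm hl h4.symm h3).swap
      · rw [huv]
        exact one hm hl (Sym2.eq_swap.trans h3) ih2 h4
    rcases Multiset.cons_eq_cons.1 h2 with ⟨h4, rfl⟩ | ⟨-, N₄, rfl, h4⟩
    · obtain ⟨h4, rfl⟩ := Prod.ext_iff.1 h4
      exact (one hl hm h4.symm ih1 h3).swap
    rcases Multiset.cons_eq_cons.1 h4 with ⟨h5, rfl⟩ | ⟨-, N₅, rfl, rfl⟩
    · obtain ⟨h5, rfl⟩ := Prod.ext_iff.1 h5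
      rw [huv]
      exact (one hl hm (by rw [Sym2.eq_swap]; exact h5) ih2 h3).swap
    · subst h3
      have := ih (N := (s(u, w), a₁ + c₁) ::ₘ N₅) hl hm
        (by simp only [← Multiset.singleton_add]; abel)
      rcases this with h | h
      · left
        refine (split (u := u) (w := w) (a := a₁) (c := c₁) (N := (s(p, r), a + d) ::ₘ (s(q, t), c + e) ::ₘ N₅) hv
          (h.congr ?_)).congr ?_
        all_goals (simp only [← Multiset.singleton_add]; abel)
      · right
        refine (split (u := u) (w := w) (a := a₁) (c := c₁)
          (N := (s(p, t), a + e) ::ₘ (s(q, r), c + d) ::ₘ N₅) hv (h.congr ?_)).congr ?_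
        all_goals (simp only [← Multiset.singleton_add]; abel)

theorem mono {m : ℕ} (h : Flood B M n) (hm : m ≤ n) : Flood B M m := by
  induction h with
  | base h hn => exact base h (hm.trans hn)
  | split hv _ ih => exact split hv (ih hm)

theorem le_ones (h : Flood B M n) (hM : ∀ e ∈ M, ∀ v ∈ e.1, v ∈ B) : n ≤ ones M := by
  cases h with
  | base _ hn => exact hn
  | @split u v w a c N n hv h => exact absurd (hM (s(u, v), a) (by simp) v (by simp)) hv

/-- Given three edges at `v`, there are three ways to split off two of them. If one of the ways
allows a flood of value `n`, then so does at least one of the other two. -/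
theorem three_way {v x y z : V} {a c d : ZMod 2} (hv : v ∉ B)
    (h : Flood B ((s(x, y), a + c) ::ₘ (s(v, z), d) ::ₘ N) n) :
    Flood B ((s(x, z), a + d) ::ₘ (s(v, y), c) ::ₘ N) n ∨
      Flood B ((s(y, z), c + d) ::ₘ (s(v, x), a) ::ₘ N) n := by
  obtain ⟨t, e, N', h1, h2⟩ := partner h hv (cons_left_comm _ _ _)
  rcases Multiset.cons_eq_cons.1 h1 with ⟨h3, rfl⟩ | ⟨-, N₃, rfl, rfl⟩
  · obtain ⟨h3, rfl⟩ := Prod.ext_iff.1 h3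
    rcases Sym2.eq_iff.1 h3 with ⟨rfl, rfl⟩ | ⟨rfl, rfl⟩
    · left
      refine (of_split (a := d + a) (c := c) (l := d + (a + c)) hv (by ring) h2).congr ?_
      rw [add_comm d]
    · right
      refine (of_split (a := d + c) (c := a) (l := d + (a + c)) hv (by ring) h2).congr ?_
      rw [add_comm d]
  · rcases two_of_three h2 (a := d) (c := e) (d := a) (e := c) rfl rfl rfl with h | h
    · left
      refine (of_split (u := t) (w := y) hv rfl (h.congr (cons_left_comm _ _ _))).congr ?_
      rw [Sym2.eq_swap (a := x), add_comm a]
      simp only [← Multiset.singleton_add]; abel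
    · right
      refine (of_split (u := t) (w := x) hv rfl (h.congr (cons_left_comm _ _ _))).congr ?_
      rw [Sym2.eq_swap (a := y), add_comm c]
      simp only [← Multiset.singleton_add]; abel

/-- Any two floods, for possibly different sets of roots, can be modified so that they
have a split in common at a given vertex that is a root of neither. -/
theorem common_split {B₁ B₂ : Set V} {n₁ n₂ : ℕ} {v x : V} {a : ZMod 2}
    (h₁ : Flood B₁ ((s(v, x), a) ::ₘ N) n₁) (h₂ : Flood B₂ ((s(v, x), a) ::ₘ N) n₂)
    (hv₁ : v ∉ B₁) (hv₂ : v ∉ B₂) :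
    ∃ p q c d N', (s(v, x), a) ::ₘ N = (s(v, p), c) ::ₘ (s(v, q), d) ::ₘ N' ∧
      Flood B₁ ((s(p, q), c + d) ::ₘ N') n₁ ∧ Flood B₂ ((s(p, q), c + d) ::ₘ N') n₂ := by
  obtain ⟨y, c, N', rfl, h1⟩ := partner h₁ hv₁ rfl
  obtain ⟨z, d, N'', h0, h2⟩ := partner h₂ hv₂ rfl
  rcases Multiset.cons_eq_cons.1 h0 with ⟨h3, rfl⟩ | ⟨-, N₃, rfl, rfl⟩
  · obtain ⟨h3, rfl⟩ := Prod.ext_iff.1 h3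
    obtain rfl := Sym2.congr_right.1 h3
    exact ⟨x, y, a, c, N', rfl, h1, h2⟩
  · rcases three_way hv₁ h1 with h3 | h3
    · exact ⟨x, z, a, d, (s(v, y), c) ::ₘ N₃, by rw [cons_left_comm (s(v, y), c)], h3, h2⟩
    rcases three_way hv₂ h2 with h4 | h4
    · exact ⟨x, y, a, c, (s(v, z), d) ::ₘ N₃, rfl, h1, h4⟩
    · refine ⟨y, z, c, d, (s(v, x), a) ::ₘ N₃, ?_, h3, h4.congr ?_⟩
      · simp only [← Multiset.singleton_add]; abel
      · rw [Sym2.eq_swap, add_comm]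

/-- Induction on a flood that keeps track of one edge. -/
theorem track {P : Sym2 V × ZMod 2 → Multiset (Sym2 V × ZMod 2) → Prop}
    (base : ∀ e N, (∀ e' ∈ e ::ₘ N, ∀ v ∈ e'.1, v ∈ B) → n ≤ ones (e ::ₘ N) → P e N)
    (tracked : ∀ u v w a c N, v ∉ B → P (s(u, w), a + c) N → P (s(u, v), a) ((s(v, w), c) ::ₘ N))
    (other : ∀ u v w a c e N, v ∉ B → P e ((s(u, w), a + c) ::ₘ N) →
      P e ((s(u, v), a) ::ₘ (s(v, w), c) ::ₘ N))
    (h : Flood B M n) : ∀ {e : Sym2 V × ZMod 2} {N : Multiset (Sym2 V × ZMod 2)},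
    M = e ::ₘ N → P e N := by
  induction h with
  | base h hn => rintro e N rfl; exact base e N h hn
  | @split u v w a c N₁ n hv h ih =>
    intro e N hM
    rcases Multiset.cons_eq_cons.1 hM with ⟨rfl, rfl⟩ | ⟨-, N₂, h1, rfl⟩
    · exact tracked u v w a c N₁ hv (ih base rfl)
    rcases Multiset.cons_eq_cons.1 h1 with ⟨rfl, rfl⟩ | ⟨-, N₃, rfl, rfl⟩
    · rw [Sym2.eq_swap, Sym2.eq_swap (a := u)]
      refine tracked w v u c a N₁ hv (ih base ?_)
      rw [Sym2.eq_swap, add_comm]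
    · exact other u v w a c e N₃ hv (ih base (cons_left_comm _ _ _))

theorem val_add_le (a c : ZMod 2) : (a + c).val ≤ a.val + c.val := by
  revert a c; decide

/-- An edge may be cut at a root. -/
theorem cut_root {u v w : V} {a c l : ZMod 2} (hv : v ∈ B) (hl : l = a + c)
    (h : Flood B ((s(u, w), l) ::ₘ N) n) : Flood B ((s(v, u), a) ::ₘ (s(v, w), c) ::ₘ N) n := by
  refine track (B := B) (n := n) (P := fun e N => ∀ u w a c, e = (s(u, w), a + c) →
    Flood B ((s(v, u), a) ::ₘ (s(v, w), c) ::ₘ N) n) ?_ ?_ ?_ h rfl u w a c (by rw [hl])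
  · rintro _ N h1 h2 u w a c rfl
    have hu : u ∈ B := h1 (s(u, w), a + c) (by simp) u (by simp)
    have hw : w ∈ B := h1 (s(u, w), a + c) (by simp) w (by simp)
    have hN : ∀ e ∈ N, ∀ v ∈ e.1, v ∈ B := fun e he => h1 e (by simp [he])
    refine base ?_ ?_
    · simp only [Multiset.mem_cons, forall_eq_or_imp, Sym2.mem_iff, forall_eq]
      exact ⟨⟨hv, hu⟩, ⟨hv, hw⟩, hN⟩
    · have := val_add_le a c
      simp only [ones_cons] at h2 ⊢
      omega
  · rintro u₁ v₁ w₁ a₁ c₁ N hv₁ ih u w a c he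
    obtain ⟨he, rfl⟩ := Prod.ext_iff.1 he
    rcases Sym2.eq_iff.1 he with ⟨rfl, rfl⟩ | ⟨rfl, rfl⟩
    · have := ih u₁ w₁ a (c + c₁) (by simp only; ring_nf)
      refine (of_split (u := v) (w := w₁) hv₁ rfl (this.congr (cons_left_comm _ _ _))).congr ?_
      rw [Sym2.eq_swap]
      simp only [← Multiset.singleton_add]; abel
    · have := ih w₁ u₁ (a + c₁) c (by rw [Sym2.eq_swap]; simp only; ring_nf)
      refine (of_split (u := v) (w := w₁) hv₁ rfl this).congr ?_
      rw [Sym2.eq_swap]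
      simp only [← Multiset.singleton_add]; abel
  · rintro u₁ v₁ w₁ a₁ c₁ e N hv₁ ih u w a c he
    have := ih u w a c he
    refine (of_split (u := u₁) (w := w₁) (a := a₁) (c := c₁) hv₁ rfl
      (N := (s(v, u), a) ::ₘ (s(v, w), c) ::ₘ N) (this.congr ?_)).congr ?_
    · simp only [← Multiset.singleton_add]; abel
    · rw [Sym2.eq_swap (a := v₁) (b := u₁)]
      simp only [← Multiset.singleton_add]; abel

/-- Undoing a split at a vertex, whether it is a root or not. -/
theorem unsplit {u w : V} {a c l : ZMod 2} (v : V) (hl : l = a + c)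
    (h : Flood B ((s(u, w), l) ::ₘ N) n) : Flood B ((s(v, u), a) ::ₘ (s(v, w), c) ::ₘ N) n := by
  by_cases hv : v ∈ B
  · exact cut_root hv hl h
  · exact of_split hv hl h

theorem mono_root {B' : Set V} (hB : B ⊆ B') (h : Flood B M n) : Flood B' M n := by
  induction h with
  | base h hn => exact base (fun e he v hv => hB (h e he v hv)) hn
  | @split u v w _ _ _ _ _ _ ih => rw [Sym2.eq_swap (a := u)]; exact unsplit v rfl ih

/-- The end of an edge may be moved from one root to another. -/
theorem move_root {w x y : V} {a : ZMod 2} (hx : x ∈ B) (hy : y ∈ B)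
    (h : Flood B ((s(w, x), a) ::ₘ N) n) : Flood B ((s(w, y), a) ::ₘ N) n := by
  refine track (B := B) (n := n) (P := fun e N => ∀ w a, e = (s(w, x), a) →
    Flood B ((s(w, y), a) ::ₘ N) n) ?_ ?_ ?_ h rfl w a rfl
  · rintro _ N h1 h2 w a rfl
    have hw : w ∈ B := h1 (s(w, x), a) (by simp) w (by simp)
    have hN : ∀ e ∈ N, ∀ v ∈ e.1, v ∈ B := fun e he => h1 e (by simp [he])
    refine base ?_ (by simpa using h2)
    simp only [Multiset.mem_cons, forall_eq_or_imp, Sym2.mem_iff, forall_eq]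
    exact ⟨⟨hw, hy⟩, hN⟩
  · rintro u₁ v₁ w₁ a₁ c₁ N hv₁ ih w a he
    obtain ⟨he, rfl⟩ := Prod.ext_iff.1 he
    rcases Sym2.eq_iff.1 he with ⟨rfl, rfl⟩ | ⟨rfl, rfl⟩
    · exact absurd hx hv₁
    · have := ih w₁ (a₁ + c₁) (by rw [Sym2.eq_swap])
      exact of_split (u := y) hv₁ rfl (this.congr (by rw [Sym2.eq_swap]))
  · rintro u₁ v₁ w₁ a₁ c₁ e N hv₁ ih w a he
    have := ih w a he
    refine (of_split (u := u₁) (w := w₁) (a := a₁) (c := c₁) hv₁ rfl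
      (N := (s(w, y), a) ::ₘ N) (this.congr (cons_left_comm _ _ _))).congr ?_
    rw [Sym2.eq_swap (a := v₁) (b := u₁)]
    simp only [← Multiset.singleton_add]; abel

/-- Whether there is a flood at all does not depend on the labels. -/
theorem relabel {f : Sym2 V} {a : ZMod 2} (a' : ZMod 2)
    (h : Flood B ((f, a) ::ₘ N) 0) : Flood B ((f, a') ::ₘ N) 0 := by
  refine track (B := B) (n := 0) (P := fun e N => ∀ a',
    Flood B ((e.1, a') ::ₘ N) 0) ?_ ?_ ?_ h rfl a'
  · rintro e N h1 h2 a'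
    refine base ?_ (Nat.zero_le _)
    simp only [Multiset.mem_cons, forall_eq_or_imp] at h1 ⊢
    exact h1
  · rintro u₁ v₁ w₁ a₁ c₁ N hv₁ ih a'
    exact split hv₁ (ih (a' + c₁))
  · rintro u₁ v₁ w₁ a₁ c₁ e N hv₁ ih a'
    refine (split (u := u₁) (w := w₁) (a := a₁) (c := c₁) hv₁
      (N := (e.1, a') ::ₘ N) ((ih a').congr (cons_left_comm _ _ _))).congr ?_
    simp only [← Multiset.singleton_add]; abel

/-- An edge between roots is a trail of its own in every flood, and may be left out. -/
theorem of_cons_root {e : Sym2 V × ZMod 2} (he : ∀ v ∈ e.1, v ∈ B) {m : ℕ} (hm : e.2.val + m ≤ n)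
    (h : Flood B (e ::ₘ N) n) : Flood B N m := by
  refine track (B := B) (n := n) (P := fun e N => (∀ v ∈ e.1, v ∈ B) → e.2.val + m ≤ n →
    Flood B N m) ?_ ?_ ?_ h rfl he hm
  · rintro e N h1 h2 - hm
    refine base (fun e he => h1 e (by simp [he])) ?_
    simp only [ones_cons] at h2
    omega
  · rintro u v w a c N hv - he
    exact absurd (he v (by simp)) hv
  · rintro u v w a c e N hv ih he hm
    exact split hv (ih he hm)

theorem add (h : Flood B M n) {n' : ℕ} (h' : Flood B N n') : Flood B (M + N) (n + n') := by
  induction h with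
  | @base M n h hn =>
    induction h' with
    | base h' hn' =>
      refine base (fun e he => (Multiset.mem_add.1 he).elim (h e) (h' e)) ?_
      rw [ones_add]; omega
    | @split u v w a c N m hv h' ih =>
      rw [Multiset.add_cons, Multiset.add_cons]
      refine split hv (ih.congr (by rw [Multiset.add_cons]))
  | @split u v w a c N m hv h ih =>
    rw [Multiset.cons_add, Multiset.cons_add]
    exact split hv (ih.congr (by rw [Multiset.cons_add]))

/-- The number of non-zero trails has the parity of the total weight, so a value of the other parity
can be raised by one. -/
theorem succ_of_ne (h : Flood B M n) (hn : (n : ZMod 2) ≠ (M.map Prod.snd).sum) :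
    Flood B M (n + 1) := by
  induction h with
  | @base M n h hn' =>
    refine base h (lt_of_le_of_ne hn' ?_)
    rintro rfl
    refine hn ?_
    simp [ones, Multiset.map_map]
  | @split u v w a c N m hv h ih =>
    refine split hv (ih ?_)
    simpa [add_assoc] using hn

end Flood

/-! ### Common reductions -/

/-- The number of ends of an edge that are equal to `v`. -/
noncomputable def ends (v : V) (f : Sym2 V) : ℕ :=
  open Classical in f.lift ⟨fun x y => (if x = v then 1 else 0) + (if y = v then 1 else 0),
    fun _ _ => add_comm _ _⟩

open Classical in
@[simp] theorem ends_mk (v x y : V) :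
    ends v s(x, y) = (if x = v then 1 else 0) + (if y = v then 1 else 0) := rfl

/-- The degree of `v`; a loop at `v` counts twice. -/
noncomputable def deg (M : Multiset (Sym2 V × ZMod 2)) (v : V) : ℕ := (M.map fun e => ends v e.1).sum

@[simp] theorem deg_zero (v : V) : deg (0 : Multiset (Sym2 V × ZMod 2)) v = 0 := rfl

@[simp] theorem deg_cons (e : Sym2 V × ZMod 2) (M : Multiset (Sym2 V × ZMod 2)) (v : V) :
    deg (e ::ₘ M) v = ends v e.1 + deg M v := by simp [deg]

@[simp] theorem deg_add (M N : Multiset (Sym2 V × ZMod 2)) (v : V) :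
    deg (M + N) v = deg M v + deg N v := by simp [deg]

theorem ends_eq_zero {v : V} {f : Sym2 V} : ends v f = 0 ↔ v ∉ f := by
  induction f with | _ x y => simp [eq_comm, ends_mk]

theorem deg_eq_zero {v : V} {M : Multiset (Sym2 V × ZMod 2)} :
    deg M v = 0 ↔ ∀ e ∈ M, v ∉ e.1 := by
  simp only [deg, Multiset.sum_eq_zero_iff, Multiset.mem_map, forall_exists_index, and_imp,
    forall_apply_eq_imp_iff₂, ends_eq_zero]

/-- `M` can be turned into `K` by splits at vertices outside `S`. -/
inductive Reduces (S : Set V) (M : Multiset (Sym2 V × ZMod 2)) :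
    Multiset (Sym2 V × ZMod 2) → Prop
  | refl : Reduces S M M
  | split {p q v : V} {a c : ZMod 2} {N : Multiset (Sym2 V × ZMod 2)} (hv : v ∉ S)
      (h : Reduces S M ((s(v, p), a) ::ₘ (s(v, q), c) ::ₘ N)) :
      Reduces S M ((s(p, q), a + c) ::ₘ N)

namespace Reduces

variable {S : Set V} {M K : Multiset (Sym2 V × ZMod 2)} {n : ℕ}

theorem flood {B : Set V} (h : Reduces S M K) (hK : Flood B K n) : Flood B M n := by
  induction h with
  | refl => exact hK
  | @split p q v a c N hv h ih => exact ih (hK.unsplit v rfl)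

theorem deg_eq (h : Reduces S M K) {v : V} (hv : v ∈ S) : deg K v = deg M v := by
  induction h with
  | refl => rfl
  | @split p q w a c N hw h ih =>
    have : w ≠ v := fun e => hw (e ▸ hv)
    rw [← ih]; simp [this]; ring

theorem sum_eq (h : Reduces S M K) : (K.map Prod.snd).sum = (M.map Prod.snd).sum := by
  induction h with
  | refl => rfl
  | split hw h ih => rw [← ih]; simp [add_assoc]

theorem mem {e : Sym2 V × ZMod 2} (h : Reduces S M K) (he : e ∈ M) (heS : ∀ v ∈ e.1, v ∈ S) :
    e ∈ K := by
  induction h with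
  | refl => exact he
  | @split p q w a c N hw h ih =>
    simp only [Multiset.mem_cons] at ih ⊢
    rcases ih with rfl | rfl | h
    · exact absurd (heS w (by simp)) hw
    · exact absurd (heS w (by simp)) hw
    · exact Or.inr h

theorem trans {L : Multiset (Sym2 V × ZMod 2)} (h : Reduces S M K) (h' : Reduces S K L) :
    Reduces S M L := by
  induction h' with
  | refl => exact h
  | split hv _ ih => exact split hv ih

end Reduces

/-- Two floods with different root sets share a reduction to edges between the roots of either of
them. So the values of both can be read off from one and the same multigraph `K` on few vertices. -/
theorem Flood.common_reduce {B₁ B₂ : Set V} {M : Multiset (Sym2 V × ZMod 2)} {n₁ n₂ : ℕ}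
    (h₁ : Flood B₁ M n₁) (h₂ : Flood B₂ M n₂) :
    ∃ K, Reduces (B₁ ∪ B₂) M K ∧ Flood B₁ K n₁ ∧ Flood B₂ K n₂ ∧
      ∀ e ∈ K, ∀ v ∈ e.1, v ∈ B₁ ∪ B₂ := by
  induction hm : M.card using Nat.strong_induction_on generalizing M with
  | _ m ih =>
    by_cases hM : ∀ e ∈ M, ∀ v ∈ e.1, v ∈ B₁ ∪ B₂
    · exact ⟨M, .refl, h₁, h₂, hM⟩
    push Not at hM
    obtain ⟨⟨e, a⟩, he, v, hv, hvB⟩ := hM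
    obtain ⟨x, rfl⟩ := hv
    obtain ⟨N, rfl⟩ := Multiset.exists_cons_of_mem he
    obtain ⟨p, q, c, d, N', hN, h1, h2⟩ :=
      h₁.common_split h₂ (fun h => hvB (Or.inl h)) (fun h => hvB (Or.inr h))
    rw [hN] at hm ⊢
    obtain ⟨K, hK, h⟩ := ih _ (by rw [← hm]; simp) h1 h2 rfl
    exact ⟨K, (Reduces.split hvB .refl).trans hK, h⟩

end SignedMultigraph

namespace SignedMultigraph

variable {V : Type*} {B : Set V} {M N K : Multiset (Sym2 V × ZMod 2)} {n k : ℕ}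

/-! ### Roots of degree two -/

/-- All ends of the edges of `M` lie in `S`. -/
def Within (S : Set V) (M : Multiset (Sym2 V × ZMod 2)) : Prop := ∀ e ∈ M, ∀ v ∈ e.1, v ∈ S

@[simp] theorem within_cons {S : Set V} {u v : V} {a : ZMod 2} :
    Within S ((s(u, v), a) ::ₘ M) ↔ (u ∈ S ∧ v ∈ S) ∧ Within S M := by
  simp only [Within, Multiset.mem_cons, forall_eq_or_imp, Sym2.mem_iff, forall_eq]

theorem Within.mono {S S' : Set V} (h : Within S M) (hS : S ⊆ S') : Within S' M :=
  fun e he v hv => hS (h e he v hv)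

theorem Within.of_insert {S : Set V} {x : V} (h : Within (insert x S) M) (hx : deg M x = 0) :
    Within S M := by
  intro e he v hv
  refine (h e he v hv).resolve_left ?_
  rintro rfl
  exact deg_eq_zero.1 hx e he hv

theorem Within.deg_eq_zero {S : Set V} {x : V} (h : Within S M) (hx : x ∉ S) : deg M x = 0 :=
  SignedMultigraph.deg_eq_zero.2 fun e he hxe => hx (h e he x hxe)

/-- The edges at a vertex of degree two. -/
theorem two_edges {y : V} (h : deg M y = 2) :
    (∃ t t' a c N, M = (s(y, t), a) ::ₘ (s(y, t'), c) ::ₘ N ∧ t ≠ y ∧ t' ≠ y ∧ deg N y = 0) ∨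
      ∃ a N, M = (s(y, y), a) ::ₘ N ∧ deg N y = 0 := by
  have one : ∀ {M : Multiset (Sym2 V × ZMod 2)}, deg M y ≠ 0 →
      ∃ t a N, M = (s(y, t), a) ::ₘ N := by
    intro M h
    rw [Ne, deg_eq_zero] at h
    push Not at h
    obtain ⟨⟨e, a⟩, he, t, rfl⟩ := h
    obtain ⟨N, rfl⟩ := Multiset.exists_cons_of_mem he
    exact ⟨t, a, N, rfl⟩
  obtain ⟨t, a, N, rfl⟩ := one (M := M) (by omega)
  by_cases ht : t = y
  · subst ht
    right
    exact ⟨a, N, rfl, by simp at h; omega⟩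
  · left
    simp only [deg_cons, ends_mk, if_true, ht, if_false] at h
    obtain ⟨t', c, N, rfl⟩ := one (M := N) (by omega)
    refine ⟨t, t', a, c, N, rfl, ht, ?_, ?_⟩
    · rintro rfl
      simp at h
      omega
    · simp only [deg_cons, ends_mk, if_true] at h
      omega

namespace Flood

theorem not_loop {y : V} {a : ZMod 2} (hy : y ∉ B) (h : Flood B ((s(y, y), a) ::ₘ N) n) :
    deg N y ≠ 0 := by
  obtain ⟨t, c, N, rfl, -⟩ := partner h hy rfl
  simp

theorem two_edges {y : V} (hy : y ∉ B) (h : Flood B M n) (hd : deg M y = 2) :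
    ∃ t t' a c N, M = (s(y, t), a) ::ₘ (s(y, t'), c) ::ₘ N ∧ t ≠ y ∧ t' ≠ y ∧ deg N y = 0 := by
  rcases SignedMultigraph.two_edges hd with h1 | ⟨a, N, rfl, h1⟩
  · exact h1
  · exact absurd h1 (not_loop hy h)

/-- A split at a vertex of degree two that is not a root is forced. -/
theorem split_two {y t t' : V} {a c : ZMod 2} (hy : y ∉ B) (hN : deg N y = 0)
    (h : Flood B ((s(y, t), a) ::ₘ (s(y, t'), c) ::ₘ N) n) :
    Flood B ((s(t, t'), a + c) ::ₘ N) n := by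
  obtain ⟨x, d, N', h1, h2⟩ := partner h hy rfl
  rcases Multiset.cons_eq_cons.1 h1 with ⟨h3, rfl⟩ | ⟨-, N₃, rfl, rfl⟩
  · obtain ⟨h3, rfl⟩ := Prod.ext_iff.1 h3
    obtain rfl := Sym2.congr_right.1 h3
    exact h2
  · simp at hN

end Flood

theorem val_three (a c d : ZMod 2) : a.val + c.val + d.val ≤ (a + c + d).val + 2 := by
  revert a c d; decide

/-- Turning two adjacent roots `z`, `z'` of degree two into ordinary vertices loses at most two
non-zero trails: in a common reduction with some flood for the roots `B` there is a path `p z z' q` with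
`p`, `q` in `B`, and its three edges become one trail. -/
theorem Flood.glue {z z' : V} {c : ZMod 2} (hz : z ∉ B) (hz' : z' ∉ B) (hne : z ≠ z')
    (hd : deg M z = 2) (hd' : deg M z' = 2) (hc : (s(z, z'), c) ∈ M)
    (h : Flood (insert z (insert z' B)) M (n + 2)) (h₀ : Flood B M 0) : Flood B M n := by
  obtain ⟨K, hK, h1, h2, h3⟩ := h.common_reduce h₀
  refine (hK.flood ?_).mono_root (B := B) subset_rfl
  rw [← hK.deg_eq (by simp)] at hd hd'
  replace hc := hK.mem hc (by simp)
  obtain ⟨K, rfl⟩ := Multiset.exists_cons_of_mem hc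
  obtain ⟨p, a, K, rfl, h4⟩ := h2.partner hz rfl
  obtain ⟨q, d, K, h5, h6⟩ := h4.partner hz' rfl
  subst h5
  have hp : p ≠ z := by rintro rfl; simp at hd; omega
  have hp' : p ≠ z' := by rintro rfl; simp at hd'; omega
  have hq : q ≠ z := by rintro rfl; simp at hd; omega
  have hq' : q ≠ z' := by rintro rfl; simp at hd'; omega
  have hk : deg K z = 0 := by simp at hd; omega
  have hk' : deg K z' = 0 := by simp at hd'; omega
  have hn := h1.le_ones (fun e he v hv => by
    have := h3 e he v hv
    simp only [Set.mem_union, Set.mem_insert_iff] at this ⊢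
    tauto)
  rw [deg_eq_zero] at hk hk'
  simp only [Multiset.mem_cons, forall_eq_or_imp, Sym2.mem_iff, forall_eq, Set.mem_union,
    Set.mem_insert_iff] at h3
  refine of_split (u := z') (w := p) (l := c + a) hz rfl ?_
  refine (of_split (u := p) (w := q) (a := c + a) (c := d) (l := c + a + d) (N := K) hz' rfl
    (base ?_ ?_))
  · simp only [Multiset.mem_cons, forall_eq_or_imp, Sym2.mem_iff, forall_eq]
    have hB : ∀ v, v ≠ z → v ≠ z' → ((v = z ∨ v = z' ∨ v ∈ B) ∨ v ∈ B) → v ∈ B := by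
      rintro v h h' ((h'' | h'' | h'') | h'') <;> first | assumption | contradiction
    refine ⟨⟨hB p hp hp' h3.2.1.2, hB q hq hq' h3.2.2.1.2⟩, fun e he v hv => ?_⟩
    refine hB v ?_ ?_ (h3.2.2.2 e he v hv)
    · rintro rfl; exact hk e he hv
    · rintro rfl; exact hk' e he hv
  · simp only [ones_cons] at hn ⊢
    have := val_three c a d
    omega

theorem one_edge {y : V} (h : deg M y = 1) :
    ∃ t a N, M = (s(y, t), a) ::ₘ N ∧ t ≠ y ∧ deg N y = 0 := by
  have h' : deg M y ≠ 0 := by omega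
  rw [Ne, deg_eq_zero] at h'
  push Not at h'
  obtain ⟨⟨e, a⟩, he, t, rfl⟩ := h'
  obtain ⟨N, rfl⟩ := Multiset.exists_cons_of_mem he
  have ht : t ≠ y := by rintro rfl; simp at h; omega
  refine ⟨t, a, N, rfl, ht, ?_⟩
  simp [ht] at h
  exact h

theorem mem_of_mem_insert₂ {x y t : V} (h : t ∈ insert x (insert y B)) (hx : t ≠ x)
    (hy : t ≠ y) : t ∈ B := (h.resolve_left hx).resolve_left hy

/-! ### The exchange property of cuts -/

section Exchange

variable {x y z : V}

/-- The case of a path `s x y t`: gluing `x` and `y` together loses at most two non-zero trails. -/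
theorem exchange_path {s t : V} {a b c : ZMod 2} (hx : x ∉ B) (hy : y ∉ B)
    (hs : s ∈ B) (ht : t ∈ B) (hN : Within B N)
    (hS : Flood (insert x (insert y B)) ((s(x, y), a) ::ₘ (s(x, s), b) ::ₘ (s(y, t), c) ::ₘ N)
      (k + 4)) :
    Flood B ((s(x, y), a) ::ₘ (s(x, s), b) ::ₘ (s(y, t), c) ::ₘ N) (k + 1) := by
  have h := hS.le_ones (show Within _ _ by
    simp [hs, ht]; exact hN.mono (fun v hv => by simp [hv]))
  refine Flood.of_split hx rfl (Flood.of_split hy rfl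
    (Flood.base (show Within _ _ by simp [hs, ht, hN]) ?_))
  have := val_three a b c
  simp only [ones_cons] at h ⊢
  omega

/-- The case in which all neighbours of `x`, `y`, `z` lie in `B`. Then the gains of making them roots are
independent of each other. -/
theorem exchange_apart {s s' t t' p q : V} {a b c d e f : ZMod 2}
    (hx : x ∉ B) (hy : y ∉ B) (hz : z ∉ B) (hxy : x ≠ y) (hxz : x ≠ z) (hyz : y ≠ z)
    (hs : s ∈ B) (hs' : s' ∈ B) (ht : t ∈ B) (ht' : t' ∈ B) (hp : p ∈ B) (hq : q ∈ B)
    (hN : Within B N)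
    (hM : M = (s(z, p), e) ::ₘ (s(z, q), f) ::ₘ (s(x, s), a) ::ₘ (s(x, s'), b) ::ₘ
      (s(y, t), c) ::ₘ (s(y, t'), d) ::ₘ N)
    (hS : Flood (insert x (insert y B)) M (k + 4)) (hT : Flood (insert z B) M (k + 2)) :
    Flood B M (k + 1) ∨ Flood (insert x (insert z B)) M (k + 4) ∨
      Flood (insert y (insert z B)) M (k + 4) := by
  subst hM
  have hNx := hN.deg_eq_zero hx
  have hNy := hN.deg_eq_zero hy
  have hNz := hN.deg_eq_zero hz
  have ne : ∀ {u v : V}, u ∈ B → v ∉ B → u ≠ v := fun hu hv e => hv (e ▸ hu)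
  have h1 := (hS.split_two (by simp [hz, hxz.symm, hyz.symm])
    (by simp [hNz, ne hs hz, ne hs' hz, ne ht hz, ne ht' hz, hxz, hyz])).le_ones
    (show Within _ _ by
      simp [hs, hs', ht, ht', hp, hq]; exact hN.mono (fun v hv => by simp [hv]))
  have h2 := (((hT.congr (N := (s(x, s), a) ::ₘ (s(x, s'), b) ::ₘ
      (s(y, t), c) ::ₘ (s(y, t'), d) ::ₘ (s(z, p), e) ::ₘ (s(z, q), f) ::ₘ N)
      (by simp only [← Multiset.singleton_add]; abel)).split_two (by simp [hx, hxz])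
      (by simp [hNx, ne hp hx, ne hq hx, ne ht hx, ne ht' hx, hxz.symm, hxy.symm])).congr
      (N := (s(y, t), c) ::ₘ (s(y, t'), d) ::ₘ (s(s, s'), a + b) ::ₘ (s(z, p), e) ::ₘ
        (s(z, q), f) ::ₘ N) (by simp only [← Multiset.singleton_add]; abel)).split_two
      (by simp [hy, hyz])
      (by simp [hNy, ne hp hy, ne hq hy, ne hs hy, ne hs' hy, hyz.symm]) |>.le_ones
    (show Within _ _ by
      simp [hs, hs', ht, ht', hp, hq]; exact hN.mono (fun v hv => by simp [hv]))
  have h3 : (a + b).val + 2 ≤ a.val + b.val ∨ (c + d).val + 2 ≤ c.val + d.val ∨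
      a.val + b.val + (c.val + d.val) ≤ (a + b).val + (c + d).val := by
    clear * -; revert a b c d; decide
  simp only [ones_cons] at h1 h2
  rcases h3 with h3 | h3 | h3
  · right; left
    refine (Flood.of_split (v := y) (u := t) (w := t') (a := c) (c := d) (by simp [hy, hxy.symm, hyz]) rfl
      (Flood.base (M := _ ::ₘ (s(z, p), e) ::ₘ (s(z, q), f) ::ₘ (s(x, s), a) ::ₘ (s(x, s'), b) ::ₘ N)
      (show Within _ _ by
      simp [hs, hs', ht, ht', hp, hq]; exact hN.mono (fun v hv => by simp [hv])) ?_)).congr ?_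
    · simp only [ones_cons]; omega
    · simp only [← Multiset.singleton_add]; abel
  · right; right
    refine (Flood.of_split (v := x) (u := s) (w := s') (a := a) (c := b) (by simp [hx, hxy, hxz]) rfl
      (Flood.base (M := _ ::ₘ (s(z, p), e) ::ₘ (s(z, q), f) ::ₘ (s(y, t), c) ::ₘ (s(y, t'), d) ::ₘ N)
      (show Within _ _ by
      simp [hs, hs', ht, ht', hp, hq]; exact hN.mono (fun v hv => by simp [hv])) ?_)).congr ?_
    · simp only [ones_cons]; omega
    · simp only [← Multiset.singleton_add]; abel
  · left
    refine Flood.of_split hz rfl ?_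
    refine (Flood.of_split (u := s) (w := s') (a := a) (c := b) hx rfl
      ((Flood.of_split (u := t) (w := t') (a := c) (c := d) hy rfl
      (Flood.base (M := _ ::ₘ (s(p, q), e + f) ::ₘ (s(s, s'), a + b) ::ₘ N)
      (show Within _ _ by simp [hs, hs', ht, ht', hp, hq, hN]) ?_)).congr
      (N := (s(s, s'), a + b) ::ₘ (s(y, t), c) ::ₘ (s(y, t'), d) ::ₘ (s(p, q), e + f) ::ₘ N)
      ?_)).congr ?_
    · simp only [ones_cons]; omega
    all_goals simp only [← Multiset.singleton_add]; abel

/-- The case in which `z` is adjacent to `x` and no other two of `x`, `y`, `z` are adjacent. -/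
theorem exchange_near {s t t' q : V} {a b c d e : ZMod 2}
    (hx : x ∉ B) (hy : y ∉ B) (hz : z ∉ B) (hxy : x ≠ y) (hxz : x ≠ z) (hyz : y ≠ z)
    (hs : s ∈ B) (ht : t ∈ B) (ht' : t' ∈ B) (hq : q ∈ B) (hN : Within B N)
    (hM : M = (s(z, x), a) ::ₘ (s(z, q), e) ::ₘ (s(x, s), b) ::ₘ
      (s(y, t), c) ::ₘ (s(y, t'), d) ::ₘ N)
    (hS : Flood (insert x (insert y B)) M (k + 4)) (hT : Flood (insert z B) M (k + 2)) :
    Flood B M (k + 1) ∨ Flood (insert y (insert z B)) M (k + 4) := by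
  subst hM
  have hNx := hN.deg_eq_zero hx
  have hNy := hN.deg_eq_zero hy
  have hNz := hN.deg_eq_zero hz
  have ne : ∀ {u v : V}, u ∈ B → v ∉ B → u ≠ v := fun hu hv e => hv (e ▸ hu)
  have h1 := (hS.split_two (by simp [hz, hxz.symm, hyz.symm])
    (by simp [hNz, ne hs hz, ne ht hz, ne ht' hz, hxz, hyz])).le_ones
    (show Within _ _ by
      simp [hs, ht, ht', hq]; exact hN.mono (fun v hv => by simp [hv]))
  have h2 := (((hT.congr (N := (s(x, z), a) ::ₘ (s(x, s), b) ::ₘ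
      (s(y, t), c) ::ₘ (s(y, t'), d) ::ₘ (s(z, q), e) ::ₘ N)
      (by rw [Sym2.eq_swap (a := x) (b := z)]; simp only [← Multiset.singleton_add]; abel)).split_two
      (by simp [hx, hxz])
      (by simp [hNx, ne hq hx, ne ht hx, ne ht' hx, hxz.symm, hxy.symm])).congr
      (N := (s(y, t), c) ::ₘ (s(y, t'), d) ::ₘ (s(z, s), a + b) ::ₘ (s(z, q), e) ::ₘ
        N) (by simp only [← Multiset.singleton_add]; abel)).split_two
      (by simp [hy, hyz])
      (by simp [hNy, ne hq hy, ne hs hy, hyz.symm]) |>.le_ones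
    (show Within _ _ by
      simp [hs, ht, ht', hq]; exact hN.mono (fun v hv => by simp [hv]))
  have h3 : (c + d).val + 2 ≤ c.val + d.val ∨
      (a + e).val + b.val + (c.val + d.val) ≤ (a + e + b).val + (c + d).val + 2 := by
    clear * -; revert a b c d e; decide
  simp only [ones_cons] at h1 h2
  rcases h3 with h3 | h3
  · right
    refine (Flood.of_split (v := x) (u := z) (w := s) (a := a) (c := b) (by simp [hx, hxy, hxz]) rfl
      (Flood.base (M := _ ::ₘ (s(z, q), e) ::ₘ (s(y, t), c) ::ₘ (s(y, t'), d) ::ₘ N)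
      (show Within _ _ by
      simp [hs, ht, ht', hq]; exact hN.mono (fun v hv => by simp [hv])) ?_)).congr ?_
    · simp only [ones_cons]; omega
    · rw [Sym2.eq_swap (a := x) (b := z)]; simp only [← Multiset.singleton_add]; abel
  · left
    refine Flood.of_split hz rfl ?_
    rw [Sym2.eq_swap]
    refine (Flood.split (a := a + e) (c := b) hx
      ((Flood.of_split (u := t) (w := t') (a := c) (c := d) hy rfl
      (Flood.base (M := _ ::ₘ (s(q, s), a + e + b) ::ₘ N)
      (show Within _ _ by simp [hs, ht, ht', hq, hN]) ?_)).congr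
      ?_))
    · simp only [ones_cons]; omega
    · simp only [← Multiset.singleton_add]; abel

/-- The case in which both edges at `z` lead to `x`: then `x` and `z` play the same role. -/
theorem exchange_double {t t' : V} {a b c d : ZMod 2}
    (hx : x ∉ B) (hz : z ∉ B) (hxy : x ≠ y) (hxz : x ≠ z) (hyz : y ≠ z)
    (ht : t ∈ B) (ht' : t' ∈ B) (hN : Within B N)
    (hM : M = (s(z, x), a) ::ₘ (s(z, x), b) ::ₘ (s(y, t), c) ::ₘ (s(y, t'), d) ::ₘ N)
    (hS : Flood (insert x (insert y B)) M (k + 4)) :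
    Flood (insert y (insert z B)) M (k + 4) := by
  subst hM
  have hNz := hN.deg_eq_zero hz
  have ne : ∀ {u v : V}, u ∈ B → v ∉ B → u ≠ v := fun hu hv e => hv (e ▸ hu)
  have h1 := (hS.split_two (by simp [hz, hxz.symm, hyz.symm])
    (by simp [hNz, ne ht hz, ne ht' hz, hyz])).le_ones
    (show Within _ _ by
      simp [ht, ht']; exact hN.mono (fun v hv => by simp [hv]))
  rw [Sym2.eq_swap]
  refine Flood.of_split (by simp [hx, hxy, hxz]) rfl (Flood.base
    (show Within _ _ by simp [ht, ht']; exact hN.mono (fun v hv => by simp [hv])) ?_)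
  simp only [ones_cons] at h1 ⊢
  omega

/-- The case of a triangle `x y z`, where the parity of `k` is needed. -/
theorem exchange_cycle {a b c : ZMod 2}
    (hx : x ∉ B) (hy : y ∉ B) (hz : z ∉ B) (hxy : x ≠ y) (hxz : x ≠ z) (hyz : y ≠ z)
    (hN : Within B N) (hM : M = (s(z, x), a) ::ₘ (s(z, y), b) ::ₘ (s(x, y), c) ::ₘ N)
    (hk : (k : ZMod 2) = (M.map Prod.snd).sum)
    (hS : Flood (insert x (insert y B)) M (k + 4)) :
    Flood (insert x (insert z B)) M (k + 4) ∨ Flood (insert y (insert z B)) M (k + 4) := by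
  subst hM
  have hNz := hN.deg_eq_zero hz
  have h1 := (hS.split_two (by simp [hz, hxz.symm, hyz.symm])
    (by simp [hNz, hyz, hxz])).le_ones
    (show Within _ _ by simp; exact hN.mono (fun v hv => by simp [hv]))
  have hk' : (k : ZMod 2) = ((a.val + b.val + c.val + ones N : ℕ) : ZMod 2) := by
    rw [hk]; simp [ones, Multiset.map_map]; ring
  rw [ZMod.natCast_eq_natCast_iff'] at hk'
  simp only [ones_cons] at h1
  have key : k + 4 ≤ (b + c).val + a.val + ones N ∨ k + 4 ≤ (a + c).val + b.val + ones N := by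
    have h01 : ∀ a : ZMod 2, a = 0 ∨ a = 1 := by decide
    have e1 : (1 : ZMod 2).val = 1 := rfl
    have e2 : ((1 : ZMod 2) + 1).val = 0 := rfl
    rcases h01 a with rfl | rfl <;> rcases h01 b with rfl | rfl <;> rcases h01 c with rfl | rfl <;>
      simp only [e1, e2, add_zero, zero_add, ZMod.val_zero] at * <;> omega
  rcases key with h | h
  · left
    refine (Flood.of_split (v := y) (u := z) (w := x) (a := b) (c := c) (by simp [hy, hxy.symm, hyz])
      rfl (Flood.base (M := _ ::ₘ (s(z, x), a) ::ₘ N) (show Within _ _ by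
      simp; exact hN.mono (fun v hv => by simp [hv])) ?_)).congr ?_
    · simp only [ones_cons]; omega
    · rw [Sym2.eq_swap (a := y), Sym2.eq_swap (a := y)]
      simp only [← Multiset.singleton_add]; abel
  · right
    refine (Flood.of_split (v := x) (u := z) (w := y) (a := a) (c := c) (by simp [hx, hxy, hxz])
      rfl (Flood.base (M := _ ::ₘ (s(z, y), b) ::ₘ N) (show Within _ _ by
      simp; exact hN.mono (fun v hv => by simp [hv])) ?_)).congr ?_
    · simp only [ones_cons]; omega
    · rw [Sym2.eq_swap (a := x) (b := z)]
      simp only [← Multiset.singleton_add]; abel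

/-- The exchange property for a completely reduced multigraph, if `z` has its neighbours in `B`. -/
theorem exchange_none {p q : V} {e f : ZMod 2}
    (hx : x ∉ B) (hy : y ∉ B) (hz : z ∉ B) (hxy : x ≠ y) (hxz : x ≠ z) (hyz : y ≠ z)
    (hp : p ∈ B) (hq : q ∈ B) (hN : Within (insert x (insert y B)) N)
    (hdx : deg N x = 2) (hdy : deg N y = 2)
    (hS : Flood (insert x (insert y B)) ((s(z, p), e) ::ₘ (s(z, q), f) ::ₘ N) (k + 4))
    (hT : Flood (insert z B) ((s(z, p), e) ::ₘ (s(z, q), f) ::ₘ N) (k + 2)) :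
    Flood B ((s(z, p), e) ::ₘ (s(z, q), f) ::ₘ N) (k + 1) ∨
      Flood (insert x (insert z B)) ((s(z, p), e) ::ₘ (s(z, q), f) ::ₘ N) (k + 4) ∨
      Flood (insert y (insert z B)) ((s(z, p), e) ::ₘ (s(z, q), f) ::ₘ N) (k + 4) := by
  have ne : ∀ {u v : V}, u ∈ B → v ∉ B → u ≠ v := fun hu hv e => hv (e ▸ hu)
  have hNz : deg N z = 0 := hN.deg_eq_zero (by simp [hxz.symm, hyz.symm, hz])
  -- the path `s x y t`
  have path : ∀ {s : V} {a b : ZMod 2} {N₁ : Multiset (Sym2 V × ZMod 2)},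
      N = (s(x, y), a) ::ₘ (s(x, s), b) ::ₘ N₁ → s ≠ x → deg N₁ x = 0 →
      Flood B ((s(z, p), e) ::ₘ (s(z, q), f) ::ₘ N) (k + 1) := by
    rintro s a b N₁ rfl hs hN₁
    simp only [deg_cons, ends_mk, if_true, if_neg hxy] at hdy
    have hsy : s ≠ y := by
      rintro rfl
      refine ((hT.congr (N := (s(x, s), a) ::ₘ (s(x, s), b) ::ₘ (s(z, p), e) ::ₘ (s(z, q), f) ::ₘ N₁)
        (by simp only [← Multiset.singleton_add]; abel)).split_two (by simp [hx, hxz])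
        (by simp [hN₁, hxz.symm, ne hp hx, ne hq hx])).not_loop (by simp [hy, hyz]) ?_
      simp only [if_true] at hdy
      simp [ne hp hy, ne hq hy, hyz.symm]
      omega
    simp only [if_neg hsy] at hdy
    obtain ⟨t, c, N₂, rfl, hty, hN₂⟩ := one_edge (M := N₁) (y := y) (by omega)
    simp only [within_cons] at hN
    have htx : t ≠ x := by rintro rfl; simp at hN₁
    simp only [deg_cons, ends_mk, if_neg htx, if_neg hxy.symm] at hN₁
    refine Flood.of_split hz rfl ?_
    refine (exchange_path (N := (s(p, q), e + f) ::ₘ N₂) (b := b) (a := a) (c := c)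
      (s := s) (t := t) hx hy (mem_of_mem_insert₂ hN.2.1.2 hs hsy)
      (mem_of_mem_insert₂ hN.2.2.1.2 htx hty) ?_ ((hS.split_two
      (by simp [hz, hxz.symm, hyz.symm]) hNz).congr ?_)).congr ?_
    · simp only [within_cons]
      exact ⟨⟨hp, hq⟩, (hN.2.2.2.of_insert (by omega)).of_insert (by omega)⟩
    all_goals simp only [← Multiset.singleton_add]; abel
  rcases two_edges hdx with ⟨s, s', a, b, N₁, rfl, hs, hs', hN₁⟩ | ⟨a, N₁, rfl, hN₁⟩
  · by_cases hsy : s = y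
    · subst hsy
      exact Or.inl (path rfl hs' hN₁)
    by_cases hs'y : s' = y
    · subst hs'y
      exact Or.inl (path (cons_left_comm _ _ _) hs hN₁)
    simp only [deg_cons, ends_mk, if_neg hxy, if_neg hsy, if_neg hs'y, zero_add] at hdy
    rcases two_edges hdy with ⟨t, t', c, d, N₂, rfl, ht, ht', hN₂⟩ | ⟨c, N₂, rfl, hN₂⟩
    · have htx : t ≠ x := by rintro rfl; simp at hN₁
      have ht'x : t' ≠ x := by rintro rfl; simp at hN₁
      simp only [deg_cons, ends_mk, if_neg hxy.symm, if_neg htx, if_neg ht'x, zero_add] at hN₁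
      simp only [within_cons] at hN
      exact exchange_apart hx hy hz hxy hxz hyz (s := s) (s' := s') (t := t) (t' := t')
        (mem_of_mem_insert₂ hN.1.2 hs hsy) (mem_of_mem_insert₂ hN.2.1.2 hs' hs'y)
        (mem_of_mem_insert₂ hN.2.2.1.2 htx ht) (mem_of_mem_insert₂ hN.2.2.2.1.2 ht'x ht') hp hq
        ((hN.2.2.2.2.of_insert hN₁).of_insert hN₂) rfl hS hT
    · refine absurd ?_ ((hT.congr (N := (s(y, y), c) ::ₘ (s(z, p), e) ::ₘ (s(z, q), f) ::ₘ
        (s(x, s), a) ::ₘ (s(x, s'), b) ::ₘ N₂)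
        (by simp only [← Multiset.singleton_add]; abel)).not_loop (by simp [hy, hyz]))
      simp [hyz.symm, ne hp hy, ne hq hy, hxy, hsy, hs'y, hN₂]
  · refine absurd ?_ ((hT.congr (N := (s(x, x), a) ::ₘ (s(z, p), e) ::ₘ (s(z, q), f) ::ₘ N₁)
      (by simp only [← Multiset.singleton_add]; abel)).not_loop (by simp [hx, hxz]))
    simp [hxz.symm, ne hp hx, ne hq hx, hN₁]

/-- The exchange property for a completely reduced multigraph, if `z` has one neighbour in `B` and is
adjacent to `x`. -/
theorem exchange_one {q : V} {e f : ZMod 2}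
    (hx : x ∉ B) (hy : y ∉ B) (hz : z ∉ B) (hxy : x ≠ y) (hxz : x ≠ z) (hyz : y ≠ z)
    (hq : q ∈ B) (hN : Within (insert x (insert y B)) N)
    (hdx : deg N x = 1) (hdy : deg N y = 2)
    (hS : Flood (insert x (insert y B)) ((s(z, x), e) ::ₘ (s(z, q), f) ::ₘ N) (k + 4))
    (hT : Flood (insert z B) ((s(z, x), e) ::ₘ (s(z, q), f) ::ₘ N) (k + 2)) :
    Flood B ((s(z, x), e) ::ₘ (s(z, q), f) ::ₘ N) (k + 1) ∨
      Flood (insert y (insert z B)) ((s(z, x), e) ::ₘ (s(z, q), f) ::ₘ N) (k + 4) := by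
  have ne : ∀ {u v : V}, u ∈ B → v ∉ B → u ≠ v := fun hu hv e => hv (e ▸ hu)
  have hNz : deg N z = 0 := hN.deg_eq_zero (by simp [hxz.symm, hyz.symm, hz])
  obtain ⟨s, b, N₁, rfl, hs, hN₁⟩ := one_edge hdx
  by_cases hsy : s = y
  · subst hsy
    simp only [deg_cons, ends_mk, if_true, if_neg hxy, zero_add] at hdy
    obtain ⟨t, c, N₂, rfl, hty, hN₂⟩ := one_edge (M := N₁) (y := s) (by omega)
    simp only [within_cons] at hN
    have htx : t ≠ x := by rintro rfl; simp at hN₁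
    simp only [deg_cons, ends_mk, if_neg htx, if_neg hxy.symm, zero_add] at hN₁
    left
    refine Flood.of_split hz rfl ?_
    refine (exchange_path (N := N₂) (b := e + f) (a := b) (c := c)
      (s := q) (t := t) hx hy hq (mem_of_mem_insert₂ hN.2.1.2 htx hty) ((hN.2.2.of_insert hN₁).of_insert hN₂) ((hS.split_two
      (by simp [hz, hxz.symm, hyz.symm]) hNz).congr ?_)).congr ?_
    all_goals simp only [← Multiset.singleton_add]; abel
  · simp only [deg_cons, ends_mk, if_neg hxy, if_neg hsy, zero_add] at hdy
    rcases two_edges hdy with ⟨t, t', c, d, N₂, rfl, ht, ht', hN₂⟩ | ⟨c, N₂, rfl, hN₂⟩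
    · have htx : t ≠ x := by rintro rfl; simp at hN₁
      have ht'x : t' ≠ x := by rintro rfl; simp at hN₁
      simp only [deg_cons, ends_mk, if_neg hxy.symm, if_neg htx, if_neg ht'x, zero_add] at hN₁
      simp only [within_cons] at hN
      exact exchange_near hx hy hz hxy hxz hyz (s := s) (t := t) (t' := t')
        (mem_of_mem_insert₂ hN.1.2 hs hsy) (mem_of_mem_insert₂ hN.2.1.2 htx ht)
        (mem_of_mem_insert₂ hN.2.2.1.2 ht'x ht') hq ((hN.2.2.2.of_insert hN₁).of_insert hN₂) rfl hS hT
    · refine absurd ?_ ((hT.congr (N := (s(y, y), c) ::ₘ (s(z, x), e) ::ₘ (s(z, q), f) ::ₘ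
        (s(x, s), b) ::ₘ N₂)
        (by simp only [← Multiset.singleton_add]; abel)).not_loop (by simp [hy, hyz]))
      simp [hyz.symm, ne hq hy, hxy, hsy, hN₂]

/-- The exchange property for a completely reduced multigraph, if both edges at `z` lead to `x`. -/
theorem exchange_loop {e f : ZMod 2}
    (hx : x ∉ B) (hy : y ∉ B) (hz : z ∉ B) (hxy : x ≠ y) (hxz : x ≠ z) (hyz : y ≠ z)
    (hN : Within (insert x (insert y B)) N)
    (hdx : deg N x = 0) (hdy : deg N y = 2)
    (hS : Flood (insert x (insert y B)) ((s(z, x), e) ::ₘ (s(z, x), f) ::ₘ N) (k + 4))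
    (hT : Flood (insert z B) ((s(z, x), e) ::ₘ (s(z, x), f) ::ₘ N) (k + 2)) :
    Flood (insert y (insert z B)) ((s(z, x), e) ::ₘ (s(z, x), f) ::ₘ N) (k + 4) := by
  rcases two_edges hdy with ⟨t, t', c, d, N₂, rfl, ht, ht', hN₂⟩ | ⟨c, N₂, rfl, hN₂⟩
  · have htx : t ≠ x := by rintro rfl; simp at hdx
    have ht'x : t' ≠ x := by rintro rfl; simp at hdx
    simp only [deg_cons, ends_mk, if_neg hxy.symm, if_neg htx, if_neg ht'x, zero_add] at hdx
    simp only [within_cons] at hN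
    exact exchange_double hx hz hxy hxz hyz (t := t) (t' := t')
      (mem_of_mem_insert₂ hN.1.2 htx ht) (mem_of_mem_insert₂ hN.2.1.2 ht'x ht')
      ((hN.2.2.of_insert hdx).of_insert hN₂) rfl hS
  · refine absurd ?_ ((hT.congr (N := (s(y, y), c) ::ₘ (s(z, x), e) ::ₘ (s(z, x), f) ::ₘ N₂)
      (by simp only [← Multiset.singleton_add]; abel)).not_loop (by simp [hy, hyz]))
    simp [hyz.symm, hxy, hN₂]

/-- The exchange property for a completely reduced multigraph, if `z` is adjacent to `x` and `y`. -/
theorem exchange_both {e f : ZMod 2}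
    (hx : x ∉ B) (hy : y ∉ B) (hz : z ∉ B) (hxy : x ≠ y) (hxz : x ≠ z) (hyz : y ≠ z)
    (hN : Within (insert x (insert y B)) N)
    (hdx : deg N x = 1) (hdy : deg N y = 1)
    (hk : (k : ZMod 2) = (((s(z, x), e) ::ₘ (s(z, y), f) ::ₘ N).map Prod.snd).sum)
    (hS : Flood (insert x (insert y B)) ((s(z, x), e) ::ₘ (s(z, y), f) ::ₘ N) (k + 4)) :
    Flood B ((s(z, x), e) ::ₘ (s(z, y), f) ::ₘ N) (k + 1) ∨
      Flood (insert x (insert z B)) ((s(z, x), e) ::ₘ (s(z, y), f) ::ₘ N) (k + 4) ∨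
      Flood (insert y (insert z B)) ((s(z, x), e) ::ₘ (s(z, y), f) ::ₘ N) (k + 4) := by
  have hNz : deg N z = 0 := hN.deg_eq_zero (by simp [hxz.symm, hyz.symm, hz])
  obtain ⟨s, b, N₁, rfl, hs, hN₁⟩ := one_edge hdx
  by_cases hsy : s = y
  · subst hsy
    simp only [deg_cons, ends_mk, if_true, if_neg hxy, zero_add] at hdy
    simp only [within_cons] at hN
    exact Or.inr (exchange_cycle hx hy hz hxy hxz hyz
      ((hN.2.of_insert hN₁).of_insert (by omega)) rfl hk hS)
  · simp only [deg_cons, ends_mk, if_neg hsy, if_neg hxy, zero_add] at hdy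
    obtain ⟨t, c, N₂, rfl, hty, hN₂⟩ := one_edge (M := N₁) (y := y) (by omega)
    simp only [within_cons] at hN
    have htx : t ≠ x := by rintro rfl; simp at hN₁
    simp only [deg_cons, ends_mk, if_neg htx, if_neg hxy.symm, zero_add] at hN₁
    left
    refine Flood.of_split hz rfl ?_
    exact exchange_path (N := N₂) (b := b) (a := e + f) (c := c)
      (s := s) (t := t) hx hy (mem_of_mem_insert₂ hN.1.2 hs hsy)
      (mem_of_mem_insert₂ hN.2.1.2 htx hty) ((hN.2.2.of_insert hN₁).of_insert hN₂)
      (hS.split_two (by simp [hz, hxz.symm, hyz.symm]) hNz)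

/-- The exchange property. Making the vertices `x`, `y`, `z` of degree two roots amounts to cutting
three edges. If cutting at `x` and `y` gains four and cutting at `z` gains two, then cutting at `z`
and at one of `x`, `y` gains four. -/
theorem Flood.exchange (hx : x ∉ B) (hy : y ∉ B) (hz : z ∉ B) (hxy : x ≠ y) (hxz : x ≠ z)
    (hyz : y ≠ z) (hdx : deg M x = 2) (hdy : deg M y = 2) (hdz : deg M z = 2)
    (hk : (k : ZMod 2) = (M.map Prod.snd).sum)
    (hS : Flood (insert x (insert y B)) M (k + 4)) (hT : Flood (insert z B) M (k + 2)) :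
    Flood B M (k + 1) ∨ Flood (insert x (insert z B)) M (k + 4) ∨
      Flood (insert y (insert z B)) M (k + 4) := by
  obtain ⟨K, hK, hS', hT', hR⟩ := hS.common_reduce hT
  suffices h : Flood B K (k + 1) ∨ Flood (insert x (insert z B)) K (k + 4) ∨
      Flood (insert y (insert z B)) K (k + 4) from
    h.imp hK.flood (Or.imp hK.flood hK.flood)
  rw [← hK.deg_eq (by simp)] at hdx hdy hdz
  rw [← hK.sum_eq] at hk
  clear hK hS hT
  obtain ⟨p, q, e, f, N, rfl, hp, hq, hN⟩ :=
    hS'.two_edges (y := z) (by simp [hz, hxz.symm, hyz.symm]) hdz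
  have hR' : Within _ _ := hR
  simp only [within_cons] at hR'
  have hW : Within (insert x (insert y B)) N := by
    refine Within.of_insert (x := z) (hR'.2.2.mono fun v hv => ?_) hN
    simp only [Set.mem_union, Set.mem_insert_iff] at hv ⊢
    tauto
  have mem : ∀ v, v ≠ z → v ∈ insert x (insert y B) ∪ insert z B → v = x ∨ v = y ∨ v ∈ B := by
    intro v hvz hv
    simp only [Set.mem_union, Set.mem_insert_iff] at hv
    tauto
  have hp' := mem p hp hR'.1.2
  have hq' := mem q hq hR'.2.1.2
  clear hR hR' mem
  have hS'' := Set.insert_comm x y B ▸ hS'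
  have ne : ∀ {u v : V}, u ∈ B → v ∉ B → u ≠ v := fun hu hv e => hv (e ▸ hu)
  have hW' := Set.insert_comm x y B ▸ hW
  simp only [deg_cons, ends_mk, if_neg hxz.symm, if_neg hyz.symm, zero_add] at hdx hdy
  rcases hp' with rfl | rfl | hpB
  · simp only [if_true, if_neg hxy] at hdx hdy
    rcases hq' with rfl | rfl | hqB
    · simp only [if_true, if_neg hxy] at hdx hdy
      exact Or.inr (Or.inr (exchange_loop hx hy hz hxy hxz hyz hW (by omega) (by omega) hS' hT'))
    · simp only [if_true, if_neg hxy.symm] at hdx hdy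
      exact exchange_both hx hy hz hxy hxz hyz hW (by omega) (by omega) hk hS'
    · simp only [if_neg (ne hqB hx), if_neg (ne hqB hy)] at hdx hdy
      exact (exchange_one hx hy hz hxy hxz hyz hqB hW (by omega) (by omega) hS' hT').imp_right
        Or.inr
  · simp only [if_true, if_neg hxy.symm] at hdx hdy
    rcases hq' with rfl | rfl | hqB
    · simp only [if_true, if_neg hxy] at hdx hdy
      have := exchange_both hy hx hz hxy.symm hyz hxz hW' (by omega) (by omega) hk hS''
      tauto
    · simp only [if_true, if_neg hxy.symm] at hdx hdy
      exact Or.inr (Or.inl (exchange_loop hy hx hz hxy.symm hyz hxz hW' (by omega) (by omega)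
        hS'' hT'))
    · simp only [if_neg (ne hqB hx), if_neg (ne hqB hy)] at hdx hdy
      exact (exchange_one hy hx hz hxy.symm hyz hxz hqB hW' (by omega) (by omega) hS'' hT').imp_right
        Or.inl
  · simp only [if_neg (ne hpB hx), if_neg (ne hpB hy), zero_add] at hdx hdy
    rcases hq' with rfl | rfl | hqB
    · simp only [if_true, if_neg hxy] at hdx hdy
      rw [cons_left_comm] at hS' hT' ⊢
      exact (exchange_one hx hy hz hxy hxz hyz hpB hW (by omega) (by omega) hS' hT').imp_right
        Or.inr
    · simp only [if_true, if_neg hxy.symm] at hdx hdy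
      rw [cons_left_comm] at hS'' hT' ⊢
      exact (exchange_one hy hx hz hxy.symm hyz hxz hpB hW' (by omega) (by omega) hS'' hT').imp_right
        Or.inl
    · simp only [if_neg (ne hqB hx), if_neg (ne hqB hy), zero_add] at hdx hdy
      exact exchange_none hx hy hz hxy hxz hyz hpB hqB hW hdx hdy hS' hT'

end Exchange

end SignedMultigraph

namespace SignedMultigraph

variable {V : Type*} {B : Set V} {M N : Multiset (Sym2 V × ZMod 2)} {n : ℕ}

/-! ### Dual certificates and the upper bound -/

/-- The label of an edge after shifting at the vertices `v` with `s v = 1`. -/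
def shifted (s : V → ZMod 2) (e : Sym2 V × ZMod 2) : ZMod 2 :=
  e.2 + e.1.lift ⟨fun x y => s x + s y, fun _ _ => add_comm _ _⟩

@[simp] theorem shifted_mk (s : V → ZMod 2) (u v : V) (a : ZMod 2) :
    shifted s (s(u, v), a) = a + (s u + s v) := rfl

open Classical in
/-- The number of ends of an edge that lie in `X`. -/
noncomputable def endsIn (X : Set V) (f : Sym2 V) : ℕ :=
  f.lift ⟨fun x y => (if x ∈ X then 1 else 0) + (if y ∈ X then 1 else 0), fun _ _ => add_comm _ _⟩

/-- Twice the contribution of an edge to `γ'(E(X)) + |δ(X)| / 2`. -/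
noncomputable def edgeCost (X : Set V) (s : V → ZMod 2) (e : Sym2 V × ZMod 2) : ℕ :=
  if endsIn X e.1 = 2 then 2 * (shifted s e).val else endsIn X e.1

/-- The contribution of an edge to `2 γ'(E(Y) ∪ δ(Y)) + |δ(Y)|` modulo `4`. -/
noncomputable def edgeLoad (Y : Set V) (s : V → ZMod 2) (e : Sym2 V × ZMod 2) : ZMod 4 :=
  if endsIn Y e.1 = 0 then 0 else
    2 * ((shifted s e).val : ZMod 4) + if endsIn Y e.1 = 1 then 1 else 0

open Classical in
theorem edgeCost_mk (X : Set V) (s : V → ZMod 2) (u v : V) (a : ZMod 2) :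
    edgeCost X s (s(u, v), a) =
      if u ∈ X then (if v ∈ X then 2 * (a + (s u + s v)).val else 1) else
        (if v ∈ X then 1 else 0) := by
  unfold edgeCost endsIn
  by_cases hu : u ∈ X <;> by_cases hv : v ∈ X <;> simp [hu, hv]

open Classical in
theorem edgeLoad_mk (Y : Set V) (s : V → ZMod 2) (u v : V) (a : ZMod 2) :
    edgeLoad Y s (s(u, v), a) =
      if u ∈ Y then (if v ∈ Y then 2 * ((a + (s u + s v)).val : ZMod 4)
        else 2 * ((a + (s u + s v)).val : ZMod 4) + 1) else
        (if v ∈ Y then 2 * ((a + (s u + s v)).val : ZMod 4) + 1 else 0) := by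
  unfold edgeLoad endsIn
  by_cases hu : u ∈ Y <;> by_cases hv : v ∈ Y <;> simp [hu, hv]

/-- The cost `2 γ'(E(X)) + |δ(X)|` of a set of vertices, where `γ'` is the signature shifted by `s`. -/
noncomputable def cost (X : Set V) (s : V → ZMod 2) (M : Multiset (Sym2 V × ZMod 2)) : ℕ :=
  (M.map (edgeCost X s)).sum

/-- The load `2 γ'(E(Y) ∪ δ(Y)) + |δ(Y)|` modulo `4` of a set of vertices, where `γ'` is the signature
shifted by `s`. A set `Y` with `|δ(Y)|` even is `γ'`-odd if and only if its load is `2`. -/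
noncomputable def load (Y : Set V) (s : V → ZMod 2) (M : Multiset (Sym2 V × ZMod 2)) : ZMod 4 :=
  (M.map (edgeLoad Y s)).sum

@[simp] theorem cost_cons (X : Set V) (s : V → ZMod 2) (e : Sym2 V × ZMod 2) :
    cost X s (e ::ₘ M) = edgeCost X s e + cost X s M := by simp [cost]

@[simp] theorem load_cons (Y : Set V) (s : V → ZMod 2) (e : Sym2 V × ZMod 2) :
    load Y s (e ::ₘ M) = edgeLoad Y s e + load Y s M := by simp [load]

/-- A collection `𝒴` of disjoint odd sets that are unions of components of `M - X`. Unions, instead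
of single components, make the notion stable under splitting off. -/
structure IsOddFamily (M : Multiset (Sym2 V × ZMod 2)) (X : Set V) (s : V → ZMod 2)
    (𝒴 : Finset (Set V)) : Prop where
  notMem : ∀ Y ∈ 𝒴, ∀ v ∈ Y, v ∉ X
  disjoint : ∀ Y ∈ 𝒴, ∀ Y' ∈ 𝒴, ∀ v ∈ Y, v ∈ Y' → Y = Y'
  closed : ∀ Y ∈ 𝒴, ∀ u v a, (s(u, v), a) ∈ M → u ∈ Y → v ∈ Y ∨ v ∈ X
  odd : ∀ Y ∈ 𝒴, load Y s M = 2

namespace IsOddFamily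

variable {X : Set V} {s : V → ZMod 2} {𝒴 : Finset (Set V)} {v p q : V} {a c : ZMod 2}

/-- `Y` remains an odd union of components if the edges `vp` and `vq` are split off at `v`. -/
def Survives (X : Set V) (s : V → ZMod 2) (v p q : V) (a c : ZMod 2) (Y : Set V) : Prop :=
  (p ∈ Y → q ∈ Y ∨ q ∈ X) ∧ (q ∈ Y → p ∈ Y ∨ p ∈ X) ∧
    edgeLoad Y s (s(p, q), a + c) = edgeLoad Y s (s(v, p), a) + edgeLoad Y s (s(v, q), c)

theorem survive (h : IsOddFamily ((s(v, p), a) ::ₘ (s(v, q), c) ::ₘ N) X s 𝒴)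
    {𝒴' : Finset (Set V)} (h𝒴 : 𝒴' ⊆ 𝒴) (hS : ∀ Y ∈ 𝒴', Survives X s v p q a c Y) :
    IsOddFamily ((s(p, q), a + c) ::ₘ N) X s 𝒴' where
  notMem Y hY := h.notMem Y (h𝒴 hY)
  disjoint Y hY Y' hY' := h.disjoint Y (h𝒴 hY) Y' (h𝒴 hY')
  closed Y hY u w d he hu := by
    rcases Multiset.mem_cons.1 he with he | he
    · obtain ⟨h1, h2, -⟩ := hS Y hY
      rcases Sym2.eq_iff.1 (congrArg Prod.fst he) with ⟨rfl, rfl⟩ | ⟨rfl, rfl⟩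
      · exact h1 hu
      · exact h2 hu
    · exact h.closed Y (h𝒴 hY) u w d (by simp [he]) hu
  odd Y hY := by
    have := h.odd Y (h𝒴 hY)
    rw [load_cons, load_cons, ← add_assoc, ← (hS Y hY).2.2] at this
    rwa [load_cons]

/-- If all members of the family survive and the cost does not increase, then the family can be kept. -/
theorem keep (h : IsOddFamily ((s(v, p), a) ::ₘ (s(v, q), c) ::ₘ N) X s 𝒴)
    (hS : ∀ Y ∈ 𝒴, Survives X s v p q a c Y)
    (hc : edgeCost X s (s(p, q), a + c) ≤ edgeCost X s (s(v, p), a) + edgeCost X s (s(v, q), c)) :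
    ∃ 𝒴', IsOddFamily ((s(p, q), a + c) ::ₘ N) X s 𝒴' ∧
      cost X s ((s(p, q), a + c) ::ₘ N) + 2 * 𝒴.card ≤
        cost X s ((s(v, p), a) ::ₘ (s(v, q), c) ::ₘ N) + 2 * 𝒴'.card :=
  ⟨𝒴, h.survive subset_rfl hS, by simp only [cost_cons]; omega⟩

/-- If the cost decreases by two, then one member of the family may be lost. -/
theorem drop (h : IsOddFamily ((s(v, p), a) ::ₘ (s(v, q), c) ::ₘ N) X s 𝒴) (Y₀ : Set V)
    (hS : ∀ Y ∈ 𝒴, Y ≠ Y₀ → Survives X s v p q a c Y)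
    (hc : edgeCost X s (s(p, q), a + c) + 2 ≤
      edgeCost X s (s(v, p), a) + edgeCost X s (s(v, q), c)) :
    ∃ 𝒴', IsOddFamily ((s(p, q), a + c) ::ₘ N) X s 𝒴' ∧
      cost X s ((s(p, q), a + c) ::ₘ N) + 2 * 𝒴.card ≤
        cost X s ((s(v, p), a) ::ₘ (s(v, q), c) ::ₘ N) + 2 * 𝒴'.card := by
  classical
  refine ⟨𝒴.erase Y₀, h.survive (Finset.erase_subset _ _) fun Y hY =>
    hS Y (Finset.mem_of_mem_erase hY) (Finset.ne_of_mem_erase hY), ?_⟩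
  have := Finset.pred_card_le_card_erase (s := 𝒴) (a := Y₀)
  simp only [cost_cons]
  omega

theorem survives_of_notMem {Y : Set V} (hv : v ∉ Y) (hp : p ∉ Y) (hq : q ∉ Y) :
    Survives X s v p q a c Y := by
  simp [Survives, edgeLoad_mk, hv, hp, hq]

theorem shift_split (s : V → ZMod 2) (p q v : V) (a c : ZMod 2) :
    a + c + (s p + s q) = (a + (s v + s p)) + (c + (s v + s q)) := by
  generalize s p = x, s q = y, s v = z
  revert a c x y z; decide

/-- Twice the label is additive modulo `4`. -/
theorem two_val_add (a c : ZMod 2) :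
    2 * ((a + c).val : ZMod 4) = 2 * (a.val : ZMod 4) + 2 * (c.val : ZMod 4) := by
  revert a c; decide

theorem load_union {Y Y' : Set V} (hd : ∀ v ∈ Y, v ∉ Y')
    (hM : ∀ u v a, (s(u, v), a) ∈ N → u ∈ Y → v ∉ Y') :
    load (Y ∪ Y') s N = load Y s N + load Y' s N := by
  simp only [load]
  rw [← Multiset.sum_map_add]
  congr 1
  refine Multiset.map_congr rfl ?_
  rintro ⟨e, a⟩ he
  induction e with | _ u v
  have h1 := hM u v a he
  have h2 := hM v u a (by rwa [Sym2.eq_swap])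
  have h3 := hd u
  have h4 := hd v
  by_cases hu : u ∈ Y <;> by_cases hv : v ∈ Y <;> by_cases hu' : u ∈ Y' <;>
    by_cases hv' : v ∈ Y' <;> simp_all [edgeLoad_mk]

open Classical in
/-- If splitting off joins two members of the family, then their union is odd afterwards. -/
theorem merge (h : IsOddFamily ((s(v, p), a) ::ₘ (s(v, q), c) ::ₘ N) X s 𝒴) {Y Y' : Set V}
    (hv : v ∈ X) (hY : Y ∈ 𝒴) (hY' : Y' ∈ 𝒴) (hne : Y ≠ Y') (hp : p ∈ Y) (hq : q ∈ Y') :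
    IsOddFamily ((s(p, q), a + c) ::ₘ N) X s (insert (Y ∪ Y') ((𝒴.erase Y).erase Y')) ∧
      𝒴.card ≤ (insert (Y ∪ Y') ((𝒴.erase Y).erase Y')).card + 1 := by
  have hd : ∀ v ∈ Y, v ∉ Y' := fun v h1 h2 => hne (h.disjoint Y hY Y' hY' v h1 h2)
  have hpY' := hd p hp
  have hqY : q ∉ Y := fun h' => hd q h' hq
  have hvY : v ∉ Y := fun h' => h.notMem Y hY v h' hv
  have hvY' : v ∉ Y' := fun h' => h.notMem Y' hY' v h' hv
  have hdisj : ∀ Z ∈ 𝒴, Z ≠ Y → Z ≠ Y' → ∀ w ∈ Z, w ∉ Y ∪ Y' := by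
    rintro Z hZ h1 h2 w hw (hw' | hw')
    · exact h1 (h.disjoint Z hZ Y hY w hw hw')
    · exact h2 (h.disjoint Z hZ Y' hY' w hw hw')
  have hN : ∀ u w d, (s(u, w), d) ∈ N → u ∈ Y → w ∉ Y' := fun u w d he hu hw => by
    rcases h.closed Y hY u w d (by simp [he]) hu with h1 | h1
    · exact hd w h1 hw
    · exact h.notMem Y' hY' w hw h1
  have hsurv : ∀ Z ∈ 𝒴, Z ≠ Y → Z ≠ Y' → Survives X s v p q a c Z := fun Z hZ h1 h2 =>
    survives_of_notMem (fun h' => h.notMem Z hZ v h' hv)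
      (fun h' => hdisj Z hZ h1 h2 p h' (Or.inl hp)) (fun h' => hdisj Z hZ h1 h2 q h' (Or.inr hq))
  have hrest := h.survive (𝒴' := (𝒴.erase Y).erase Y')
    ((Finset.erase_subset _ _).trans (Finset.erase_subset _ _)) (fun Z hZ => by
      simp only [Finset.mem_erase] at hZ
      exact hsurv Z hZ.2.2 hZ.2.1 hZ.1)
  constructor
  · constructor
    · intro Z hZ
      rcases Finset.mem_insert.1 hZ with rfl | hZ
      · rintro w (hw | hw)
        · exact h.notMem Y hY w hw
        · exact h.notMem Y' hY' w hw
      · exact hrest.notMem Z hZ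
    · intro Z hZ Z' hZ' w hw hw'
      rcases Finset.mem_insert.1 hZ with rfl | hZ <;> rcases Finset.mem_insert.1 hZ' with rfl | hZ'
      · rfl
      · simp only [Finset.mem_erase] at hZ'
        exact absurd hw (hdisj Z' hZ'.2.2 hZ'.2.1 hZ'.1 w hw')
      · simp only [Finset.mem_erase] at hZ
        exact absurd hw' (hdisj Z hZ.2.2 hZ.2.1 hZ.1 w hw)
      · exact hrest.disjoint Z hZ Z' hZ' w hw hw'
    · intro Z hZ u w d he hu
      rcases Finset.mem_insert.1 hZ with rfl | hZ
      · rcases Multiset.mem_cons.1 he with he | he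
        · rcases Sym2.eq_iff.1 (congrArg Prod.fst he) with ⟨rfl, rfl⟩ | ⟨rfl, rfl⟩
          · exact Or.inl (Or.inr hq)
          · exact Or.inl (Or.inl hp)
        · rcases hu with hu | hu
          · exact (h.closed Y hY u w d (by simp [he]) hu).imp_left Or.inl
          · exact (h.closed Y' hY' u w d (by simp [he]) hu).imp_left Or.inr
      · exact hrest.closed Z hZ u w d he hu
    · intro Z hZ
      rcases Finset.mem_insert.1 hZ with rfl | hZ
      · have h1 := h.odd Y hY
        have h2 := h.odd Y' hY'
        have hl := two_val_add (a + (s v + s p)) (c + (s v + s q))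
        rw [← shift_split] at hl
        rw [load_cons, load_union hd hN]
        simp only [load_cons, edgeLoad_mk, hp, hq, hpY', hqY, hvY, hvY', if_true, if_false,
          Set.mem_union, or_true, true_or, zero_add] at h1 h2 ⊢
        rw [hl]
        clear hl
        generalize 2 * ((a + (s v + s p)).val : ZMod 4) = x at *
        generalize 2 * ((c + (s v + s q)).val : ZMod 4) = y at *
        generalize load Y s N = z at *
        generalize load Y' s N = w at *
        revert x y z w
        decide
      · exact hrest.odd Z hZ
  · rw [Finset.card_insert_of_notMem, Finset.card_erase_of_mem, Finset.card_erase_of_mem hY]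
    · have : 1 < 𝒴.card := Finset.one_lt_card.2 ⟨Y, hY, Y', hY', hne⟩
      omega
    · exact Finset.mem_erase.2 ⟨hne.symm, hY'⟩
    · intro hZ
      simp only [Finset.mem_erase] at hZ
      exact hdisj _ hZ.2.2 hZ.2.1 hZ.1 p (Or.inl hp) (Or.inl hp)

/-- The case of `split_off` in which one of the two edges lies inside `X` and the other one leaves `X`:
if the edge inside has label `0`, then nothing changes, otherwise the cost drops and pays for
the member of the family at the other end. -/
theorem split_off_boundary (h : IsOddFamily ((s(v, p), a) ::ₘ (s(v, q), c) ::ₘ N) X s 𝒴)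
    (hv : v ∈ X) (hp : p ∈ X) (hq : q ∉ X) :
    ∃ 𝒴', IsOddFamily ((s(p, q), a + c) ::ₘ N) X s 𝒴' ∧
      cost X s ((s(p, q), a + c) ::ₘ N) + 2 * 𝒴.card ≤
        cost X s ((s(v, p), a) ::ₘ (s(v, q), c) ::ₘ N) + 2 * 𝒴'.card := by
  have hlt : ∀ x : ZMod 2, x.val = 0 ∨ x.val = 1 := by decide
  have hl := two_val_add (a + (s v + s p)) (c + (s v + s q))
  rw [← shift_split s p q v a c] at hl
  have hvY : ∀ Y ∈ 𝒴, v ∉ Y := fun Y hY hvY => h.notMem Y hY v hvY hv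
  have hpY : ∀ Y ∈ 𝒴, p ∉ Y := fun Y hY h' => h.notMem Y hY p h' hp
  rcases hlt (a + (s v + s p)) with h0 | h1
  · refine h.keep (fun Y hY => ?_) ?_
    · by_cases hqY : q ∈ Y
      · refine ⟨fun h' => absurd h' (hpY Y hY), fun _ => Or.inr hp, ?_⟩
        rw [h0, Nat.cast_zero, mul_zero, zero_add] at hl
        simp only [edgeLoad_mk, hvY Y hY, hpY Y hY, hqY, if_true, if_false, hl, zero_add]
      · exact survives_of_notMem (hvY Y hY) (hpY Y hY) hqY
    · simp [edgeCost_mk, hv, hp, hq]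
  · by_cases hex : ∃ Y ∈ 𝒴, q ∈ Y
    · obtain ⟨Y₀, hY₀, hqY₀⟩ := hex
      refine h.drop Y₀ (fun Y hY hne => survives_of_notMem (hvY Y hY) (hpY Y hY) fun hqY =>
        hne (h.disjoint Y hY Y₀ hY₀ q hqY hqY₀)) ?_
      simp [edgeCost_mk, hv, hp, hq, h1]
    · push Not at hex
      refine h.keep (fun Y hY => survives_of_notMem (hvY Y hY) (hpY Y hY) (hex Y hY)) ?_
      simp [edgeCost_mk, hv, hp, hq]

/-- Splitting off does not increase `γ'(E(X)) + |δ(X)| / 2 - |𝒴|` for a suitable family `𝒴`. -/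
theorem split_off (h : IsOddFamily ((s(v, p), a) ::ₘ (s(v, q), c) ::ₘ N) X s 𝒴) :
    ∃ 𝒴', IsOddFamily ((s(p, q), a + c) ::ₘ N) X s 𝒴' ∧
      cost X s ((s(p, q), a + c) ::ₘ N) + 2 * 𝒴.card ≤
        cost X s ((s(v, p), a) ::ₘ (s(v, q), c) ::ₘ N) + 2 * 𝒴'.card := by
  classical
  have hsum := shift_split s p q v a c
  have hl := two_val_add (a + (s v + s p)) (c + (s v + s q))
  have hle := Flood.val_add_le (a + (s v + s p)) (c + (s v + s q))
  rw [← hsum] at hl hle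
  have hlt : ∀ x : ZMod 2, x.val = 0 ∨ x.val = 1 := by decide
  have clp : ∀ Y ∈ 𝒴, p ∈ Y → v ∈ Y ∨ v ∈ X := fun Y hY hp =>
    h.closed Y hY p v a (by rw [Sym2.eq_swap]; simp) hp
  have clq : ∀ Y ∈ 𝒴, q ∈ Y → v ∈ Y ∨ v ∈ X := fun Y hY hq =>
    h.closed Y hY q v c (by rw [Sym2.eq_swap (a := q)]; simp) hq
  by_cases hv : v ∈ X
  · have hvY : ∀ Y ∈ 𝒴, v ∉ Y := fun Y hY hvY => h.notMem Y hY v hvY hv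
    by_cases hp : p ∈ X <;> by_cases hq : q ∈ X
    · refine h.keep (fun Y hY => survives_of_notMem (hvY Y hY)
        (fun h' => h.notMem Y hY p h' hp) (fun h' => h.notMem Y hY q h' hq)) ?_
      simp only [edgeCost_mk, hv, hp, hq, if_true]
      omega
    · exact h.split_off_boundary hv hp hq
    · rw [cons_left_comm, Sym2.eq_swap (a := p), add_comm a]
      exact (cons_left_comm _ _ _ ▸ h).split_off_boundary hv hq hp
    · by_cases hpY : ∃ Y ∈ 𝒴, p ∈ Y
      · obtain ⟨Y, hY, hpY⟩ := hpY
        by_cases hqY : ∃ Y' ∈ 𝒴, Y' ≠ Y ∧ q ∈ Y'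
        · obtain ⟨Y', hY', hne, hqY'⟩ := hqY
          obtain ⟨h1, h2⟩ := h.merge hv hY hY' hne.symm hpY hqY'
          refine ⟨_, h1, ?_⟩
          simp only [cost_cons, edgeCost_mk, hv, hp, hq, if_true, if_false]
          omega
        · push Not at hqY
          refine h.drop Y (fun Z hZ hne => survives_of_notMem (hvY Z hZ)
            (fun h' => hne (h.disjoint Z hZ Y hY p h' hpY)) (hqY Z hZ hne)) ?_
          simp [edgeCost_mk, hv, hp, hq]
      · push Not at hpY
        by_cases hqY : ∃ Y ∈ 𝒴, q ∈ Y
        · obtain ⟨Y, hY, hqY⟩ := hqY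
          refine h.drop Y (fun Z hZ hne => survives_of_notMem (hvY Z hZ) (hpY Z hZ)
            (fun h' => hne (h.disjoint Z hZ Y hY q h' hqY))) ?_
          simp [edgeCost_mk, hv, hp, hq]
        · push Not at hqY
          refine h.keep (fun Z hZ => survives_of_notMem (hvY Z hZ) (hpY Z hZ) (hqY Z hZ)) ?_
          simp [edgeCost_mk, hv, hp, hq]
  · have hcost : edgeCost X s (s(p, q), a + c) ≤
        edgeCost X s (s(v, p), a) + edgeCost X s (s(v, q), c) := by
      have h2 : (a + c + (s p + s q)).val ≤ 1 := Nat.lt_succ_iff.1 (ZMod.val_lt _)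
      by_cases hp : p ∈ X <;> by_cases hq : q ∈ X <;> simp [edgeCost_mk, hv, hp, hq] <;> omega
    by_cases hvY : ∃ Y ∈ 𝒴, v ∈ Y
    · obtain ⟨Y, hY, hvY⟩ := hvY
      have hother : ∀ Z ∈ 𝒴, Z ≠ Y → Survives X s v p q a c Z := by
        intro Z hZ hne
        have hvZ : v ∉ Z := fun h' => hne (h.disjoint Z hZ Y hY v h' hvY)
        exact survives_of_notMem hvZ (fun h' => (clp Z hZ h').elim hvZ hv)
          (fun h' => (clq Z hZ h').elim hvZ hv)
      have hpY : p ∈ Y ∨ p ∈ X := h.closed Y hY v p a (by simp) hvY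
      have hqY : q ∈ Y ∨ q ∈ X := h.closed Y hY v q c (by simp) hvY
      have hXY : ∀ w ∈ X, w ∉ Y := fun w h1 h2 => h.notMem Y hY w h2 h1
      by_cases hb : p ∈ X ∧ q ∈ X ∧ (a + c + (s p + s q)).val = 0
      · refine h.drop Y hother ?_
        simp [edgeCost_mk, hb.1, hb.2.1, hb.2.2, hv]
      · refine h.keep (fun Z hZ => ?_) hcost
        by_cases hne : Z = Y
        · subst hne
          refine ⟨fun _ => hqY, fun _ => hpY, ?_⟩
          rcases hpY with hp | hp <;> rcases hqY with hq | hq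
          · simp only [edgeLoad_mk, hvY, hp, hq, if_true, hl]
          · simp only [edgeLoad_mk, hvY, hp, hXY q hq, if_true, if_false, hl]
            ring
          · simp only [edgeLoad_mk, hvY, hXY p hp, hq, if_true, if_false, hl]
            ring
          · have h1 := (hlt (a + c + (s p + s q))).resolve_left fun h0 => hb ⟨hp, hq, h0⟩
            simp only [edgeLoad_mk, hvY, hXY p hp, hXY q hq, if_true, if_false]
            rw [h1] at hl
            generalize 2 * ((a + (s v + s p)).val : ZMod 4) = x at *
            generalize 2 * ((c + (s v + s q)).val : ZMod 4) = y at *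
            revert x y
            decide
        · exact hother Z hZ hne
    · push Not at hvY
      exact h.keep (fun Z hZ => survives_of_notMem (hvY Z hZ)
        (fun h' => (clp Z hZ h').elim (hvY Z hZ) hv)
        (fun h' => (clq Z hZ h').elim (hvY Z hZ) hv)) hcost

end IsOddFamily

theorem two_mul_ones (X : Set V) (s : V → ZMod 2) (hs : ∀ u ∈ B, ∀ v ∈ B, s u = s v) (hB : B ⊆ X)
    (hM : Within B M) : cost X s M = 2 * ones M := by
  simp only [cost, ones]
  rw [← Multiset.sum_map_mul_left]
  congr 1
  refine Multiset.map_congr rfl ?_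
  rintro ⟨e, a⟩ he
  have h := hM _ he
  induction e with | _ u v
  have hu := h u (by simp)
  have hv := h v (by simp)
  simp [edgeCost_mk, hB hu, hB hv, hs u hu v hv, CharTwo.add_self_eq_zero]

theorem load_eq_zero {Y : Set V} {s : V → ZMod 2} (hM : ∀ e ∈ M, ∀ v ∈ e.1, v ∉ Y) :
    load Y s M = 0 := by
  simp only [load]
  refine Multiset.sum_eq_zero fun x hx => ?_
  obtain ⟨⟨e, a⟩, he, rfl⟩ := Multiset.mem_map.1 hx
  have h := hM _ he
  induction e with | _ u v
  simp [edgeLoad_mk, h u (by simp), h v (by simp)]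

/-- The upper bound in the min-max formula: by `IsOddFamily.split_off` the bound descends to
multigraphs whose edges join roots only, which have no odd sets outside the roots. -/
theorem Flood.le_cost (h : Flood B M n) {X : Set V} {s : V → ZMod 2} {𝒴 : Finset (Set V)}
    (hB : B ⊆ X) (hs : ∀ u ∈ B, ∀ v ∈ B, s u = s v) (h𝒴 : IsOddFamily M X s 𝒴) :
    2 * n + 2 * 𝒴.card ≤ cost X s M := by
  induction h generalizing 𝒴 with
  | @base M n h hn =>
    have : 𝒴 = ∅ := by
      refine Finset.eq_empty_of_forall_notMem fun Y hY => ?_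
      have h1 := h𝒴.odd Y hY
      rw [load_eq_zero fun e he v hv hvY => h𝒴.notMem Y hY v hvY (hB (h e he v hv))] at h1
      exact absurd h1 (by decide)
    rw [this, two_mul_ones X s hs hB h]
    simp only [Finset.card_empty]
    omega
  | @split u v w a c N n hv h ih =>
    rw [Sym2.eq_swap (a := u)] at *
    rw [Sym2.eq_swap (a := w)] at ih
    obtain ⟨𝒴', h1, h2⟩ := h𝒴.split_off
    have := ih h1
    omega

end SignedMultigraph

namespace SignedMultigraph

variable {V : Type*} {B : Set V} {M N K : Multiset (Sym2 V × ZMod 2)} {n k : ℕ}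

/-! ### Cutting edges of an optimal flood -/

/-- `C` arises from the edge `e` by cutting it at a new vertex `x`. -/
def IsCut (x : V) (e : Sym2 V × ZMod 2) (C : Multiset (Sym2 V × ZMod 2)) : Prop :=
  ∃ u v a α, e = (s(u, v), a) ∧ C = (s(x, u), α) ::ₘ (s(x, v), α + a) ::ₘ 0

theorem IsCut.exists_eq {x u v : V} {a : ZMod 2} {C : Multiset (Sym2 V × ZMod 2)}
    (h : IsCut x (s(u, v), a) C) :
    ∃ α, C = (s(x, u), α) ::ₘ (s(x, v), α + a) ::ₘ 0 := by
  obtain ⟨u', v', a', α, he, rfl⟩ := h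
  obtain ⟨he, rfl⟩ := Prod.ext_iff.1 he
  rcases Sym2.eq_iff.1 he with ⟨rfl, rfl⟩ | ⟨rfl, rfl⟩
  · exact ⟨α, rfl⟩
  · refine ⟨α + a, ?_⟩
    rw [cons_left_comm, add_assoc, CharTwo.add_self_eq_zero, add_zero]

/-- Cutting an edge at an ordinary vertex changes nothing. -/
theorem Flood.of_cut {x : V} {e : Sym2 V × ZMod 2} {C : Multiset (Sym2 V × ZMod 2)}
    (hC : IsCut x e C) (h : Flood B (e ::ₘ N) n) : Flood B (C + N) n := by
  obtain ⟨u, v, a, α, rfl, rfl⟩ := hC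
  simp only [Multiset.cons_add, zero_add]
  exact h.unsplit x (by rw [← add_assoc, CharTwo.add_self_eq_zero, zero_add])

theorem Flood.uncut {x : V} {e : Sym2 V × ZMod 2} {C : Multiset (Sym2 V × ZMod 2)}
    (hC : IsCut x e C) (hx : x ∉ B) (hN : deg N x = 0) (h : Flood B (C + N) n) :
    Flood B (e ::ₘ N) n := by
  obtain ⟨u, v, a, α, rfl, rfl⟩ := hC
  simp only [Multiset.cons_add, zero_add] at h
  have := h.split_two hx hN
  rwa [← add_assoc, CharTwo.add_self_eq_zero, zero_add] at this

theorem IsCut.sum_eq {x : V} {e : Sym2 V × ZMod 2} {C : Multiset (Sym2 V × ZMod 2)}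
    (hC : IsCut x e C) : (C.map Prod.snd).sum = e.2 := by
  obtain ⟨u, v, a, α, rfl, rfl⟩ := hC
  simp [← add_assoc, CharTwo.add_self_eq_zero]

theorem IsCut.deg_self {x : V} {e : Sym2 V × ZMod 2} {C : Multiset (Sym2 V × ZMod 2)}
    (hC : IsCut x e C) (he : ends x e.1 = 0) : deg C x = 2 := by
  obtain ⟨u, v, a, α, rfl, rfl⟩ := hC
  simp only [ends_mk, Nat.add_eq_zero_iff, ite_eq_right_iff, one_ne_zero, imp_false] at he
  simp only [deg_cons, deg_zero, ends_mk, he.1, he.2, if_true, if_false]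

theorem IsCut.deg_of_ne {x y : V} {e : Sym2 V × ZMod 2} {C : Multiset (Sym2 V × ZMod 2)}
    (hC : IsCut x e C) (hy : x ≠ y) : deg C y = ends y e.1 := by
  obtain ⟨u, v, a, α, rfl, rfl⟩ := hC
  simp only [deg_cons, deg_zero, ends_mk, hy, if_false]
  omega

theorem exists_isCut (x : V) (e : Sym2 V × ZMod 2) : ∃ C, IsCut x e C := by
  obtain ⟨f, a⟩ := e
  induction f with | _ u v
  exact ⟨_, u, v, a, 0, rfl, rfl⟩

/-- The edges `e` and `f` of `e ::ₘ f ::ₘ N` can be cut simultaneously, with a gain of two for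
each of them. -/
def Indep (B : Set V) (k : ℕ) (e f : Sym2 V × ZMod 2) (N : Multiset (Sym2 V × ZMod 2)) : Prop :=
  ∃ x y C D, x ≠ y ∧ x ∉ B ∧ y ∉ B ∧ deg (e ::ₘ f ::ₘ N) x = 0 ∧ deg (e ::ₘ f ::ₘ N) y = 0 ∧
    IsCut x e C ∧ IsCut y f D ∧ Flood (insert x (insert y B)) (C + (D + N)) (k + 4)

theorem Indep.symm {e f : Sym2 V × ZMod 2} (h : Indep B k e f N) : Indep B k f e N := by
  obtain ⟨x, y, C, D, hne, hx, hy, hdx, hdy, hC, hD, h⟩ := h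
  refine ⟨y, x, D, C, hne.symm, hy, hx, ?_, ?_, hD, hC, ?_⟩
  · rwa [cons_left_comm]
  · rwa [cons_left_comm]
  · rw [Set.insert_comm, add_left_comm]; exact h

/-- There are always vertices that are new for `M`; this is the reason to have `V` infinite. -/
theorem exists_fresh [Infinite V] (hB : B.Finite) (M : Multiset (Sym2 V × ZMod 2))
    (x y : V) : ∃ z, z ∉ B ∧ deg M z = 0 ∧ z ≠ x ∧ z ≠ y := by
  classical
  have h : (B ∪ {v | v ∈ M.bind fun e => e.1.toMultiset} ∪ {x, y}).Finite := by
    refine (hB.union ?_).union (by simp)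
    exact (M.bind fun e => e.1.toMultiset).toFinset.finite_toSet.subset fun v hv => by simpa using hv
  obtain ⟨z, hz⟩ := h.exists_notMem
  simp only [Set.mem_union, Set.mem_ofPred_eq, Multiset.mem_bind, not_or, not_exists, not_and,
    Set.mem_insert_iff, Set.mem_singleton_iff] at hz
  refine ⟨z, hz.1.1, deg_eq_zero.2 fun e he hze => hz.1.2 e he ?_, hz.2.1, hz.2.2⟩
  simpa using hze

/-- Suppose that two adjacent edges `vp` and `vq` are cut at roots `x` and `y` such that the arms `vx` and
`vy` get different labels. Then the arms can be connected in the other way, by non-zero edges from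
`x` to `x'` and from `y` to `y'`, where `x'` and `y'` cut the arms at `q` and `p`. Two applications
of `Flood.glue` show that the cuts gain only two more than no cuts at all. -/
theorem Flood.rewire [Infinite V] (hB : B.Finite) {v p q x y : V} {a c α β : ZMod 2}
    (hxy : x ≠ y) (hx : x ∉ B) (hy : y ∉ B)
    (hdx : deg ((s(v, p), a) ::ₘ (s(v, q), c) ::ₘ N) x = 0)
    (hdy : deg ((s(v, p), a) ::ₘ (s(v, q), c) ::ₘ N) y = 0) (hne : α + β = 1)
    (h : Flood (insert x (insert y B)) ((s(x, v), α) ::ₘ (s(x, p), α + a) ::ₘ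
      (s(y, v), β) ::ₘ (s(y, q), β + c) ::ₘ N) (k + 4))
    (h₀ : Flood B ((s(v, p), a) ::ₘ (s(v, q), c) ::ₘ N) 0) :
    Flood B ((s(v, p), a) ::ₘ (s(v, q), c) ::ₘ N) (k + 2) := by
  obtain ⟨x', hx', hdx', hxx', hyx'⟩ :=
    exists_fresh hB ((s(v, p), a) ::ₘ (s(v, q), c) ::ₘ N) x y
  obtain ⟨y', hy'', hdy', hxy', hyy'⟩ :=
    exists_fresh (B := insert x' B) (hB.insert _) ((s(v, p), a) ::ₘ (s(v, q), c) ::ₘ N) x y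
  simp only [Set.mem_insert_iff, not_or] at hy''
  obtain ⟨hx'y', hy'⟩ := hy''
  -- the arms at the cuts, joined in the other way by two new non-zero edges `xx'` and `yy'`
  set L : Multiset (Sym2 V × ZMod 2) := (s(x, x'), 1) ::ₘ (s(v, x), α) ::ₘ (s(q, x'), β + c) ::ₘ
    (s(y, y'), 1) ::ₘ (s(v, y), β) ::ₘ (s(p, y'), α + a) ::ₘ N with hL
  simp only [deg_cons, ends_mk, Nat.add_eq_zero_iff, ite_eq_right_iff, one_ne_zero, imp_false]
    at hdx hdy hdx' hdy'
  obtain ⟨⟨hvx, hpx⟩, ⟨-, hqx⟩, hNx⟩ := hdx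
  obtain ⟨⟨hvy, hpy⟩, ⟨-, hqy⟩, hNy⟩ := hdy
  obtain ⟨⟨hvx', hpx'⟩, ⟨-, hqx'⟩, hNx'⟩ := hdx'
  obtain ⟨⟨hvy', hpy'⟩, ⟨-, hqy'⟩, hNy'⟩ := hdy'
  have hβ : β = 1 + α := by rw [← hne, add_right_comm, CharTwo.add_self_eq_zero, zero_add]
  have back : ∀ {n}, Flood B ((s(v, p), a) ::ₘ (s(v, q), c) ::ₘ N) n → Flood B L n := by
    intro n h
    have h1 := h.unsplit (a := β) (c := β + a) y
      (by rw [← add_assoc, CharTwo.add_self_eq_zero, zero_add])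
    have h2 := (h1.congr (N := (s(y, p), β + a) ::ₘ (s(v, q), c) ::ₘ (s(v, y), β) ::ₘ N) (by
      rw [Sym2.eq_swap (a := y) (b := v)]
      simp only [← Multiset.singleton_add]; abel)).unsplit (a := 1) (c := α + a) y'
        (by rw [hβ, add_assoc])
    have h3 := (h2.congr (N := (s(v, q), c) ::ₘ (s(y, y'), 1) ::ₘ (s(v, y), β) ::ₘ
        (s(p, y'), α + a) ::ₘ N) (by
      rw [Sym2.eq_swap (a := y') (b := y), Sym2.eq_swap (a := y') (b := p)]
      simp only [← Multiset.singleton_add]; abel)).unsplit (a := α) (c := α + c) x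
        (by rw [← add_assoc, CharTwo.add_self_eq_zero, zero_add])
    have h4 := (h3.congr (N := (s(x, q), α + c) ::ₘ (s(v, x), α) ::ₘ (s(y, y'), 1) ::ₘ
        (s(v, y), β) ::ₘ (s(p, y'), α + a) ::ₘ N) (by
      rw [Sym2.eq_swap (a := x) (b := v)]
      simp only [← Multiset.singleton_add]; abel)).unsplit (a := 1) (c := β + c) x'
        (by rw [hβ, ← add_assoc, ← add_assoc, CharTwo.add_self_eq_zero, zero_add])
    refine h4.congr ?_
    rw [hL, Sym2.eq_swap (a := x') (b := x), Sym2.eq_swap (a := x') (b := q)]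
    simp only [← Multiset.singleton_add]; abel
  have forth : ∀ {n}, Flood B L n → Flood B ((s(v, p), a) ::ₘ (s(v, q), c) ::ₘ N) n := by
    intro n h
    have h1 := (h.congr (N := (s(x, x'), 1) ::ₘ (s(x, v), α) ::ₘ (s(q, x'), β + c) ::ₘ
      (s(y, y'), 1) ::ₘ (s(v, y), β) ::ₘ (s(p, y'), α + a) ::ₘ N) (by
        rw [hL, Sym2.eq_swap (a := x) (b := v)])).split_two hx (by
      simp only [deg_cons, ends_mk, hqx, hxx', hvx, hxy.symm, hxy', hpx, hNx, if_false])
    have h2 := (h1.congr (N := (s(x', v), 1 + α) ::ₘ (s(x', q), β + c) ::ₘ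
      (s(y, y'), 1) ::ₘ (s(v, y), β) ::ₘ (s(p, y'), α + a) ::ₘ N) (by
        rw [Sym2.eq_swap (a := x') (b := q)])).split_two hx' (by
      simp only [deg_cons, ends_mk, hyx'.symm, hvx', hx'y', hpx', hNx', if_false])
    have h3 := (h2.congr (N := (s(y, y'), 1) ::ₘ (s(y, v), β) ::ₘ (s(v, q), c) ::ₘ
      (s(p, y'), α + a) ::ₘ N) (by
        rw [Sym2.eq_swap (a := y) (b := v), hβ, ← add_assoc, CharTwo.add_self_eq_zero, zero_add]
        simp only [← Multiset.singleton_add]; abel)).split_two hy (by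
      simp only [deg_cons, ends_mk, hqy, hvy, hyy', hpy, hNy, if_false])
    have h4 := (h3.congr (N := (s(y', v), 1 + β) ::ₘ (s(y', p), α + a) ::ₘ (s(v, q), c) ::ₘ N) (by
        rw [Sym2.eq_swap (a := y') (b := p)]
        simp only [← Multiset.singleton_add]; abel)).split_two hy' (by
      simp only [deg_cons, ends_mk, hvy', hqy', hNy', if_false])
    refine h4.congr ?_
    rw [hβ, show 1 + (1 + α) + (α + a) = (1 + 1) + (α + α) + a by ring,
      CharTwo.add_self_eq_zero, CharTwo.add_self_eq_zero, zero_add, zero_add]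
  refine forth ?_
  have h1 : Flood (insert x (insert x' (insert y (insert y' B)))) L (k + 2 + 2 + 2) := by
    have h1 := h.mono_root (B' := insert x (insert x' (insert y (insert y' B)))) (by
      rw [Set.insert_comm x']
      exact Set.insert_subset_insert (Set.insert_subset_insert
        ((Set.subset_insert _ _).trans (Set.subset_insert _ _))))
    have h2 := (h1.congr (N := (s(p, x), α + a) ::ₘ (s(x, v), α) ::ₘ
      (s(y, v), β) ::ₘ (s(y, q), β + c) ::ₘ N) (by
        rw [Sym2.eq_swap (a := p)]
        simp only [← Multiset.singleton_add]; abel)).move_root (y := y') (by simp) (by simp)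
    have h3 := (h2.congr (N := (s(q, y), β + c) ::ₘ (s(p, y'), α + a) ::ₘ (s(x, v), α) ::ₘ
      (s(y, v), β) ::ₘ N) (by
        rw [Sym2.eq_swap (a := q)]
        simp only [← Multiset.singleton_add]; abel)).move_root (y := x') (by simp) (by simp)
    have h4 : Flood (insert x (insert x' (insert y (insert y' B))))
        ((s(x, x'), (1 : ZMod 2)) ::ₘ (s(y, y'), 1) ::ₘ 0) 2 :=
      .base (by simp) (by simp only [ones_cons, ones_zero]; decide)
    refine (h4.add h3).congr ?_ |>.mono (by omega)
    rw [hL, Sym2.eq_swap (a := x) (b := v), Sym2.eq_swap (a := y) (b := v)]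
    simp only [← Multiset.singleton_add]; abel
  have h2 := h1.glue (c := 1) (B := insert y (insert y' B)) (by simp [hx, hxy, Ne.symm hxy'])
    (by simp [hx', hyx', Ne.symm hx'y']) hxx'.symm (by
      simp [hL, hqx, hxx', hvx, hxy.symm, hxy', hpx, hNx])
    (by simp [hL, hqx', hxx'.symm, hvx', Ne.symm hyx', hx'y', hpx', hNx'])
    (by simp [hL]) ((back h₀).mono_root ((Set.subset_insert _ _).trans (Set.subset_insert _ _)))
  exact h2.glue (c := 1) hy hy' hyy'.symm
    (by simp [hL, hqy, hxy, hvy, hyx', hyy', hpy, hNy])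
    (by simp [hL, hqy', Ne.symm hxy', hvy', Ne.symm hyy', Ne.symm hx'y', hpy', hNy'])
    (by simp [hL]) (back h₀)

/-- Every way of cutting the edge `g` of `g ::ₘ N` at a root yields a gain. -/
def Cuttable (B : Set V) (k : ℕ) (g : Sym2 V × ZMod 2) (N : Multiset (Sym2 V × ZMod 2)) : Prop :=
  ∀ z C, z ∉ B → deg (g ::ₘ N) z = 0 → IsCut z g C → Flood (insert z B) (C + N) (k + 2)

/-- In an optimal flood, adjacent edges are not independent if one of them is cuttable. By
`Flood.rewire` the arms at the common vertex `v` would have to have equal labels. The exchange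
property with a second cut of the edge `vq`, for which the arm at `v` has the other label, leads
to arms with different labels nevertheless. -/
theorem not_indep_of_adj [Infinite V] (hB : B.Finite) {v p q : V} {a c : ZMod 2}
    (hcut : Cuttable B k (s(v, q), c) ((s(v, p), a) ::ₘ N))
    (hk : (k : ZMod 2) = (((s(v, p), a) ::ₘ (s(v, q), c) ::ₘ N).map Prod.snd).sum)
    (h₀ : Flood B ((s(v, p), a) ::ₘ (s(v, q), c) ::ₘ N) 0)
    (hmax : ¬ Flood B ((s(v, p), a) ::ₘ (s(v, q), c) ::ₘ N) (k + 1)) :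
    ¬ Indep B k (s(v, p), a) (s(v, q), c) N := by
  rintro ⟨x, y, C, D, hxy, hx, hy, hdx, hdy, hC, hD, h⟩
  obtain ⟨α, rfl⟩ := hC.exists_eq
  obtain ⟨β, rfl⟩ := hD.exists_eq
  simp only [Multiset.cons_add, zero_add] at h
  by_cases hαβ : α + β = 1
  · exact hmax ((h.rewire hB hxy hx hy hdx hdy hαβ h₀).mono (by omega))
  obtain rfl : α = β := (by decide : ∀ α β : ZMod 2, ¬ α + β = 1 → α = β) α β hαβ
  obtain ⟨z, hz, hdz, hzx, hzy⟩ :=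
    exists_fresh hB ((s(v, p), a) ::ₘ (s(v, q), c) ::ₘ N) x y
  have hdx' := hdx
  have hdy' := hdy
  have hdz' := hdz
  simp only [deg_cons, ends_mk, Nat.add_eq_zero_iff, ite_eq_right_iff, one_ne_zero, imp_false]
    at hdx hdy hdz
  obtain ⟨⟨hvx, hpx⟩, ⟨-, hqx⟩, hNx⟩ := hdx
  obtain ⟨⟨hvy, hpy⟩, ⟨-, hqy⟩, hNy⟩ := hdy
  obtain ⟨⟨hvz, hpz⟩, ⟨-, hqz⟩, hNz⟩ := hdz
  -- the second cut edge is now subdivided twice, so that the part of it at `v` can be given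
  -- either label
  set L : Multiset (Sym2 V × ZMod 2) := (s(z, v), α + 1) ::ₘ (s(z, y), 1) ::ₘ
    (s(x, v), α) ::ₘ (s(x, p), α + a) ::ₘ (s(y, q), α + c) ::ₘ N with hL
  have forth_y : ∀ {B' : Set V} {n : ℕ}, y ∉ B' → Flood B' L n → Flood B' ((s(x, v), α) ::ₘ
      (s(x, p), α + a) ::ₘ (s(z, v), α + 1) ::ₘ (s(z, q), α + 1 + c) ::ₘ N) n := by
    intro B' n hB' h
    have h1 := (h.congr (N := (s(y, z), 1) ::ₘ (s(y, q), α + c) ::ₘ (s(z, v), α + 1) ::ₘ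
      (s(x, v), α) ::ₘ (s(x, p), α + a) ::ₘ N) (by
        rw [hL, Sym2.eq_swap (a := y) (b := z)]
        simp only [← Multiset.singleton_add]; abel)).split_two hB' (by
      simp only [deg_cons, ends_mk, hzy, hvy, hxy, hpy, hNy, if_false])
    refine h1.congr ?_
    rw [show 1 + (α + c) = α + 1 + c by ring]
    simp only [← Multiset.singleton_add]; abel
  have forth : ∀ {n}, Flood B L n → Flood B ((s(v, p), a) ::ₘ (s(v, q), c) ::ₘ N) n := by
    intro n h
    have h1 := (forth_y hy h).split_two hx (by
      simp only [deg_cons, ends_mk, hzx, hvx, hqx, hNx, if_false])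
    have h2 := (h1.congr (N := (s(z, v), α + 1) ::ₘ (s(z, q), α + 1 + c) ::ₘ
      (s(v, p), α + (α + a)) ::ₘ N) (by
        simp only [← Multiset.singleton_add]; abel)).split_two hz (by
      simp only [deg_cons, ends_mk, hvz, hpz, hNz, if_false])
    refine h2.congr ?_
    rw [← add_assoc α α a, ← add_assoc (α + 1) (α + 1) c, CharTwo.add_self_eq_zero,
      CharTwo.add_self_eq_zero, zero_add, zero_add, cons_left_comm]
  have back : ∀ {B' : Set V} {n}, Flood B' ((s(z, v), α + 1) ::ₘ (s(z, q), α + 1 + c) ::ₘ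
      (s(v, p), a) ::ₘ N) n → Flood B' L n := by
    intro B' n h
    have h1 := (h.congr (cons_left_comm _ _ _)).unsplit (a := 1) (c := α + c) y
      (by ring)
    have h2 := (h1.congr (N := (s(v, p), a) ::ₘ (s(z, v), α + 1) ::ₘ (s(z, y), 1) ::ₘ
      (s(y, q), α + c) ::ₘ N) (by
        rw [Sym2.eq_swap (a := y) (b := z)]
        simp only [← Multiset.singleton_add]; abel)).unsplit (a := α) (c := α + a) x
        (by rw [← add_assoc, CharTwo.add_self_eq_zero, zero_add])
    refine h2.congr ?_
    rw [hL]
    simp only [← Multiset.singleton_add]; abel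
  have hS : Flood (insert x (insert y B)) L (k + 4) := by
    refine ((h.congr (N := (s(y, v), α) ::ₘ (s(x, v), α) ::ₘ (s(x, p), α + a) ::ₘ
      (s(y, q), α + c) ::ₘ N) (by simp only [← Multiset.singleton_add]; abel)).unsplit
        (a := 1) (c := α + 1) z (by
          rw [add_left_comm, CharTwo.add_self_eq_zero, add_zero])).congr ?_
    rw [hL]
    exact cons_left_comm _ _ _
  have hT : Flood (insert z B) L (k + 2) := by
    refine back ((hcut z _ hz (by rwa [cons_left_comm])
      ⟨v, q, c, α + 1, rfl, rfl⟩).congr ?_)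
    simp only [Multiset.cons_add, zero_add]
  have hL₀ : Flood B L 0 := by
    refine back (((h₀.congr (cons_left_comm _ _ _)).unsplit (a := α + 1) (c := α + 1 + c) z ?_))
    rw [← add_assoc, CharTwo.add_self_eq_zero, zero_add]
  have hsum : (k : ZMod 2) = (L.map Prod.snd).sum := by
    rw [hk, hL]
    simp only [Multiset.map_cons, Multiset.sum_cons]
    linear_combination (-(α + 1)) * CharTwo.two_eq_zero (R := ZMod 2) - α * CharTwo.two_eq_zero (R := ZMod 2)
  rcases Flood.exchange (B := B) hx hy hz hxy hzx.symm hzy.symm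
    (by simp [hL, hzx, hvx, hpx, hqx, Ne.symm hxy, hNx])
    (by simp [hL, hzy, hvy, hpy, hqy, hxy, hNy])
    (by simp [hL, Ne.symm hzx, Ne.symm hzy, hvz, hpz, hqz, hNz]) hsum hS hT with h' | h' | h'
  · exact hmax (forth h')
  · refine hmax ((Flood.rewire hB hzx.symm hx hz hdx' hdz' ?_
      (forth_y (by simp [hy, hxy.symm, hzy.symm]) h') h₀).mono (by omega))
    rw [← add_assoc, CharTwo.add_self_eq_zero, zero_add]
  · refine hmax (forth ((Flood.glue (n := k + 2) (c := 1) hy hz hzy.symm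
      (by simp [hL, hzy, hvy, hpy, hqy, hxy, hNy])
      (by simp [hL, Ne.symm hzx, Ne.symm hzy, hvz, hpz, hqz, hNz])
      (by simp [hL, Sym2.eq_swap (a := y) (b := z)]) h' hL₀).mono (by omega)))

/-- The exchange property of independent edges. -/
theorem Indep.exchange [Infinite V] (hB : B.Finite) {e f g : Sym2 V × ZMod 2}
    (h : Indep B k e f (g ::ₘ N)) (hcut : Cuttable B k g (e ::ₘ f ::ₘ N))
    (hk : (k : ZMod 2) = ((e ::ₘ f ::ₘ g ::ₘ N).map Prod.snd).sum)
    (hmax : ¬ Flood B (e ::ₘ f ::ₘ g ::ₘ N) (k + 1)) :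
    Indep B k e g (f ::ₘ N) ∨ Indep B k f g (e ::ₘ N) := by
  obtain ⟨x, y, C, D, hxy, hx, hy, hdx, hdy, hC, hD, h⟩ := h
  obtain ⟨z, hz, hdz, hzx, hzy⟩ := exists_fresh hB (e ::ₘ f ::ₘ g ::ₘ N) x y
  obtain ⟨E, hE⟩ := exists_isCut z g
  have hdx' := hdx
  have hdy' := hdy
  have hdz' := hdz
  simp only [deg_cons, Nat.add_eq_zero_iff] at hdx hdy hdz
  obtain ⟨hex, hfx, hgx, hNx⟩ := hdx
  obtain ⟨hey, hfy, hgy, hNy⟩ := hdy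
  obtain ⟨hez, hfz, hgz, hNz⟩ := hdz
  have hS : Flood (insert x (insert y B)) (C + (D + (E + N))) (k + 4) := by
    refine ((h.congr (N := g ::ₘ (C + (D + N))) ?_).of_cut hE).congr ?_
    · simp only [← Multiset.singleton_add]; abel
    · abel
  have hT : Flood (insert z B) (C + (D + (E + N))) (k + 2) := by
    have h1 := hcut z E hz (by simp [hez, hfz, hgz, hNz]) hE
    have h2 := (h1.congr (N := e ::ₘ f ::ₘ (E + N)) (by
      simp only [← Multiset.singleton_add]; abel)).of_cut hC
    refine ((h2.congr (N := f ::ₘ (C + (E + N))) (by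
      simp only [← Multiset.singleton_add]; abel)).of_cut hD).congr ?_
    abel
  have hCx := hC.deg_self hex
  have hDy := hD.deg_self hfy
  have hEz := hE.deg_self hgz
  have hCy := hC.deg_of_ne hxy
  have hCz := hC.deg_of_ne hzx.symm
  have hDx := hD.deg_of_ne hxy.symm
  have hDz := hD.deg_of_ne hzy.symm
  have hEx := hE.deg_of_ne hzx
  have hEy := hE.deg_of_ne hzy
  rcases Flood.exchange (B := B) hx hy hz hxy hzx.symm hzy.symm (by simp only [deg_add]; omega)
    (by simp only [deg_add]; omega) (by simp only [deg_add]; omega) (by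
      rw [hk]
      simp only [Multiset.map_add, Multiset.map_cons, Multiset.sum_add, Multiset.sum_cons,
        hC.sum_eq, hD.sum_eq, hE.sum_eq]) hS hT with h' | h' | h'
  · refine (hmax ?_).elim
    have h1 := h'.uncut hC hx (by simp only [deg_add]; omega)
    have h2 := (h1.congr (N := D + (e ::ₘ (E + N))) (by
      simp only [← Multiset.singleton_add]; abel)).uncut hD hy (by
        simp only [deg_add, deg_cons]; omega)
    refine ((h2.congr (N := E + (e ::ₘ f ::ₘ N)) (by
      simp only [← Multiset.singleton_add]; abel)).uncut hE hz (by
        simp only [deg_cons]; omega)).congr ?_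
    simp only [← Multiset.singleton_add]; abel
  · refine .inl ⟨x, z, C, E, hzx.symm, hx, hz, ?_, ?_, hC, hE, ?_⟩
    · simp only [deg_cons]; omega
    · simp only [deg_cons]; omega
    · refine ((h'.congr (N := D + (C + (E + N))) (by abel)).uncut hD
        (by simp [hy, hxy.symm, hzy.symm]) (by simp only [deg_add]; omega)).congr ?_
      simp only [← Multiset.singleton_add]; abel
  · refine .inr ⟨y, z, D, E, hzy.symm, hy, hz, ?_, ?_, hD, hE, ?_⟩
    · simp only [deg_cons]; omega
    · simp only [deg_cons]; omega
    · refine (h'.uncut hC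
        (by simp [hx, hxy, hzx.symm]) (by simp only [deg_add]; omega)).congr ?_
      simp only [← Multiset.singleton_add]; abel

end SignedMultigraph

namespace SignedMultigraph

variable {V : Type*} {B : Set V} {M N K : Multiset (Sym2 V × ZMod 2)} {n k : ℕ}

/-! ### Independent edges and zero trails -/

/-- The number of edge ends in `S`. -/
noncomputable def degIn (S : Set V) (M : Multiset (Sym2 V × ZMod 2)) : ℕ :=
  (M.map fun e => endsIn S e.1).sum

@[simp] theorem degIn_cons (S : Set V) (e : Sym2 V × ZMod 2) :
    degIn S (e ::ₘ M) = endsIn S e.1 + degIn S M := by simp [degIn]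

open Classical in
theorem endsIn_mk (S : Set V) (u v : V) :
    endsIn S s(u, v) = (if u ∈ S then 1 else 0) + (if v ∈ S then 1 else 0) := rfl

theorem endsIn_eq_two {S : Set V} {f : Sym2 V} : endsIn S f = 2 ↔ ∀ v ∈ f, v ∈ S := by
  induction f with | _ u v
  rw [endsIn_mk]
  by_cases hu : u ∈ S <;> by_cases hv : v ∈ S <;> simp [hu, hv]

theorem endsIn_eq_zero {S : Set V} {f : Sym2 V} : endsIn S f = 0 ↔ ∀ v ∈ f, v ∉ S := by
  induction f with | _ u v
  rw [endsIn_mk]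
  by_cases hu : u ∈ S <;> by_cases hv : v ∈ S <;> simp [hu, hv]

theorem Reduces.degIn_eq {S : Set V} (h : Reduces S M K) : degIn S K = degIn S M := by
  induction h with
  | refl => rfl
  | @split p q v a c N hv h ih =>
    rw [← ih]
    simp only [degIn_cons, endsIn_mk, hv, if_false]
    ring

theorem degIn_eq_of_within (hM : Within B M) : degIn B M = 2 * M.card := by
  induction M using Multiset.induction with
  | empty => rfl
  | cons e M ih =>
    rw [degIn_cons, ih fun e he => hM e (Multiset.mem_cons_of_mem he),
      endsIn_eq_two.2 (hM e (Multiset.mem_cons_self _ _)), Multiset.card_cons]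
    ring

/-- A flood can be carried out down to edges between the roots. -/
theorem Flood.exists_reduces (h : Flood B M n) :
    ∃ K, Reduces B M K ∧ Within B K ∧ n ≤ ones K := by
  obtain ⟨K, hK, hf, -, hw⟩ := h.common_reduce h
  rw [Set.union_self] at hK hw
  exact ⟨K, hK, hw, hf.le_ones hw⟩

theorem Flood.two_dvd_degIn (h : Flood B M n) : 2 ∣ degIn B M := by
  obtain ⟨K, hK, hw, -⟩ := h.exists_reduces
  rw [← hK.degIn_eq, degIn_eq_of_within hw]
  exact dvd_mul_right _ _

theorem exists_zero_edge (h : ones M + 1 ≤ M.card) : ∃ e N, M = e ::ₘ N ∧ e.2 = 0 := by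
  induction M using Multiset.induction with
  | empty => simp at h
  | cons e M ih =>
    by_cases he : e.2 = 0
    · exact ⟨e, M, rfl, he⟩
    · have he1 : e.2.val = 1 := (by decide : ∀ a : ZMod 2, a ≠ 0 → a.val = 1) _ he
      rw [ones_cons, Multiset.card_cons, he1] at h
      obtain ⟨f, N, rfl, hf⟩ := ih (by omega)
      exact ⟨f, e ::ₘ N, cons_left_comm _ _ _, hf⟩

/-- Two edges of `M` can be cut at `x` and `y` such that the result has a flood of value `m`. -/
def TwoCut (B : Set V) (m : ℕ) (x y : V) (M : Multiset (Sym2 V × ZMod 2)) : Prop :=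
  ∃ e f N C D, M = e ::ₘ f ::ₘ N ∧ IsCut x e C ∧ IsCut y f D ∧
    Flood (insert x (insert y B)) (C + (D + N)) m

theorem TwoCut.symm {m : ℕ} {x y : V} (h : TwoCut B m x y M) : TwoCut B m y x M := by
  obtain ⟨e, f, N, C, D, rfl, hC, hD, h⟩ := h
  refine ⟨f, e, N, D, C, cons_left_comm _ _ _, hD, hC, ?_⟩
  rw [Set.insert_comm, add_left_comm]
  exact h

theorem TwoCut.unsplit_left {m : ℕ} {x y v p q : V} {a c : ZMod 2} {f : Sym2 V × ZMod 2}
    {C D : Multiset (Sym2 V × ZMod 2)} (hC : IsCut x (s(p, q), a + c) C) (hD : IsCut y f D)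
    (h : Flood (insert x (insert y B)) (C + (D + N)) m) :
    TwoCut B m x y ((s(v, p), a) ::ₘ (s(v, q), c) ::ₘ f ::ₘ N) := by
  obtain ⟨α, rfl⟩ := hC.exists_eq
  refine ⟨(s(v, p), a), f, (s(v, q), c) ::ₘ N, (s(x, p), α) ::ₘ (s(x, v), α + a) ::ₘ 0, D,
    ?_, ?_, hD, ?_⟩
  · simp only [← Multiset.singleton_add]; abel
  · exact ⟨p, v, a, α, by rw [Sym2.eq_swap], rfl⟩
  · refine ((h.congr (N := (s(x, q), α + (a + c)) ::ₘ (s(x, p), α) ::ₘ (D + N)) ?_).unsplit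
      (a := α + a) (c := c) v (add_assoc _ _ _).symm).congr ?_
    · simp only [← Multiset.singleton_add]; abel
    · rw [Sym2.eq_swap (a := x) (b := v)]
      simp only [← Multiset.singleton_add]; abel

theorem TwoCut.of_reduces {m : ℕ} {x y : V} {S : Set V} (hR : Reduces S M K)
    (h : TwoCut B m x y K) : TwoCut B m x y M := by
  induction hR with
  | refl => exact h
  | @split p q v a c N₀ hv hR ih =>
    refine ih ?_
    obtain ⟨e, f, N, C, D, hM, hC, hD, h⟩ := h
    rcases Multiset.cons_eq_cons.1 hM with ⟨rfl, rfl⟩ | ⟨-, N₁, rfl, hN₁⟩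
    · exact TwoCut.unsplit_left hC hD h
    · rcases Multiset.cons_eq_cons.1 hN₁ with ⟨rfl, rfl⟩ | ⟨-, N₂, rfl, rfl⟩
      · refine (TwoCut.unsplit_left (x := y) (y := x) hD hC ?_).symm
        rw [Set.insert_comm, add_left_comm]
        exact h
      · refine ⟨e, f, (s(v, p), a) ::ₘ (s(v, q), c) ::ₘ N₂, C, D, ?_, hC, hD, ?_⟩
        · simp only [← Multiset.singleton_add]; abel
        · refine ((h.congr (N := (s(p, q), a + c) ::ₘ (C + (D + N₂))) ?_).unsplit v rfl).congr ?_
          all_goals simp only [← Multiset.singleton_add]; abel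

/-- If there are at least two zero trails, then these contain two independent edges: the edges of the
reduced multigraph that stand for the trails are independent, and this is inherited by some edges
of `M`. -/
theorem Flood.exists_indep [Infinite V] (hB : B.Finite) (h : Flood B M k)
    (hmax : ¬ Flood B M (k + 1)) (hd : 2 * k + 4 ≤ degIn B M) :
    ∃ e f N, M = e ::ₘ f ::ₘ N ∧ Indep B k e f N := by
  obtain ⟨K, hK, hw, hk⟩ := h.exists_reduces
  have hk' : ones K ≤ k := by
    by_contra! hlt
    exact hmax ((hK.flood (.base hw le_rfl)).mono hlt)
  rw [← hK.degIn_eq, degIn_eq_of_within hw] at hd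
  obtain ⟨⟨e, _⟩, K₁, rfl, rfl⟩ := exists_zero_edge (M := K) (by omega)
  simp only [ones_cons, ZMod.val_zero, zero_add, Multiset.card_cons] at hd hk hk'
  obtain ⟨⟨f, _⟩, K₂, rfl, rfl⟩ := exists_zero_edge (M := K₁) (by omega)
  obtain ⟨x, hx, hdx, -, -⟩ := exists_fresh hB M (Classical.arbitrary V) (Classical.arbitrary V)
  obtain ⟨y, hy, hdy, hyx, -⟩ := exists_fresh hB M x x
  simp only [ones_cons, ZMod.val_zero, zero_add] at hk
  induction e with | _ u v
  induction f with | _ u' v'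
  obtain ⟨e, f, N, C, D, rfl, hC, hD, h⟩ : TwoCut B (k + 4) x y M := by
    refine TwoCut.of_reduces hK ⟨_, _, K₂, (s(x, u), 1) ::ₘ (s(x, v), 1 + 0) ::ₘ 0,
      (s(y, u'), 1) ::ₘ (s(y, v'), 1 + 0) ::ₘ 0, rfl, ⟨_, _, _, _, rfl, rfl⟩,
      ⟨_, _, _, _, rfl, rfl⟩, .base ?_ ?_⟩
    · simp only [within_cons] at hw
      obtain ⟨hw1, hw2, hw3⟩ := hw
      have := hw3.mono (S' := insert x (insert y B))
        ((Set.subset_insert _ _).trans (Set.subset_insert _ _))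
      show Within _ _
      simp [within_cons, hw1, hw2, this]
    · simp only [Multiset.cons_add, zero_add, ones_cons, add_zero, ZMod.val_one]
      omega
  exact ⟨e, f, N, rfl, x, y, C, D, hyx.symm, hx, hy, hdx, hdy, hC, hD, h⟩

end SignedMultigraph

namespace SignedMultigraph

variable {V : Type*} {B : Set V} {M N K : Multiset (Sym2 V × ZMod 2)} {n k : ℕ}

/-! ### Multigraphs all of whose cuts yield a gain -/

/-- Two vertices outside `B` are adjacent. -/
def OutAdj (B : Set V) (M : Multiset (Sym2 V × ZMod 2)) (u v : V) : Prop :=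
  u ∉ B ∧ v ∉ B ∧ ∃ c, (s(u, v), c) ∈ M

theorem OutAdj.symm {u v : V} (h : OutAdj B M u v) : OutAdj B M v u := by
  obtain ⟨hu, hv, c, hc⟩ := h
  exact ⟨hv, hu, c, by rwa [Sym2.eq_swap]⟩

/-- Every edge of `M` outside the roots can be cut with a gain. -/
def AllCuttable (B : Set V) (k : ℕ) (M : Multiset (Sym2 V × ZMod 2)) : Prop :=
  ∀ g N, M = g ::ₘ N → (∀ v ∈ g.1, v ∉ B) → Cuttable B k g N

/-- `not_indep_of_adj` for edges given by their common end. -/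
theorem not_indep_at [Infinite V] (hB : B.Finite) {e g : Sym2 V × ZMod 2} {v : V}
    (hcut : AllCuttable B k (e ::ₘ g ::ₘ N)) (hg : ∀ v ∈ g.1, v ∉ B)
    (hk : (k : ZMod 2) = ((e ::ₘ g ::ₘ N).map Prod.snd).sum)
    (h₀ : Flood B (e ::ₘ g ::ₘ N) 0) (hmax : ¬ Flood B (e ::ₘ g ::ₘ N) (k + 1))
    (hev : v ∈ e.1) (hgv : v ∈ g.1) : ¬ Indep B k e g N := by
  obtain ⟨e, a⟩ := e
  obtain ⟨g, c⟩ := g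
  obtain ⟨p, rfl⟩ := hev
  obtain ⟨q, rfl⟩ := hgv
  exact not_indep_of_adj hB (hcut _ _ (cons_left_comm _ _ _) hg) hk h₀ hmax

/-- Independence spreads along the edges outside the roots: if `f` is independent of an edge at `u`,
then it is independent of the other edges at `u`, and has no end at `u` itself. -/
theorem Indep.spread [Infinite V] (hB : B.Finite) (hcut : AllCuttable B k M)
    (hk : (k : ZMod 2) = (M.map Prod.snd).sum) (h₀ : Flood B M 0) (hmax : ¬ Flood B M (k + 1))
    {f e g : Sym2 V × ZMod 2} {u : V} (hM : M = f ::ₘ e ::ₘ N) (h : Indep B k f e N)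
    (hu : u ∈ e.1) (hg : g ∈ M) (hgB : ∀ v ∈ g.1, v ∉ B) (hug : u ∈ g.1) :
    g = e ∨ ∃ N', M = f ::ₘ g ::ₘ N' ∧ Indep B k f g N' ∧ (u ∉ f.1) := by
  subst hM
  have hne : g ≠ f := by
    rintro rfl
    refine not_indep_at hB (e := e) (g := g) (N := N) ?_ hgB ?_ ?_ ?_ hu hug h.symm <;>
      rwa [cons_left_comm]
  rw [Multiset.mem_cons, Multiset.mem_cons] at hg
  rcases hg with hg | hg | hg
  · exact absurd hg hne
  · exact .inl hg
  right
  obtain ⟨N', rfl⟩ := Multiset.exists_cons_of_mem hg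
  have h1 : f ::ₘ e ::ₘ g ::ₘ N' = e ::ₘ g ::ₘ f ::ₘ N' := by
    simp only [← Multiset.singleton_add]; abel
  have h2 : f ::ₘ e ::ₘ g ::ₘ N' = f ::ₘ g ::ₘ e ::ₘ N' := by
    simp only [← Multiset.singleton_add]; abel
  have h3 : f ::ₘ e ::ₘ g ::ₘ N' = g ::ₘ f ::ₘ e ::ₘ N' := by
    simp only [← Multiset.singleton_add]; abel
  have key : Indep B k f g (e ::ₘ N') := by
    rcases h.exchange hB (hcut _ _ h3 hgB) hk hmax with h | h
    · exact h
    · rw [h1] at hcut hk h₀ hmax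
      exact absurd h (not_indep_at hB hcut hgB hk h₀ hmax hu hug)
  refine ⟨_, h2, key, fun huf => ?_⟩
  rw [h2] at hcut hk h₀ hmax
  exact not_indep_at hB hcut hgB hk h₀ hmax huf hug key

/-- If `M` is connected outside the roots and all cuts yield a gain, then an optimal flood has at
most one zero trail, that is, at most `k + 1` trails. Otherwise there are independent edges, and
independence spreads until two independent edges are adjacent. -/
theorem Flood.degIn_le [Infinite V] (hB : B.Finite) (hcut : AllCuttable B k M)
    (hk : (k : ZMod 2) = (M.map Prod.snd).sum) (h : Flood B M k) (hmax : ¬ Flood B M (k + 1))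
    (hroot : ∀ e ∈ M, ∃ v ∈ e.1, v ∉ B)
    (hout : ∀ v ∉ B, deg M v ≠ 0 → ∃ w, OutAdj B M v w)
    (hconn : ∀ u ∉ B, ∀ v ∉ B, deg M u ≠ 0 → deg M v ≠ 0 →
      Relation.ReflTransGen (OutAdj B M) u v) :
    degIn B M ≤ 2 * k + 2 := by
  have h₀ := h.mono (Nat.zero_le k)
  obtain ⟨d, hd⟩ := h.two_dvd_degIn
  by_contra! hlt
  obtain ⟨f, e, N, hM, hI⟩ := h.exists_indep hB hmax (by omega)
  obtain ⟨u, hu, huB⟩ := hroot e (by simp [hM])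
  obtain ⟨t, ht, htB⟩ := hroot f (by simp [hM])
  have hu0 : deg M u ≠ 0 := fun h' => deg_eq_zero.1 h' e (by simp [hM]) hu
  have ht0 : deg M t ≠ 0 := fun h' => deg_eq_zero.1 h' f (by simp [hM]) ht
  have hP : ∀ w, Relation.ReflTransGen (OutAdj B M) u w →
      ∃ e N, M = f ::ₘ e ::ₘ N ∧ w ∈ e.1 ∧ Indep B k f e N := by
    intro w hw
    induction hw with
    | refl => exact ⟨e, N, hM, hu, hI⟩
    | @tail w w' _ hww' ih =>
      obtain ⟨e, N, hM, hw, hI⟩ := ih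
      obtain ⟨hwB, hwB', c, hc⟩ := hww'
      rcases Indep.spread hB hcut hk h₀ hmax hM hI hw hc (by simp [hwB, hwB'])
        (by simp) with he | ⟨N', hN', hI', -⟩
      · exact ⟨e, N, hM, by rw [← he]; simp, hI⟩
      · exact ⟨_, N', hN', by simp, hI'⟩
  obtain ⟨e', N', hM', hte', hI'⟩ := hP t (hconn u huB t htB hu0 ht0)
  obtain ⟨w, -, hwB, c, hc⟩ := hout t htB ht0
  rcases Indep.spread hB hcut hk h₀ hmax hM' hI' hte' hc (by simp [htB, hwB])
    (by simp) with he | ⟨_, _, _, htf⟩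
  · subst he
    subst hM'
    exact not_indep_at hB hcut (by simp [htB, hwB]) hk h₀ hmax ht (by simp) hI'
  · exact htf ht

/-- A dual certificate of value at most `k`: a set `X` that contains the roots, a shifting that does
not involve the roots, and a family of odd sets outside `X`. -/
def HasCertificate (B : Set V) (M : Multiset (Sym2 V × ZMod 2)) (k : ℕ) : Prop :=
  ∃ (X : Set V) (s : V → ZMod 2) (𝒴 : Finset (Set V)), B ⊆ X ∧ (∀ b ∈ B, s b = 0) ∧
    IsOddFamily M X s 𝒴 ∧ cost X s M ≤ 2 * k + 2 * 𝒴.card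

theorem HasCertificate.mono {k' : ℕ} (h : HasCertificate B M k) (hk : k ≤ k') :
    HasCertificate B M k' := by
  obtain ⟨X, s, 𝒴, hX, hs, h𝒴, hc⟩ := h
  exact ⟨X, s, 𝒴, hX, hs, h𝒴, by omega⟩

theorem cost_zero_eq_degIn (hroot : ∀ e ∈ M, ∃ v ∈ e.1, v ∉ B) : cost B 0 M = degIn B M := by
  unfold cost degIn
  congr 1
  refine Multiset.map_congr rfl fun e he => ?_
  obtain ⟨v, hv, hvB⟩ := hroot e he
  have : endsIn B e.1 ≠ 2 := fun h => hvB (endsIn_eq_two.1 h v hv)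
  simp [edgeCost, this]

theorem load_compl_root (Y : Set V) (hroot : ∀ e ∈ M, ∃ v ∈ e.1, v ∉ B)
    (hY : ∀ e ∈ M, ∀ v ∈ e.1, v ∈ Y ↔ v ∉ B) :
    load Y 0 M = 2 * (((M.map Prod.snd).sum.val : ℕ) : ZMod 4) + (degIn B M : ZMod 4) := by
  induction M using Multiset.induction with
  | empty => simp [load, degIn]
  | cons e M ih =>
    rw [load_cons, ih (fun e he => hroot e (Multiset.mem_cons_of_mem he))
      (fun e he => hY e (Multiset.mem_cons_of_mem he)), degIn_cons, Multiset.map_cons,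
      Multiset.sum_cons]
    have h1 := hroot e (Multiset.mem_cons_self _ _)
    have h2 := hY e (Multiset.mem_cons_self _ _)
    obtain ⟨f, a⟩ := e
    induction f with | _ u v
    have hval : ∀ a b : ZMod 2, 2 * (((a + b).val : ℕ) : ZMod 4) =
      2 * ((a.val : ℕ) : ZMod 4) + 2 * ((b.val : ℕ) : ZMod 4) := by decide
    simp only [Sym2.mem_iff, exists_eq_or_imp, exists_eq_left, forall_eq_or_imp, forall_eq]
      at h1 h2
    rw [edgeLoad_mk, endsIn_mk, hval]
    by_cases hu : u ∈ B <;> by_cases hv : v ∈ B <;> simp_all <;> ring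

/-- Under the assumptions of `Flood.degIn_le`, the set of roots is optimal. Its cost is `2k` or `2k + 2`,
and in the second case the complement of the roots is odd. -/
theorem Flood.hasCertificate_of_cuttable [Infinite V] (hB : B.Finite) (hcut : AllCuttable B k M)
    (hk : (k : ZMod 2) = (M.map Prod.snd).sum) (h : Flood B M k) (hmax : ¬ Flood B M (k + 1))
    (hroot : ∀ e ∈ M, ∃ v ∈ e.1, v ∉ B)
    (hout : ∀ v ∉ B, deg M v ≠ 0 → ∃ w, OutAdj B M v w)
    (hconn : ∀ u ∉ B, ∀ v ∉ B, deg M u ≠ 0 → deg M v ≠ 0 →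
      Relation.ReflTransGen (OutAdj B M) u v) :
    HasCertificate B M k := by
  have hle := h.degIn_le hB hcut hk hmax hroot hout hconn
  have hcost := cost_zero_eq_degIn hroot
  by_cases hd : degIn B M ≤ 2 * k
  · exact ⟨B, 0, ∅, subset_rfl, fun _ _ => rfl, ⟨by simp, by simp, by simp, by simp⟩, by
      rw [hcost]; simpa using hd⟩
  have hd' : degIn B M = 2 * k + 2 := by
    obtain ⟨d, hd⟩ := h.two_dvd_degIn
    omega
  refine ⟨B, 0, {Bᶜ}, subset_rfl, fun _ _ => rfl, ⟨?_, ?_, ?_, ?_⟩, by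
    rw [hcost, hd', Finset.card_singleton]⟩
  · simp
  · simp
  · rintro Y hY u v a h hu
    rw [Finset.mem_singleton] at hY
    subst hY
    exact (em (v ∈ B)).symm
  · rintro Y hY
    rw [Finset.mem_singleton] at hY
    subst hY
    rw [load_compl_root Bᶜ hroot (fun _ _ _ _ => Iff.rfl), ← hk, hd', ZMod.val_natCast]
    rcases Nat.even_or_odd' k with ⟨m, rfl | rfl⟩
    · have : ((2 * (2 * m) + 2 : ℕ) : ZMod 4) = 4 * (m : ZMod 4) + 2 := by push_cast; ring
      rw [this, show (4 : ZMod 4) = 0 from rfl, Nat.mul_mod_right]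
      simp
    · have : ((2 * (2 * m + 1) + 2 : ℕ) : ZMod 4) = 4 * (m : ZMod 4) + 4 := by push_cast; ring
      rw [this, show (4 : ZMod 4) = 0 from rfl, show (2 * m + 1) % 2 = 1 by omega]
      simp

end SignedMultigraph

namespace SignedMultigraph

variable {V : Type*} {B : Set V} {M N K : Multiset (Sym2 V × ZMod 2)} {n k : ℕ}

/-! ### Combining certificates -/

@[simp] theorem cost_add (X : Set V) (s : V → ZMod 2) :
    cost X s (M + N) = cost X s M + cost X s N := by simp [cost]

@[simp] theorem load_add (X : Set V) (s : V → ZMod 2) :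
    load X s (M + N) = load X s M + load X s N := by simp [load]

theorem cost_congr {X X' : Set V} {s s' : V → ZMod 2}
    (hX : ∀ e ∈ M, ∀ v ∈ e.1, v ∈ X ↔ v ∈ X') (hs : ∀ e ∈ M, ∀ v ∈ e.1, s v = s' v) :
    cost X s M = cost X' s' M := by
  unfold cost
  congr 1
  refine Multiset.map_congr rfl ?_
  rintro ⟨e, a⟩ he
  have h1 := hX _ he
  have h2 := hs _ he
  induction e with | _ u v
  simp only [Sym2.mem_iff, forall_eq_or_imp, forall_eq] at h1 h2
  by_cases hu : u ∈ X' <;> by_cases hv : v ∈ X' <;> simp [edgeCost_mk, h1, h2, hu, hv]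

theorem load_congr {Y Y' : Set V} {s s' : V → ZMod 2}
    (hY : ∀ e ∈ M, ∀ v ∈ e.1, v ∈ Y ↔ v ∈ Y') (hs : ∀ e ∈ M, ∀ v ∈ e.1, s v = s' v) :
    load Y s M = load Y' s' M := by
  unfold load
  congr 1
  refine Multiset.map_congr rfl ?_
  rintro ⟨e, a⟩ he
  have h1 := hY _ he
  have h2 := hs _ he
  induction e with | _ u v
  simp only [Sym2.mem_iff, forall_eq_or_imp, forall_eq] at h1 h2
  by_cases hu : u ∈ Y' <;> by_cases hv : v ∈ Y' <;> simp [edgeLoad_mk, h1, h2, hu, hv]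

/-- The members of an odd family can be restricted to the vertices of `M`. -/
theorem IsOddFamily.restrict {X X' : Set V} {s s' : V → ZMod 2} {𝒴 : Finset (Set V)} {T : Set V}
    (h : IsOddFamily M X s 𝒴) (hT : Within T M) (hX : ∀ v ∈ T, v ∈ X ↔ v ∈ X')
    (hs : ∀ v ∈ T, s v = s' v) :
    ∃ 𝒴', IsOddFamily M X' s' 𝒴' ∧ 𝒴'.card = 𝒴.card ∧ ∀ Y ∈ 𝒴', Y ⊆ T := by
  classical
  have hload : ∀ Y, load (Y ∩ T) s' M = load Y s M := fun Y =>
    load_congr (fun e he v hv => ⟨fun h => h.1, fun h => ⟨h, hT e he v hv⟩⟩)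
      fun e he v hv => (hs v (hT e he v hv)).symm
  refine ⟨𝒴.image (· ∩ T), ⟨?_, ?_, ?_, ?_⟩, ?_, ?_⟩
  · simp only [Finset.forall_mem_image]
    exact fun Y hY v hv hvX => h.notMem Y hY v hv.1 ((hX v hv.2).2 hvX)
  · simp only [Finset.forall_mem_image]
    intro Y hY Y' hY' v hv hv'
    rw [h.disjoint Y hY Y' hY' v hv.1 hv'.1]
  · simp only [Finset.forall_mem_image]
    intro Y hY u v a he hu
    have hv := hT _ he v (by simp)
    exact (h.closed Y hY u v a he hu.1).imp (fun h => ⟨h, hv⟩) (hX v hv).1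
  · simp only [Finset.forall_mem_image]
    exact fun Y hY => (hload Y).trans (h.odd Y hY)
  · refine Finset.card_image_of_injOn fun Y hY Y' hY' hYY' => ?_
    have h1 : load (Y ∩ T) s' M = 2 := (hload Y).trans (h.odd Y hY)
    have h2 : (Y ∩ T).Nonempty := by
      by_contra! h2
      rw [h2, load_eq_zero (by simp)] at h1
      exact absurd h1 (by decide)
    obtain ⟨v, hv⟩ := h2
    have hv' : v ∈ Y' ∩ T := by
      have : Y ∩ T = Y' ∩ T := hYY'
      rwa [← this]
    exact h.disjoint Y hY Y' hY' v hv.1 hv'.1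
  · simp only [Finset.forall_mem_image]
    exact fun Y _ => Set.inter_subset_right

theorem within_touched (M : Multiset (Sym2 V × ZMod 2)) : Within {v | deg M v ≠ 0} M :=
  fun e he _ hv h => deg_eq_zero.1 h e he hv

/-- Certificates of vertex-disjoint parts can be combined. -/
theorem HasCertificate.add {k₁ k₂ : ℕ} (h₁ : HasCertificate B M k₁) (h₂ : HasCertificate B N k₂)
    (hd : ∀ v ∉ B, deg M v = 0 ∨ deg N v = 0) : HasCertificate B (M + N) (k₁ + k₂) := by
  classical
  obtain ⟨X₁, s₁, 𝒴₁, hX₁, hs₁, hF₁, hc₁⟩ := h₁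
  obtain ⟨X₂, s₂, 𝒴₂, hX₂, hs₂, hF₂, hc₂⟩ := h₂
  set X : Set V := {v | v ∈ B ∨ if deg M v ≠ 0 then v ∈ X₁ else v ∈ X₂} with hX
  set s : V → ZMod 2 := fun v => if v ∈ B then 0 else if deg M v ≠ 0 then s₁ v else s₂ v with hs
  have hXM : ∀ v ∈ {v | deg M v ≠ 0}, v ∈ X₁ ↔ v ∈ X := by
    intro v hv
    by_cases hvB : v ∈ B
    · simp [hX, hvB, hX₁ hvB]
    · have : deg M v ≠ 0 := hv
      simp [hX, hvB, this]
  have hXN : ∀ v ∈ {v | deg N v ≠ 0}, v ∈ X₂ ↔ v ∈ X := by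
    intro v hv
    by_cases hvB : v ∈ B
    · simp [hX, hvB, hX₂ hvB]
    · have : deg M v = 0 := (hd v hvB).resolve_right hv
      simp [hX, hvB, this]
  have hsM : ∀ v ∈ {v | deg M v ≠ 0}, s₁ v = s v := by
    intro v hv
    by_cases hvB : v ∈ B
    · simp [hs, hvB, hs₁ v hvB]
    · have : deg M v ≠ 0 := hv
      simp [hs, hvB, this]
  have hsN : ∀ v ∈ {v | deg N v ≠ 0}, s₂ v = s v := by
    intro v hv
    by_cases hvB : v ∈ B
    · simp [hs, hvB, hs₂ v hvB]
    · have : deg M v = 0 := (hd v hvB).resolve_right hv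
      simp [hs, hvB, this]
  rw [cost_congr (fun e he v hv => hXM v (within_touched M e he v hv))
    (fun e he v hv => hsM v (within_touched M e he v hv))] at hc₁
  rw [cost_congr (fun e he v hv => hXN v (within_touched N e he v hv))
    (fun e he v hv => hsN v (within_touched N e he v hv))] at hc₂
  obtain ⟨𝒵₁, hG₁, hcard₁, hT₁⟩ := hF₁.restrict (within_touched M) hXM hsM
  obtain ⟨𝒵₂, hG₂, hcard₂, hT₂⟩ := hF₂.restrict (within_touched N) hXN hsN
  have hBX : B ⊆ X := fun v hv => Or.inl hv
  have hM0 : ∀ Y ∈ 𝒵₁, ∀ v ∈ Y, deg N v = 0 := fun Y hY v hv =>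
    (hd v fun hvB => hG₁.notMem Y hY v hv (hBX hvB)).resolve_left (hT₁ Y hY hv)
  have hN0 : ∀ Y ∈ 𝒵₂, ∀ v ∈ Y, deg M v = 0 := fun Y hY v hv =>
    (hd v fun hvB => hG₂.notMem Y hY v hv (hBX hvB)).resolve_right (hT₂ Y hY hv)
  have hloadN : ∀ Y ∈ 𝒵₁, load Y s N = 0 := fun Y hY => load_eq_zero fun e he v hv hvY =>
    deg_eq_zero.1 (hM0 Y hY v hvY) e he hv
  have hloadM : ∀ Y ∈ 𝒵₂, load Y s M = 0 := fun Y hY => load_eq_zero fun e he v hv hvY =>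
    deg_eq_zero.1 (hN0 Y hY v hvY) e he hv
  refine ⟨X, s, 𝒵₁ ∪ 𝒵₂, hBX, fun b hb => by simp [hs, hb], ⟨?_, ?_, ?_, ?_⟩, ?_⟩
  · intro Y hY
    rcases Finset.mem_union.1 hY with hY | hY
    · exact hG₁.notMem Y hY
    · exact hG₂.notMem Y hY
  · intro Y hY Y' hY' v hv hv'
    rcases Finset.mem_union.1 hY with hY | hY <;> rcases Finset.mem_union.1 hY' with hY' | hY'
    · exact hG₁.disjoint Y hY Y' hY' v hv hv'
    · exact absurd (hM0 Y hY v hv) (hT₂ Y' hY' hv')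
    · exact absurd (hM0 Y' hY' v hv') (hT₂ Y hY hv)
    · exact hG₂.disjoint Y hY Y' hY' v hv hv'
  · intro Y hY u v a he hu
    rcases Finset.mem_union.1 hY with hY | hY <;> rcases Multiset.mem_add.1 he with he | he
    · exact hG₁.closed Y hY u v a he hu
    · exact absurd (Sym2.mem_mk_left u v) (deg_eq_zero.1 (hM0 Y hY u hu) _ he)
    · exact absurd (Sym2.mem_mk_left u v) (deg_eq_zero.1 (hN0 Y hY u hu) _ he)
    · exact hG₂.closed Y hY u v a he hu
  · intro Y hY
    rw [load_add]
    rcases Finset.mem_union.1 hY with hY | hY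
    · rw [hG₁.odd Y hY, hloadN Y hY, add_zero]
    · rw [hG₂.odd Y hY, hloadM Y hY, zero_add]
  · rw [Finset.card_union_of_disjoint, cost_add]
    · omega
    rw [Finset.disjoint_left]
    intro Y hY hY'
    have h1 := hG₁.odd Y hY
    rw [hloadM Y hY'] at h1
    exact absurd h1 (by decide)

/-- A flood induces floods of the parts of `M`, if these have only roots in common. The values are
not needed, and are left out. -/
theorem Flood.of_add (h : Flood B K n) : ∀ {M N}, K = M + N →
    (∀ v ∉ B, deg M v = 0 ∨ deg N v = 0) → Flood B M 0 := by
  induction h with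
  | @base K n h hn =>
    rintro M N rfl -
    exact .base (fun e he => h e (Multiset.mem_add.2 (.inl he))) (Nat.zero_le _)
  | @split u v w a c L n hv h ih =>
    intro M N hK hd
    have aux : ∀ {M N : Multiset (Sym2 V × ZMod 2)},
        (s(u, v), a) ::ₘ (s(v, w), c) ::ₘ L = M + N → (s(u, v), a) ∈ M → deg N v = 0 →
        ∃ M', M = (s(u, v), a) ::ₘ (s(v, w), c) ::ₘ M' ∧ L = M' + N := by
      intro M N hK he hN
      obtain ⟨M₁, rfl⟩ := Multiset.exists_cons_of_mem he
      rw [Multiset.cons_add, Multiset.cons_inj_right] at hK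
      have he' : (s(v, w), c) ∈ M₁ + N := hK ▸ Multiset.mem_cons_self _ _
      rcases Multiset.mem_add.1 he' with he' | he'
      · obtain ⟨M₂, rfl⟩ := Multiset.exists_cons_of_mem he'
        rw [Multiset.cons_add, Multiset.cons_inj_right] at hK
        exact ⟨M₂, rfl, hK⟩
      · exact absurd (Sym2.mem_mk_left v w) (deg_eq_zero.1 hN _ he')
    have he : (s(u, v), a) ∈ M + N := hK ▸ Multiset.mem_cons_self _ _
    rcases Multiset.mem_add.1 he with he | he
    · have hN : deg N v = 0 := (hd v hv).resolve_left fun h =>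
        deg_eq_zero.1 h _ he (Sym2.mem_mk_right u v)
      obtain ⟨M', rfl, rfl⟩ := aux hK he hN
      refine .split hv (ih (M := (s(u, w), a + c) ::ₘ M') (by rw [Multiset.cons_add]) ?_)
      intro x hx
      refine (hd x hx).imp_left fun h => ?_
      simp only [deg_cons, ends_mk] at h ⊢
      omega
    · have hM : deg M v = 0 := (hd v hv).resolve_right fun h =>
        deg_eq_zero.1 h _ he (Sym2.mem_mk_right u v)
      obtain ⟨N', rfl, rfl⟩ := aux (hK.trans (add_comm _ _)) he hM
      refine ih (N := (s(u, w), a + c) ::ₘ N') (by rw [add_comm N', Multiset.add_cons]) ?_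
      intro x hx
      refine (hd x hx).imp_right fun h => ?_
      simp only [deg_cons, ends_mk] at h ⊢
      omega

theorem Flood.exists_max (h : Flood B M 0) : ∃ k, Flood B M k ∧ ¬ Flood B M (k + 1) := by
  classical
  have hex : ∃ k, ¬ Flood B M (k + 1) := by
    by_contra! hcon
    have h1 := (hcon (cost Set.univ 0 M)).le_cost (X := Set.univ) (s := 0) (𝒴 := ∅)
      (Set.subset_univ _) (fun _ _ _ _ => rfl) ⟨by simp, by simp, by simp, by simp⟩
    simp only [Finset.card_empty] at h1
    omega
  refine ⟨Nat.find hex, ?_, Nat.find_spec hex⟩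
  rcases hk : Nat.find hex with _ | k
  · exact h
  · by_contra hcon
    exact Nat.find_min hex (m := k) (by omega) hcon

/-! ### Stars -/

/-- All edges join a root to the vertex `w`. -/
def IsStar (B : Set V) (w : V) (M : Multiset (Sym2 V × ZMod 2)) : Prop :=
  ∀ e ∈ M, ∃ b ∈ B, e.1 = s(b, w)

/-- In a star, edges with different labels are joined as long as possible. Then one of the labels does
not occur any more. -/
theorem IsStar.flood {w : V} (hw : w ∉ B) (h : IsStar B w M) {m : ℕ} (hm : M.card = 2 * m) :
    ∃ n, Flood B M n ∧ (ones M ≤ n ∨ M.card ≤ ones M + n) := by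
  induction m generalizing M with
  | zero =>
    rw [Nat.mul_zero, Multiset.card_eq_zero] at hm
    subst hm
    exact ⟨0, .base (by simp) (by simp), by simp⟩
  | succ m ih =>
    have step : ∀ {e f N}, M = e ::ₘ f ::ₘ N → ∃ n, Flood B M (n + (e.2 + f.2).val) ∧
        (ones N ≤ n ∨ N.card ≤ ones N + n) := by
      rintro ⟨e, a⟩ ⟨f, c⟩ N rfl
      obtain ⟨b, hb, rfl⟩ : ∃ b ∈ B, e = s(b, w) := h _ (Multiset.mem_cons_self _ _)
      obtain ⟨b', hb', rfl⟩ : ∃ b ∈ B, f = s(b, w) := h (f, c) (by simp)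
      obtain ⟨n, hn, hn'⟩ := ih (M := N) (fun e he => h e (by simp [he])) (by
        simp only [Multiset.card_cons] at hm; omega)
      refine ⟨n, ?_, hn'⟩
      rw [Sym2.eq_swap (a := b')]
      refine .split hw ?_
      have h1 : Flood B ((s(b, b'), a + c) ::ₘ 0) (a + c).val :=
        .base (show Within _ _ by simp [Within, hb, hb']) (by simp only [ones_cons]; omega)
      rw [add_comm n]
      simpa only [Multiset.cons_add, zero_add] using h1.add hn
    have h01 : ∀ a : ZMod 2, a = 0 ∨ a = 1 := by decide
    by_cases hmix : (∃ e ∈ M, e.2 = 0) ∧ ∃ f ∈ M, f.2 = 1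
    · obtain ⟨⟨⟨e, _⟩, he, rfl⟩, ⟨f, _⟩, hf, rfl⟩ := hmix
      obtain ⟨N, rfl⟩ := Multiset.exists_cons_of_mem he
      rw [Multiset.mem_cons] at hf
      rcases hf with hf | hf
      · exact absurd (Prod.ext_iff.1 hf).2 one_ne_zero
      obtain ⟨N, rfl⟩ := Multiset.exists_cons_of_mem hf
      obtain ⟨n, hn, hn'⟩ := step rfl
      refine ⟨n + 1, hn, ?_⟩
      simp only [ones_cons, Multiset.card_cons, ZMod.val_zero, ZMod.val_one]
      omega
    · obtain ⟨e, N, rfl⟩ : ∃ e N, M = e ::ₘ N := by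
        induction M using Multiset.induction with
        | empty => simp at hm
        | cons e N => exact ⟨e, N, rfl⟩
      obtain ⟨f, N, rfl⟩ : ∃ e N', N = e ::ₘ N' := by
        induction N using Multiset.induction with
        | empty => simp only [Multiset.card_cons, Multiset.card_zero] at hm; omega
        | cons e N => exact ⟨e, N, rfl⟩
      obtain ⟨n, hn, -⟩ := step rfl
      refine ⟨0, hn.mono (Nat.zero_le _), ?_⟩
      generalize e ::ₘ f ::ₘ N = M at *
      by_cases h0 : ∃ e ∈ M, e.2 = 0
      · left
        have : ∀ e ∈ M, e.2 = 0 := fun e he => (h01 e.2).resolve_right fun h1 =>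
          hmix ⟨h0, e, he, h1⟩
        refine (Multiset.sum_eq_zero fun x hx => ?_).le
        obtain ⟨e, he, rfl⟩ := Multiset.mem_map.1 hx
        simp [this e he]
      · right
        by_contra! hlt
        obtain ⟨e, N, rfl, he⟩ := exists_zero_edge (M := M) (by omega)
        exact h0 ⟨e, Multiset.mem_cons_self _ _, he⟩

theorem IsStar.cost_eq {w : V} (h : IsStar B w M) {s : V → ZMod 2} (hs : ∀ b ∈ B, s b = 0) :
    (s w = 0 → cost (insert w B) s M = 2 * ones M) ∧
      (s w = 1 → cost (insert w B) s M + 2 * ones M = 2 * M.card) := by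
  induction M using Multiset.induction with
  | empty => simp [cost]
  | cons e M ih =>
    obtain ⟨h0, h1⟩ := ih fun e he => h e (Multiset.mem_cons_of_mem he)
    obtain ⟨b, hb, he⟩ := h e (Multiset.mem_cons_self _ _)
    obtain ⟨e, a⟩ := e
    obtain rfl : e = s(b, w) := he
    simp only [cost_cons, ones_cons, Multiset.card_cons, edgeCost_mk, Set.mem_insert_iff, hb,
      or_true, true_or, if_true, hs b hb, zero_add]
    refine ⟨fun hw => ?_, fun hw => ?_⟩
    · rw [h0 hw, hw, add_zero]
      ring
    · have : ∀ a : ZMod 2, (a + 1).val + a.val = 1 := by decide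
      have := this a
      have := h1 hw
      rw [hw]
      omega

/-- For a star, the certificate consists of the roots and `w`, with a shifting at `w` if necessary. -/
theorem IsStar.hasCertificate {w : V} (hw : w ∉ B) (h : IsStar B w M) (hn : ones M ≤ n ∨
    M.card ≤ ones M + n) : HasCertificate B M n := by
  classical
  have aux : ∀ t : ZMod 2, cost (insert w B) (fun v => if v = w then t else 0) M ≤ 2 * n →
      HasCertificate B M n := fun t ht => by
    refine ⟨insert w B, _, ∅, Set.subset_insert _ _, fun b hb => ?_,
      ⟨by simp, by simp, by simp, by simp⟩, by simpa using ht⟩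
    exact if_neg fun e : b = w => hw (e ▸ hb)
  have hs : ∀ (t : ZMod 2), ∀ b ∈ B, (if b = w then t else 0) = 0 := fun t b hb => by
    exact if_neg fun e : b = w => hw (e ▸ hb)
  rcases hn with hn | hn
  · refine aux 0 ?_
    rw [(h.cost_eq (hs 0)).1 (if_pos rfl)]
    omega
  · refine aux 1 ?_
    have := (h.cost_eq (hs 1)).2 (if_pos rfl)
    omega

/-! ### The min-max theorem for floods -/

theorem HasCertificate.cons_root {e : Sym2 V × ZMod 2} (he : ∀ v ∈ e.1, v ∈ B)
    (h : HasCertificate B M k) : HasCertificate B (e ::ₘ M) (e.2.val + k) := by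
  obtain ⟨X, s, 𝒴, hX, hs, h𝒴, hc⟩ := h
  obtain ⟨e, a⟩ := e
  induction e with | _ u v
  simp only [Sym2.mem_iff, forall_eq_or_imp, forall_eq] at he
  obtain ⟨hu, hv⟩ := he
  refine ⟨X, s, 𝒴, hX, hs, ⟨h𝒴.notMem, h𝒴.disjoint, fun Y hY x y c hxy hx => ?_,
    fun Y hY => ?_⟩, ?_⟩
  · rcases Multiset.mem_cons.1 hxy with h | h
    · have hx' := h𝒴.notMem Y hY x hx
      rcases Sym2.eq_iff.1 (Prod.ext_iff.1 h).1 with ⟨rfl, rfl⟩ | ⟨rfl, rfl⟩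
      · exact absurd (hX hu) hx'
      · exact absurd (hX hv) hx'
    · exact h𝒴.closed Y hY x y c h hx
  · have hu' : u ∉ Y := fun h => h𝒴.notMem Y hY u h (hX hu)
    have hv' : v ∉ Y := fun h => h𝒴.notMem Y hY v h (hX hv)
    rw [load_cons, h𝒴.odd Y hY, edgeLoad_mk, if_neg hu', if_neg hv', zero_add]
  · rw [cost_cons, edgeCost_mk, if_pos (hX hu), if_pos (hX hv), hs u hu, hs v hv, add_zero,
      add_zero]
    change 2 * a.val + _ ≤ 2 * (a.val + k) + _
    omega

/-- A certificate for a multigraph in which an edge is cut is one for the multigraph itself. -/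
theorem HasCertificate.uncut {e : Sym2 V × ZMod 2} {C : Multiset (Sym2 V × ZMod 2)} {z : V}
    (hC : IsCut z e C) (h : HasCertificate (insert z B) (C + N) k) :
    HasCertificate B (e ::ₘ N) k := by
  obtain ⟨X, s, 𝒴, hX, hs, h𝒴, hc⟩ := h
  obtain ⟨u, v, a, α, rfl, rfl⟩ := hC
  simp only [Multiset.cons_add, zero_add] at h𝒴 hc
  obtain ⟨𝒴', h1, h2⟩ := h𝒴.split_off
  rw [← add_assoc, CharTwo.add_self_eq_zero, zero_add] at h1 h2
  exact ⟨X, s, 𝒴', (Set.subset_insert _ _).trans hX, fun b hb => hs b (.inr hb), h1, by omega⟩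

/-- The weight for the induction: edges outside the roots count three times. -/
noncomputable def weight (B : Set V) (M : Multiset (Sym2 V × ZMod 2)) : ℕ :=
  (M.map fun e => if endsIn B e.1 = 0 then 3 else 1).sum

@[simp] theorem weight_cons (e : Sym2 V × ZMod 2) :
    weight B (e ::ₘ M) = (if endsIn B e.1 = 0 then 3 else 1) + weight B M := by simp [weight]

@[simp] theorem weight_add : weight B (M + N) = weight B M + weight B N := by simp [weight]

theorem weight_pos (hM : M ≠ 0) : 0 < weight B M := by
  obtain ⟨e, he⟩ := Multiset.exists_mem_of_ne_zero hM
  obtain ⟨N, rfl⟩ := Multiset.exists_cons_of_mem he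
  rw [weight_cons]
  split_ifs <;> omega

theorem weight_insert_le {z : V} : weight (insert z B) M ≤ weight B M := by
  unfold weight
  refine Multiset.sum_map_le_sum_map _ _ fun e _ => ?_
  by_cases h : endsIn (insert z B) e.1 = 0
  · have : endsIn B e.1 = 0 :=
      endsIn_eq_zero.2 fun v hv hvB => endsIn_eq_zero.1 h v hv (.inr hvB)
    rw [if_pos h, if_pos this]
  · rw [if_neg h]
    split_ifs <;> omega

theorem IsCut.weight_lt {e : Sym2 V × ZMod 2} {C : Multiset (Sym2 V × ZMod 2)} {z : V}
    (hC : IsCut z e C) (he : ∀ v ∈ e.1, v ∉ B) :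
    weight (insert z B) (C + N) < weight B (e ::ₘ N) := by
  have hN := weight_insert_le (B := B) (M := N) (z := z)
  obtain ⟨u, v, a, α, rfl, rfl⟩ := hC
  have h1 : ∀ x, endsIn (insert z B) s(z, x) ≠ 0 := fun x h =>
    endsIn_eq_zero.1 h z (by simp) (by simp)
  simp only [Multiset.cons_add, zero_add, weight_cons, h1, if_false, endsIn_eq_zero.2 he, if_true]
  omega

/-- The min-max theorem: an optimal flood has a dual certificate. The proof removes edges between
roots, separates the components outside the roots, and cuts an edge outside the roots if this yields
no gain. What remains is a star or covered by `Flood.hasCertificate_of_cuttable`. -/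
theorem Flood.exists_certificate [Infinite V] (hB : B.Finite) (h : Flood B M 0) :
    ∃ k, Flood B M k ∧ HasCertificate B M k := by
  classical
  induction hm : weight B M using Nat.strong_induction_on generalizing B M with
  | _ m ih =>
  subst hm
  by_cases hroot : ∀ e ∈ M, ∃ v ∈ e.1, v ∉ B
  swap
  · push Not at hroot
    obtain ⟨⟨f, a⟩, he, heB⟩ := hroot
    obtain ⟨N, rfl⟩ := Multiset.exists_cons_of_mem he
    have hN : Flood B N 0 := Flood.of_cons_root (e := (f, 0)) heB (by simp) (h.relabel 0)
    obtain ⟨k, hk, hc⟩ := ih _ (by rw [weight_cons]; split_ifs <;> omega) hB hN rfl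
    refine ⟨_, ?_, hc.cons_root heB⟩
    have h1 : Flood B ((f, a) ::ₘ 0) a.val :=
      .base (by simpa using heB) (by simp only [ones_cons]; omega)
    simpa only [Multiset.cons_add, zero_add] using h1.add hk
  by_cases hM0 : M = 0
  · subst hM0
    exact ⟨0, h, B, 0, ∅, subset_rfl, fun _ _ => rfl, ⟨by simp, by simp, by simp, by simp⟩,
      by simp [cost]⟩
  obtain ⟨e₀, he₀⟩ := Multiset.exists_mem_of_ne_zero hM0
  obtain ⟨w₀, hw₀, hw₀B⟩ := hroot e₀ he₀
  -- the component of `w₀` in the graph of the edges outside the roots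
  set W : Set V := {w | Relation.ReflTransGen (OutAdj B M) w₀ w} with hW
  have hWB : ∀ w ∈ W, w ∉ B := by
    intro w hw
    rcases Relation.ReflTransGen.cases_tail hw with rfl | ⟨_, -, h⟩
    · exact hw₀B
    · exact h.2.1
  have hWe : ∀ e ∈ M, ∀ u ∈ e.1, ∀ v ∈ e.1, u ∈ W → v ∉ B → v ∈ W := by
    rintro ⟨f, a⟩ he u hu v hv huW hvB
    by_cases huv : u = v
    · rwa [← huv]
    · obtain rfl : f = s(u, v) := (Sym2.mem_and_mem_iff huv).1 ⟨hu, hv⟩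
      exact Relation.ReflTransGen.tail huW ⟨hWB u huW, hvB, a, he⟩
  by_cases hsep : ∃ e ∈ M, ∀ v ∈ e.1, v ∉ W
  · set M₁ := M.filter fun e => ∃ v ∈ e.1, v ∈ W with hM₁
    set M₂ := M.filter fun e => ¬ ∃ v ∈ e.1, v ∈ W with hM₂
    have hadd : M₁ + M₂ = M := Multiset.filter_add_not _ _
    have hd : ∀ v ∉ B, deg M₁ v = 0 ∨ deg M₂ v = 0 := by
      intro v hvB
      by_cases hv : v ∈ W
      · right
        refine deg_eq_zero.2 fun e he hve => ?_
        exact (Multiset.mem_filter.1 he).2 ⟨v, hve, hv⟩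
      · left
        refine deg_eq_zero.2 fun e he hve => hv ?_
        obtain ⟨he, u, hu, huW⟩ := Multiset.mem_filter.1 he
        exact hWe e he u hu v hve huW hvB
    have h1 : 0 < weight B M₁ := weight_pos fun h0 => by
      have : e₀ ∈ M₁ := Multiset.mem_filter.2 ⟨he₀, w₀, hw₀, .refl⟩
      simp [h0] at this
    have h2 : 0 < weight B M₂ := weight_pos fun h0 => by
      obtain ⟨e, he, heW⟩ := hsep
      have : e ∈ M₂ := Multiset.mem_filter.2 ⟨he, fun ⟨v, hv, hvW⟩ => heW v hv hvW⟩
      simp [h0] at this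
    have hw := weight_add (B := B) (M := M₁) (N := M₂)
    rw [hadd] at hw
    obtain ⟨k₁, hk₁, hc₁⟩ := ih _ (by omega) hB (h.of_add hadd.symm hd) rfl
    obtain ⟨k₂, hk₂, hc₂⟩ := ih _ (by omega) hB
      (h.of_add (hadd.symm.trans (add_comm _ _)) fun v hv => (hd v hv).symm) rfl
    rw [← hadd]
    exact ⟨k₁ + k₂, hk₁.add hk₂, hc₁.add hc₂ hd⟩
  push Not at hsep
  have htouch : ∀ v ∉ B, deg M v ≠ 0 → v ∈ W := by
    intro v hvB hv
    rw [Ne, deg_eq_zero] at hv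
    push Not at hv
    obtain ⟨e, he, hve⟩ := hv
    obtain ⟨u, hu, huW⟩ := hsep e he
    exact hWe e he u hu v hve huW hvB
  by_cases hadj : ∃ u v, OutAdj B M u v
  swap
  · -- there is only one vertex besides the roots
    push Not at hadj
    have hWw : ∀ w ∈ W, w = w₀ := by
      intro w hw
      rcases Relation.ReflTransGen.cases_tail hw with rfl | ⟨_, -, h⟩
      · rfl
      · exact absurd h (hadj _ _)
    have hstar : IsStar B w₀ M := by
      rintro ⟨e, a⟩ he
      obtain ⟨u, hu, huW⟩ := hsep _ he
      obtain rfl := hWw u huW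
      obtain ⟨v, rfl⟩ := hu
      refine ⟨v, ?_, Sym2.eq_swap⟩
      by_contra hv
      exact hadj _ _ ⟨hw₀B, hv, a, he⟩
    have hcard : degIn B M = M.card := by
      unfold degIn
      rw [Multiset.map_congr rfl (g := fun _ => 1), Multiset.map_const', Multiset.sum_replicate]
      · simp
      · rintro ⟨e, a⟩ he
        obtain ⟨b, hb, rfl⟩ : ∃ b ∈ B, e = s(b, w₀) := hstar _ he
        simp [endsIn_mk, hb, hw₀B]
    obtain ⟨m, hm⟩ := h.two_dvd_degIn
    obtain ⟨n, hn, hn'⟩ := hstar.flood hw₀B (hcard.symm.trans hm)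
    exact ⟨n, hn, hstar.hasCertificate hw₀B hn'⟩
  obtain ⟨k, hk, hmax⟩ := h.exists_max
  have hpar : (k : ZMod 2) = (M.map Prod.snd).sum := by
    by_contra hne
    exact hmax (hk.succ_of_ne hne)
  by_cases hcut : AllCuttable B k M
  · have hconn : ∀ u ∉ B, ∀ v ∉ B, deg M u ≠ 0 → deg M v ≠ 0 →
        Relation.ReflTransGen (OutAdj B M) u v := fun u hu v hv hu' hv' =>
      have : Std.Symm (OutAdj B M) := ⟨fun _ _ h => h.symm⟩
      (Std.Symm.symm _ _ (htouch u hu hu') : Relation.ReflTransGen (OutAdj B M) u w₀).trans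
        (htouch v hv hv')
    refine ⟨k, hk, hk.hasCertificate_of_cuttable hB hcut hpar hmax hroot ?_ hconn⟩
    intro v hvB hv
    obtain ⟨x, y, hxy⟩ := hadj
    have hx : deg M x ≠ 0 := fun h0 => by
      obtain ⟨-, -, c, hc⟩ := hxy
      exact deg_eq_zero.1 h0 _ hc (by simp)
    rcases Relation.ReflTransGen.cases_head (hconn v hvB x hxy.1 hv hx) with rfl | ⟨w, hw, -⟩
    · exact ⟨y, hxy⟩
    · exact ⟨w, hw⟩
  · unfold AllCuttable Cuttable at hcut
    push Not at hcut
    obtain ⟨g, N, rfl, hg, z, C, hz, hdz, hC, hnot⟩ := hcut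
    have hlt : ∀ j, Flood (insert z B) (C + N) j → j ≤ k := by
      intro j hj
      by_contra! hlt
      refine hnot ((hj.mono hlt).succ_of_ne ?_)
      have hs : ((C + N).map Prod.snd).sum = ((g ::ₘ N).map Prod.snd).sum := by
        rw [Multiset.map_add, Multiset.sum_add, hC.sum_eq, Multiset.map_cons, Multiset.sum_cons]
      rw [hs, ← hpar]
      push_cast
      simp
    obtain ⟨j, hj, hc⟩ := ih _ (hC.weight_lt hg) (hB.insert z)
      ((h.of_cut hC).mono_root (Set.subset_insert _ _)) rfl
    exact ⟨k, hk, (hc.uncut hC).mono (hlt j hj)⟩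

end SignedMultigraph

namespace Graph

open SignedMultigraph

variable {α β : Type*} {G : Graph α β} {γ : β → ZMod 2} {b : α}

/-! ### From floods to circuit-decompositions -/

namespace Trail

theorem exists_reverse (T : G.Trail) :
    ∃ T' : G.Trail, T'.tail = T.head ∧ T'.head = T.tail ∧ T'.edges = T.edges.reverse := by
  refine ⟨⟨T.arcs.reverse.map fun a => ⟨a.head, a.edge, a.tail, a.isLink.symm⟩, ?_, ?_, ?_⟩,
    ?_, ?_, ?_⟩
  · simpa using T.ne_nil
  · rw [List.isChain_map, List.isChain_reverse]
    exact T.isChain.imp fun _ _ h => h.symm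
  · rw [List.map_map, List.map_reverse, List.nodup_reverse]
    exact T.nodup
  · simp [tail, head]
  · simp [tail, head]
  · simp [edges, Function.comp_def]

theorem exists_append (T T' : G.Trail) (h : T.head = T'.tail) (hn : (T.edges ++ T'.edges).Nodup) :
    ∃ T'' : G.Trail, T''.tail = T.tail ∧ T''.head = T'.head ∧ T''.edges = T.edges ++ T'.edges := by
  refine ⟨⟨T.arcs ++ T'.arcs, by simp [T.ne_nil], ?_, by simpa [edges] using hn⟩, ?_, ?_, ?_⟩
  · rw [List.isChain_append]
    refine ⟨T.isChain, T'.isChain, fun x hx y hy => ?_⟩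
    rw [List.getLast?_eq_some_getLast T.ne_nil, Option.mem_some_iff] at hx
    rw [List.head?_eq_some_head T'.ne_nil, Option.mem_some_iff] at hy
    subst hx hy
    exact h
  · simp [tail, List.head_append_of_ne_nil T.ne_nil]
  · simp [head, List.getLast_append_of_ne_nil _ T'.ne_nil]
  · simp [edges]

/-- The edge that replaces a trail when all inner vertices of the trail are split. -/
def toEdge (γ : β → ZMod 2) (T : G.Trail) : Sym2 (α ⊕ ℕ) × ZMod 2 :=
  (s(.inl T.tail, .inl T.head), T.weight γ)

end Trail

/-- The edges of `M` stand for trails of `G` whose edges together are those in `E`. -/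
def Realizes (G : Graph α β) (γ : β → ZMod 2) (M : Multiset (Sym2 (α ⊕ ℕ) × ZMod 2))
    (E : Multiset β) : Prop :=
  ∃ R : Multiset G.Trail, R.map (Trail.toEdge γ) = M ∧ (R.bind fun T => (T.edges : Multiset β)) = E

theorem Realizes.cons {E : Multiset β} {M : Multiset (Sym2 (α ⊕ ℕ) × ZMod 2)} {p q : α ⊕ ℕ}
    {a : ZMod 2} (h : G.Realizes γ ((s(p, q), a) ::ₘ M) E) :
    ∃ (T : G.Trail) (E' : Multiset β), p = .inl T.tail ∧ q = .inl T.head ∧ a = T.weight γ ∧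
      E = (T.edges : Multiset β) + E' ∧ G.Realizes γ M E' := by
  obtain ⟨R, hR, rfl⟩ := h
  obtain ⟨T, hT, hTe⟩ := Multiset.mem_map.1 (hR ▸ Multiset.mem_cons_self _ _)
  obtain ⟨R, rfl⟩ := Multiset.exists_cons_of_mem hT
  rw [Multiset.map_cons, hTe, Multiset.cons_inj_right] at hR
  obtain ⟨h1, h2⟩ := Prod.ext_iff.1 hTe
  rcases Sym2.eq_iff.1 h1 with ⟨h3, h4⟩ | ⟨h3, h4⟩
  · exact ⟨T, _, h3.symm, h4.symm, h2.symm, Multiset.cons_bind _ _ _, R, hR, rfl⟩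
  · obtain ⟨T', ht, hh, he⟩ := T.exists_reverse
    refine ⟨T', R.bind fun T => (T.edges : Multiset β), by rw [ht, h4], by rw [hh, h3], ?_, ?_,
      R, hR, rfl⟩
    · refine Eq.trans h2.symm ?_
      simp [Trail.toEdge, Trail.weight, he]
    · rw [Multiset.cons_bind, he, Multiset.coe_reverse]

theorem Realizes.join {E : Multiset β} (hE : E.Nodup) {M : Multiset (Sym2 (α ⊕ ℕ) × ZMod 2)}
    {v p q : α ⊕ ℕ} {a c : ZMod 2}
    (h : G.Realizes γ ((s(v, p), a) ::ₘ (s(v, q), c) ::ₘ M) E) :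
    G.Realizes γ ((s(p, q), a + c) ::ₘ M) E := by
  rw [Sym2.eq_swap (a := v) (b := p)] at h
  obtain ⟨T, E', rfl, rfl, rfl, rfl, h'⟩ := h.cons
  obtain ⟨T', E'', hv, rfl, rfl, rfl, R, rfl, rfl⟩ := h'.cons
  rw [← add_assoc, Multiset.coe_add] at hE
  obtain ⟨T'', ht, hh, he⟩ := T.exists_append T' (Sum.inl_injective hv)
    (Multiset.coe_nodup.1 (Multiset.nodup_of_le (Multiset.le_add_right _ _) hE))
  refine ⟨T'' ::ₘ R, ?_, ?_⟩
  · rw [Multiset.map_cons, Trail.toEdge, ht, hh]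
    simp [Trail.weight, he]
  · rw [Multiset.cons_bind, he, ← Multiset.coe_add, add_assoc]

theorem Realizes.of_reduces {E : Multiset β} (hE : E.Nodup)
    {M K : Multiset (Sym2 (α ⊕ ℕ) × ZMod 2)} {S : Set (α ⊕ ℕ)} (h : G.Realizes γ M E)
    (hR : Reduces S M K) : G.Realizes γ K E := by
  induction hR with
  | refl => exact h
  | split _ _ ih => exact ih.join hE

/-- Zero circuits can be merged into a non-zero one. -/
theorem Realizes.exists_ones {E : Multiset β} (hE : E.Nodup)
    {K : Multiset (Sym2 (α ⊕ ℕ) × ZMod 2)} {v : α ⊕ ℕ} (h : G.Realizes γ K E)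
    (hK : Within {v} K) (h1 : 1 ≤ ones K) :
    ∃ m, ones K ≤ m ∧ G.Realizes γ (Multiset.replicate m (s(v, v), 1)) E := by
  induction hm : K.card using Nat.strong_induction_on generalizing K with
  | _ c ih =>
  have hv : ∀ e ∈ K, e.1 = s(v, v) := by
    rintro ⟨e, a⟩ he
    have := hK _ he
    induction e with | _ x y
    rw [Set.mem_singleton_iff.1 (this x (by simp)), Set.mem_singleton_iff.1 (this y (by simp))]
  by_cases h0 : ones K + 1 ≤ K.card
  · obtain ⟨⟨e, _⟩, N, rfl, rfl⟩ := exists_zero_edge h0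
    obtain rfl : e = s(v, v) := hv _ (Multiset.mem_cons_self _ _)
    rw [ones_cons, ZMod.val_zero, zero_add] at *
    obtain ⟨⟨f, a⟩, hf⟩ : ∃ f, f ∈ N := by
      refine Multiset.exists_mem_of_ne_zero ?_
      rintro rfl
      simp at h1
    obtain ⟨N, rfl⟩ := Multiset.exists_cons_of_mem hf
    obtain rfl : f = s(v, v) := hv (f, a) (by simp)
    have := ih _ (by rw [← hm]; simp) (h.join hE)
      (fun e he => hK e (Multiset.mem_cons_of_mem (by rwa [zero_add] at he)))
      (by rwa [zero_add]) rfl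
    rwa [zero_add] at this
  · refine ⟨K.card, ?_, ?_⟩
    · refine (Multiset.sum_le_card_nsmul _ 1 ?_).trans (by simp)
      simp only [Multiset.mem_map, forall_exists_index, and_imp, forall_apply_eq_imp_iff₂]
      exact fun e _ => (by decide : ∀ a : ZMod 2, a.val ≤ 1) _
    · rwa [← Multiset.eq_replicate_card.2]
      rintro ⟨e, a⟩ he
      obtain rfl : e = s(v, v) := hv _ he
      by_contra hne
      have ha : a = 0 := by
        by_contra ha
        exact hne (by rw [(by decide : ∀ a : ZMod 2, a ≠ 0 → a = 1) a ha])
      obtain ⟨N, rfl⟩ := Multiset.exists_cons_of_mem he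
      have : ∀ N : Multiset (Sym2 (α ⊕ ℕ) × ZMod 2), ones N ≤ N.card := fun N => by
        refine (Multiset.sum_le_card_nsmul _ 1 ?_).trans (by simp)
        simp only [Multiset.mem_map, forall_exists_index, and_imp, forall_apply_eq_imp_iff₂]
        exact fun e _ => (by decide : ∀ a : ZMod 2, a.val ≤ 1) _
      have := this N
      refine h0 ?_
      rw [ones_cons, Multiset.card_cons, ha, ZMod.val_zero]
      omega

open Classical in
/-- The ends of an edge of `G`, as a pair in the larger vertex set `α ⊕ ℕ`, which has room for new
vertices. (The value for elements of `β` that are not edges of `G` is irrelevant.) -/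
noncomputable def endPair (G : Graph α β) (e : β) : Sym2 (α ⊕ ℕ) :=
  if h : ∃ x y, G.IsLink e x y then s(.inl h.choose, .inl h.choose_spec.choose)
  else s(.inr 0, .inr 0)

theorem IsLink.endPair_eq {e : β} {x y : α} (h : G.IsLink e x y) :
    G.endPair e = s(.inl x, .inl y) := by
  have hex : ∃ x y, G.IsLink e x y := ⟨x, y, h⟩
  rw [endPair, dif_pos hex]
  rcases h.eq_and_eq_or_eq_and_eq hex.choose_spec.choose_spec with ⟨h1, h2⟩ | ⟨h1, h2⟩
  · exact congrArg₂ (fun x y => s(Sum.inl x, Sum.inl y)) h1.symm h2.symm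
  · rw [Sym2.eq_swap]
    exact congrArg₂ (fun x y => s(Sum.inl x, Sum.inl y)) h1.symm h2.symm

/-- The edges of `G` as a multiset of labelled pairs of vertices. -/
noncomputable def edgeMultiset (G : Graph α β) (hE : G.edgeSet.Finite) (γ : β → ZMod 2) :
    Multiset (Sym2 (α ⊕ ℕ) × ZMod 2) :=
  hE.toFinset.val.map fun e => (G.endPair e, γ e)

theorem realizes_edges (E : Multiset β) (hE : ∀ e ∈ E, e ∈ G.edgeSet) :
    G.Realizes γ (E.map fun e => (G.endPair e, γ e)) E := by
  induction E using Multiset.induction with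
  | empty => exact ⟨0, rfl, rfl⟩
  | cons e E ih =>
    obtain ⟨R, h1, h2⟩ := ih fun e he => hE e (Multiset.mem_cons_of_mem he)
    obtain ⟨x, y, h⟩ := exists_isLink_of_mem_edgeSet (hE e (Multiset.mem_cons_self _ _))
    refine ⟨⟨[⟨x, e, y, h⟩], by simp, by simp, by simp⟩ ::ₘ R, ?_, ?_⟩
    · rw [Multiset.map_cons, Multiset.map_cons, h1, h.endPair_eq]
      simp [Trail.toEdge, Trail.tail, Trail.head, Trail.weight, Trail.edges]
    · rw [Multiset.cons_bind, h2]
      simp [Trail.edges]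

theorem Trail.edges_ne_nil (T : G.Trail) : T.edges ≠ [] := by
  simpa [Trail.edges] using T.ne_nil

theorem Trail.inc_tail (T : G.Trail) : ∃ e ∈ T.edges, G.Inc e T.tail :=
  ⟨_, List.mem_map_of_mem (List.head_mem T.ne_nil), (T.arcs.head T.ne_nil).isLink.inc_left⟩

/-- A flood of the edges of `G` yields circuits. -/
theorem le_floodingNumber {hE : G.edgeSet.Finite} {n : ℕ}
    (h : Flood {.inl b} (G.edgeMultiset hE γ) n) : n ≤ G.floodingNumber γ b := by
  rcases Nat.eq_zero_or_pos n with rfl | hn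
  · exact Nat.zero_le _
  obtain ⟨K, hK, hw, hones⟩ := h.exists_reduces
  have hnodup := hE.toFinset.nodup
  have hR := (realizes_edges (G := G) (γ := γ) hE.toFinset.val (fun e he => by simpa using he)
    ).of_reduces hnodup hK
  obtain ⟨m, hm, R, hR, hRE⟩ := hR.exists_ones hnodup hw (by omega)
  rw [← hRE] at hnodup
  have hcard : R.card = m := by
    rw [← Multiset.card_map (Trail.toEdge γ) R, hR, Multiset.card_replicate]
  have hT : ∀ T ∈ R, T.tail = b ∧ T.head = b ∧ T.weight γ = 1 := by
    intro T hT
    have := Multiset.eq_of_mem_replicate (hR ▸ Multiset.mem_map_of_mem (Trail.toEdge γ) hT)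
    obtain ⟨h1, h2⟩ := Prod.ext_iff.1 this
    have h3 : T.tail = b ∧ T.head = b := by
      rcases Sym2.eq_iff.1 h1 with ⟨h3, h4⟩ | ⟨h3, h4⟩ <;>
        exact ⟨Sum.inl_injective h3, Sum.inl_injective h4⟩
    exact ⟨h3.1, h3.2, h2⟩
  have huniq : ∀ T ∈ R, ∀ T' ∈ R, ∀ e ∈ T.edges, e ∈ T'.edges →
      T = T' := by
    intro T hT T' hT' e he he'
    by_contra hne
    obtain ⟨R, rfl⟩ := Multiset.exists_cons_of_mem hT
    have hT' := (Multiset.mem_cons.1 hT').resolve_left (Ne.symm hne)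
    rw [Multiset.cons_bind, Multiset.nodup_add] at hnodup
    exact Multiset.disjoint_left.1 hnodup.2.2 he (Multiset.mem_bind.2 ⟨T', hT', he'⟩)
  have hRn : R.Nodup := by
    rw [Multiset.nodup_iff_ne_cons_cons]
    rintro T R' rfl
    obtain ⟨e, he⟩ := List.exists_mem_of_ne_nil _ T.edges_ne_nil
    rw [Multiset.cons_bind, Multiset.nodup_add] at hnodup
    exact Multiset.disjoint_left.1 hnodup.2.2 he (Multiset.mem_bind.2 ⟨T, by simp, he⟩)
  have hmem : m ∈ G.floodingSizes γ b := by
    refine ⟨⟨R, hRn⟩, ⟨fun T hT' => ?_, fun e he => ?_⟩, fun T hT' => ⟨?_, ?_⟩, hcard⟩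
    · obtain ⟨h1, h2, -⟩ := hT T hT'
      exact h2.trans h1.symm
    · have : e ∈ R.bind fun T => (T.edges : Multiset β) := by
        rw [hRE]
        simpa using he
      obtain ⟨T, hT', he'⟩ := Multiset.mem_bind.1 this
      exact ⟨T, ⟨hT', he'⟩, fun T' ⟨h1, h2⟩ => huniq T' h1 T hT' e h2 he'⟩
    · rw [(hT T hT').2.2]
      exact one_ne_zero
    · have := T.inc_tail
      rwa [(hT T hT').1] at this
  exact (hones.trans hm).trans ((G.isGreatest_floodingNumber hE γ b ⟨m, hmem⟩).2 hmem)

end Graph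

namespace Graph

open SignedMultigraph

variable {α β : Type*} {G : Graph α β} {γ : β → ZMod 2} {b : α}

/-! ### From circuit-decompositions to floods -/

/-- The edges of a trail may be joined: a flood in which the trail is replaced by one edge yields a
flood with all edges of the trail. -/
theorem flood_arcs {B : Set (α ⊕ ℕ)} {n : ℕ} (l : List G.Arc) : ∀ {N} (hl : l ≠ []),
    l.IsChain (fun a a' => a.head = a'.tail) →
    Flood B ((s(.inl (l.head hl).tail, .inl (l.getLast hl).head),
      ((l.map Arc.edge).map γ).sum) ::ₘ N) n →
    Flood B ((l.map fun a => (G.endPair a.edge, γ a.edge) : Multiset _) + N) n := by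
  induction l with
  | nil => simp
  | cons a l ih =>
    intro N hl hc h
    rcases l with _ | ⟨a', l⟩
    · simpa [a.isLink.endPair_eq] using h
    · rw [List.isChain_cons_cons] at hc
      have h1 := h.unsplit (a := γ a.edge) (c := (((a' :: l).map Arc.edge).map γ).sum)
        (.inl a.head) (by simp)
      rw [hc.1, cons_left_comm] at h1
      refine ((ih (N := (s(.inl a'.tail, .inl a.tail), γ a.edge) ::ₘ N) (by simp) hc.2
        (by simpa using h1)).congr ?_)
      rw [List.map_cons (a := a), ← Multiset.cons_coe, a.isLink.endPair_eq, hc.1,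
        Sym2.eq_swap (a := Sum.inl a'.tail), Multiset.add_cons, Multiset.cons_add]

theorem Trail.exists_tail_eq {T : G.Trail} (hT : T.IsCircuit) (hb : T.Hits b) :
    ∃ a ∈ T.arcs, a.tail = b := by
  obtain ⟨e, he, hb⟩ := hb
  obtain ⟨a, ha, rfl⟩ := List.mem_map.1 he
  rcases hb.eq_or_eq_of_isLink a.isLink with rfl | rfl
  · exact ⟨a, ha, rfl⟩
  · obtain ⟨l, l', hl⟩ := List.append_of_mem ha
    rcases l' with _ | ⟨a', l'⟩
    · refine ⟨T.arcs.head T.ne_nil, List.head_mem _, ?_⟩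
      have h : T.head = T.tail := hT
      rw [Trail.tail] at h
      rw [← h, Trail.head]
      congr 1
      simp [hl]
    · refine ⟨a', by simp [hl], ?_⟩
      have := T.isChain
      rw [hl, List.isChain_append_cons_cons] at this
      exact this.2.1.symm

/-- A non-zero circuit that hits `b` is a flood of value `1`: it is cut at `b` into two trails,
unless it begins at `b`. -/
theorem Trail.flood {T : G.Trail} (hT : T.IsCircuit) (hb : T.Hits b) (hw : T.weight γ ≠ 0) :
    Flood {.inl b} ((T.edges : Multiset β).map fun e => (G.endPair e, γ e)) 1 := by
  have hw1 : T.weight γ = 1 := (by decide : ∀ a : ZMod 2, a ≠ 0 → a = 1) _ hw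
  have h0 : Flood {.inl b} ((s((.inl b : α ⊕ ℕ), .inl b), (1 : ZMod 2)) ::ₘ 0) 1 :=
    .base (by simp) (by simp only [ones_cons, ZMod.val_one]; omega)
  have hM : ((T.edges : Multiset β).map fun e => (G.endPair e, γ e)) =
      (T.arcs.map fun a => (G.endPair a.edge, γ a.edge) : Multiset _) + 0 := by
    simp [Trail.edges, Function.comp_def]
  rw [hM]
  obtain ⟨a, ha, rfl⟩ := T.exists_tail_eq hT hb
  obtain ⟨l, l', hl⟩ := List.append_of_mem ha
  have hT' : T.head = T.tail := hT
  by_cases hne : l = []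
  · have ht : T.tail = a.tail := by simp [Trail.tail, hl, hne]
    refine flood_arcs T.arcs T.ne_nil T.isChain ?_
    change Flood _ ((s(Sum.inl T.tail, Sum.inl T.head), T.weight γ) ::ₘ 0) 1
    rwa [hT', ht, hw1]
  · have ht : T.tail = (l.head hne).tail := by simp [Trail.tail, hl, hne]
    have hh : T.head = ((a :: l').getLast (by simp)).head := by simp [Trail.head, hl]
    have hc := T.isChain
    rw [hl, List.isChain_append] at hc
    have hjoin : (l.getLast hne).head = a.tail :=
      hc.2.2 _ (by rw [List.getLast?_eq_some_getLast hne]; exact rfl) _ (by simp)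
    have hsum : (1 : ZMod 2) = ((l.map Arc.edge).map γ).sum +
        (((a :: l').map Arc.edge).map γ).sum := by
      rw [← hw1, Trail.weight, Trail.edges, hl]
      simp
    rw [hl, List.map_append, ← Multiset.coe_add, add_assoc]
    refine flood_arcs l hne hc.1 ?_
    rw [← Multiset.add_cons]
    refine flood_arcs (a :: l') (by simp) hc.2.1 ?_
    rw [← hh, hT', hjoin, ← ht]
    refine (h0.unsplit (.inl T.tail) hsum).congr ?_
    rw [cons_left_comm, Sym2.eq_swap]
    simp

theorem IsCircuitDecomposition.bind_edges {𝒞 : Finset G.Trail} (h : G.IsCircuitDecomposition 𝒞)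
    (hE : G.edgeSet.Finite) :
    (𝒞.val.bind fun T => (T.edges : Multiset β)) = hE.toFinset.val := by
  refine (Multiset.Nodup.ext ?_ hE.toFinset.nodup).2 fun e => ?_
  · refine (𝒞.disjiUnion (fun T => (⟨T.edges, Multiset.coe_nodup.2 T.nodup⟩ : Finset β)) ?_).nodup
    intro T hT T' hT' hne
    refine Finset.disjoint_left.2 fun e he he' => hne ?_
    obtain ⟨a, -, rfl⟩ := List.mem_map.1 (show e ∈ T.edges from he)
    exact (h.2 _ a.isLink.edge_mem).unique ⟨hT, he⟩ ⟨hT', he'⟩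
  · rw [Multiset.mem_bind]
    refine ⟨?_, fun he => ?_⟩
    · rintro ⟨T, -, he⟩
      obtain ⟨a, -, rfl⟩ := List.mem_map.1 (Multiset.mem_coe.1 he)
      simpa using a.isLink.edge_mem
    · obtain ⟨T, ⟨hT, he⟩, -⟩ := h.2 e (by simpa using he)
      exact ⟨T, hT, he⟩

theorem IsCircuitDecomposition.flood {𝒞 : Finset G.Trail} (h : G.IsCircuitDecomposition 𝒞)
    (hE : G.edgeSet.Finite) (h𝒞 : ∀ C ∈ 𝒞, C.weight γ ≠ 0 ∧ C.Hits b) :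
    Flood {.inl b} (G.edgeMultiset hE γ) 𝒞.card := by
  rw [edgeMultiset, ← h.bind_edges hE, Multiset.map_bind, Finset.card]
  have hT : ∀ T ∈ 𝒞.val, T.IsCircuit ∧ T.weight γ ≠ 0 ∧ T.Hits b := fun T hT =>
    ⟨h.1 T hT, h𝒞 T hT⟩
  generalize 𝒞.val = R at hT
  induction R using Multiset.induction with
  | empty => exact .base (by simp) (by simp)
  | cons T R ih =>
    obtain ⟨h1, h2, h3⟩ := hT T (Multiset.mem_cons_self _ _)
    rw [Multiset.cons_bind, Multiset.card_cons, add_comm (R.card)]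
    exact (Trail.flood h1 h3 h2).add (ih fun T h => hT T (Multiset.mem_cons_of_mem h))

end Graph

namespace SignedMultigraph

variable {V : Type*} {B : Set V} {M N K : Multiset (Sym2 V × ZMod 2)} {n k : ℕ}

/-! ### Eulerian graphs have floods -/

/-- If `p` and `q` are the only vertices of odd degree, then a trail `C` from `p` to `q`
can be removed. It is encoded by the fact that it may be replaced by an edge `pq`. -/
theorem exists_trail (B : Set V) {p q : V} (hpq : p ≠ q)
    (h : ∀ y, Odd (deg M y) ↔ y = p ∨ y = q) :
    ∃ C R, M = C + R ∧ (∀ y, Even (deg R y)) ∧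
      ∀ X, Flood B ((s(p, q), 0) ::ₘ X) 0 → Flood B (C + X) 0 := by
  induction hm : M.card generalizing M p with
  | zero =>
    obtain rfl := Multiset.card_eq_zero.1 hm
    have := (h p).2 (.inl rfl)
    simp at this
  | succ m ih =>
    have hp : deg M p ≠ 0 := fun h0 => by
      have := (h p).2 (.inl rfl)
      simp [h0] at this
    rw [Ne, deg_eq_zero] at hp
    push Not at hp
    obtain ⟨⟨e, a⟩, he, x, rfl⟩ := hp
    obtain ⟨M, rfl⟩ := Multiset.exists_cons_of_mem he
    have hm' : M.card = m := by simpa using hm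
    simp only [deg_cons, ends_mk] at h
    by_cases hxp : x = p
    · subst hxp
      obtain ⟨C, R, rfl, hR, hC⟩ := ih (M := M) hpq (fun y => by
        rw [← h y]; split_ifs <;> grind) hm'
      refine ⟨C, (s(x, x), a) ::ₘ R, by rw [Multiset.add_cons], fun y => ?_, hC⟩
      have := hR y
      simp only [deg_cons, ends_mk]
      split_ifs <;> grind
    by_cases hxq : x = q
    · subst hxq
      refine ⟨(s(p, x), a) ::ₘ 0, M, by simp, fun y => ?_, fun X hX => ?_⟩
      · have := h y
        split_ifs at this <;> grind
      · simpa using hX.relabel a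
    · obtain ⟨C, R, rfl, hR, hC⟩ := ih (M := M) (p := x) hxq (fun y => by
        have := h y
        split_ifs at this <;> grind) hm'
      refine ⟨(s(p, x), a) ::ₘ C, R, by rw [Multiset.cons_add], hR, fun X hX => ?_⟩
      have h1 := (hX.unsplit x (a := a) (c := a) (CharTwo.add_self_eq_zero a).symm)
      refine (hC ((s(p, x), a) ::ₘ X) ?_).congr (by rw [Multiset.add_cons, Multiset.cons_add])
      rw [cons_left_comm, Sym2.eq_swap (a := x) (b := p)] at h1
      exact h1.relabel 0

/-- If all degrees are even, then a closed trail at `v` can be removed. It is encoded by the fact that it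
may be replaced by a loop at `v`; its label is irrelevant for floods of value `0`. -/
theorem exists_circuit (B : Set V) {v : V} (h : ∀ y, Even (deg M y)) (hv : deg M v ≠ 0) :
    ∃ C R, M = C + R ∧ C ≠ 0 ∧ (∀ y, Even (deg R y)) ∧
      ∀ X, Flood B ((s(v, v), 0) ::ₘ X) 0 → Flood B (C + X) 0 := by
  rw [Ne, deg_eq_zero] at hv
  push Not at hv
  obtain ⟨⟨e, a⟩, he, x, rfl⟩ := hv
  obtain ⟨M, rfl⟩ := Multiset.exists_cons_of_mem he
  simp only [deg_cons, ends_mk] at h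
  by_cases hx : x = v
  · subst hx
    refine ⟨(s(x, x), a) ::ₘ 0, M, by simp, by simp, fun y => ?_, fun X hX => ?_⟩
    · have := h y
      split_ifs at this <;> grind
    · simpa using hX.relabel a
  · obtain ⟨C, R, rfl, hR, hC⟩ := exists_trail B (M := M) hx (fun y => by
      have := h y
      split_ifs at this <;> grind)
    refine ⟨(s(v, x), a) ::ₘ C, R, by rw [Multiset.cons_add], by simp, hR, fun X hX => ?_⟩
    have h1 := (hX.unsplit x (a := a) (c := a) (CharTwo.add_self_eq_zero a).symm)
    refine (hC ((s(v, x), a) ::ₘ X) ?_).congr (by rw [Multiset.add_cons, Multiset.cons_add])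
    rw [Sym2.eq_swap (a := v) (b := x)]
    exact h1.relabel 0

/-- A loop at a vertex that is reached by a flood can be included in one of its trails. -/
theorem Flood.add_loop {v : V} (h : Flood B M 0) (hv : v ∈ B ∨ deg M v ≠ 0) :
    Flood B ((s(v, v), 0) ::ₘ M) 0 := by
  rcases hv with hv | hv
  · have h1 : Flood B ((s(v, v), (0 : ZMod 2)) ::ₘ 0) 0 := .base (by simpa using hv) (by simp)
    simpa using h1.add h
  · rw [Ne, deg_eq_zero] at hv
    push Not at hv
    obtain ⟨⟨e, a⟩, he, x, rfl⟩ := hv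
    obtain ⟨M, rfl⟩ := Multiset.exists_cons_of_mem he
    exact h.unsplit v (zero_add a).symm

/-- If all degrees are even and every edge is connected to the roots, then there is a flood. It is
built up from closed trails, each of which is attached to a vertex already reached. -/
theorem Flood.of_even (h : ∀ v, Even (deg M v))
    (hconn : ∀ S : Set V, B ⊆ S → (∀ e ∈ M, ∀ u ∈ e.1, ∀ v ∈ e.1, u ∈ S → v ∈ S) → Within S M) :
    Flood B M 0 := by
  suffices H : ∀ c, ∀ N R : Multiset (Sym2 V × ZMod 2), R.card = c → M = N + R →
      (∀ v, Even (deg R v)) → Flood B N 0 → Flood B M 0 from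
    H _ 0 M rfl (zero_add _).symm h (.base (by simp) (by simp))
  intro c
  induction c using Nat.strong_induction_on with
  | _ c ih =>
  rintro N R rfl rfl hR hN
  by_cases hR0 : R = 0
  · rwa [hR0, add_zero]
  obtain ⟨v, hv, hvR⟩ : ∃ v, (v ∈ B ∨ deg N v ≠ 0) ∧ deg R v ≠ 0 := by
    by_contra! hcon
    have hS := hconn {v | v ∈ B ∨ deg N v ≠ 0} (fun v hv => .inl hv) (fun e he u hu v hv huS => by
      rcases Multiset.mem_add.1 he with he | he
      · exact .inr fun h0 => deg_eq_zero.1 h0 e he hv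
      · exact absurd hu (deg_eq_zero.1 (hcon u huS) e he))
    obtain ⟨⟨e, a⟩, he⟩ := Multiset.exists_mem_of_ne_zero hR0
    induction e with | _ x y
    have hx := hS _ (Multiset.mem_add.2 (.inr he)) x (by simp)
    exact deg_eq_zero.1 (hcon x hx) _ he (by simp)
  obtain ⟨C, R, rfl, hC0, hR, hC⟩ := exists_circuit B hR hvR
  refine ih R.card ?_ (C + N) R rfl (by abel) hR (hC N (hN.add_loop hv))
  rw [Multiset.card_add]
  have := Multiset.card_pos.2 hC0
  omega

end SignedMultigraph

namespace Graph

open SignedMultigraph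

variable {α β : Type*} {G : Graph α β} {γ : β → ZMod 2} {b : α}

theorem mem_edgeMultiset {hE : G.edgeSet.Finite} {e : Sym2 (α ⊕ ℕ) × ZMod 2} :
    e ∈ G.edgeMultiset hE γ ↔ ∃ f x y, G.IsLink f x y ∧ e = (s(.inl x, .inl y), γ f) := by
  simp only [edgeMultiset, Multiset.mem_map, Finset.mem_val, Set.Finite.mem_toFinset]
  constructor
  · rintro ⟨f, hf, rfl⟩
    obtain ⟨x, y, h⟩ := exists_isLink_of_mem_edgeSet hf
    exact ⟨f, x, y, h, by rw [h.endPair_eq]⟩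
  · rintro ⟨f, x, y, h, rfl⟩
    exact ⟨f, h.edge_mem, by rw [h.endPair_eq]⟩

theorem IsLink.isNonloopAt_iff {e : β} {u v x : α} (h : G.IsLink e u v) :
    G.IsNonloopAt e x ↔ (u = x ∧ v ≠ x) ∨ (u ≠ x ∧ v = x) := by
  simp only [IsNonloopAt, h.isLink_iff]
  constructor
  · rintro ⟨y, hy, ⟨rfl, rfl⟩ | ⟨rfl, rfl⟩⟩
    · exact .inl ⟨rfl, hy⟩
    · exact .inr ⟨hy, rfl⟩
  · rintro (⟨rfl, hv⟩ | ⟨hu, rfl⟩)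
    · exact ⟨v, hv, .inl ⟨rfl, rfl⟩⟩
    · exact ⟨u, hu, .inr ⟨rfl, rfl⟩⟩

theorem deg_edgeMultiset (hE : G.edgeSet.Finite) (x : α) :
    deg (G.edgeMultiset hE γ) (.inl x) = G.degree x := by
  classical
  have h1 : {e | G.IsNonloopAt e x} = (hE.toFinset.filter fun e => G.IsNonloopAt e x : Set β) := by
    ext e
    simpa using fun h : G.IsNonloopAt e x => h.edge_mem
  have h2 : {e | G.IsLoopAt e x} = (hE.toFinset.filter fun e => G.IsLoopAt e x : Set β) := by
    ext e
    simpa using fun h : G.IsLoopAt e x => h.edge_mem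
  rw [degree, h1, h2, Set.ncard_coe_finset, Set.ncard_coe_finset, Finset.card_filter,
    Finset.card_filter, Finset.mul_sum, ← Finset.sum_add_distrib, deg, edgeMultiset,
    Multiset.map_map]
  refine Finset.sum_congr rfl fun e he => ?_
  obtain ⟨u, v, h⟩ := exists_isLink_of_mem_edgeSet (hE.mem_toFinset.1 he)
  have h3 : G.IsLoopAt e x ↔ u = x ∧ v = x := by
    rw [← isLink_self_iff, h.isLink_iff]
    grind
  simp only [Function.comp_apply, h.endPair_eq, ends_mk, h3, h.isNonloopAt_iff, Sum.inl.injEq]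
  by_cases hu : u = x <;> by_cases hv : v = x <;> simp [hu, hv]

theorem IsEulerian.flood (hG : G.IsEulerian) (hE : G.edgeSet.Finite) (hb : b ∈ G.vertexSet) :
    Flood {.inl b} (G.edgeMultiset hE γ) 0 := by
  refine .of_even ?_ ?_
  · rintro (v | v)
    · rw [deg_edgeMultiset]
      by_cases hv : v ∈ G.vertexSet
      · exact hG.2 v hv
      · have h1 : {e | G.IsNonloopAt e v} = ∅ :=
          Set.eq_empty_of_forall_notMem fun e he => hv he.vertex_mem
        have h2 : {e | G.IsLoopAt e v} = ∅ :=
          Set.eq_empty_of_forall_notMem fun e he => hv he.vertex_mem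
        simp [degree, h1, h2]
    · rw [deg_eq_zero.2]
      · exact Even.zero
      · intro e he
        obtain ⟨f, x, y, -, rfl⟩ := mem_edgeMultiset.1 he
        simp
  · intro S hBS hS
    have key : ∀ x, Relation.ReflTransGen G.Adj b x → Sum.inl x ∈ S := by
      intro x hx
      induction hx with
      | refl => exact hBS rfl
      | @tail x y _ h ih =>
        obtain ⟨e, h⟩ := h
        exact hS _ (mem_edgeMultiset.2 ⟨e, x, y, h, rfl⟩) _ (by simp) _ (by simp) ih
    intro e he v hv
    obtain ⟨f, x, y, h, rfl⟩ := mem_edgeMultiset.1 he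
    rcases Sym2.mem_iff.1 hv with rfl | rfl
    · exact key _ (hG.1.2 b hb x h.left_mem)
    · exact key _ (hG.1.2 b hb y h.right_mem)

/-- The flooding number is the maximum value of a flood at `b`. -/
theorem IsEulerian.flood_floodingNumber (hG : G.IsEulerian) (hE : G.edgeSet.Finite)
    (hb : b ∈ G.vertexSet) :
    Flood {.inl b} (G.edgeMultiset hE γ) (G.floodingNumber γ b) := by
  by_cases h : (G.floodingSizes γ b).Nonempty
  · obtain ⟨𝒞, h1, h2, h3⟩ := (G.isGreatest_floodingNumber hE γ b h).1
    rw [← h3]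
    exact h1.flood hE h2
  · rw [floodingNumber, Set.not_nonempty_iff_eq_empty.1 h, csSup_empty]
    exact hG.flood hE hb

end Graph

namespace SignedMultigraph

variable {V : Type*} {B : Set V} {M N K : Multiset (Sym2 V × ZMod 2)} {n k : ℕ}

/-! ### The parity of loads -/

theorem two_mul_edgeLoad (Y : Set V) (s : V → ZMod 2) (e : Sym2 V × ZMod 2) :
    2 * edgeLoad Y s e = 2 * (endsIn Y e.1 : ZMod 4) := by
  obtain ⟨e, a⟩ := e
  induction e with | _ u v
  rw [edgeLoad_mk, endsIn_mk]
  generalize a + (s u + s v) = c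
  by_cases hu : u ∈ Y <;> by_cases hv : v ∈ Y <;> simp only [hu, hv, if_true, if_false] <;>
    revert c <;> decide

theorem Reduces.two_mul_load (h : Reduces B M K) (Y : Set V) (s : V → ZMod 2) :
    2 * load Y s K = 2 * load Y s M := by
  induction h with
  | refl => rfl
  | @split p q v a c N hv h ih =>
    rw [← ih]
    simp only [load_cons, mul_add, two_mul_edgeLoad, endsIn_mk]
    generalize 2 * load Y s N = x
    by_cases hp : p ∈ Y <;> by_cases hq : q ∈ Y <;> by_cases hv : v ∈ Y <;>
      simp only [hp, hq, hv, if_true, if_false] <;> revert x <;> decide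

/-- The load of a set that avoids the roots is even, since the degrees outside the roots are even. -/
theorem Flood.two_mul_load (h : Flood B M n) {Y : Set V} (hY : ∀ v ∈ B, v ∉ Y)
    (s : V → ZMod 2) : 2 * load Y s M = 0 := by
  obtain ⟨K, hK, hw, -⟩ := h.exists_reduces
  rw [← hK.two_mul_load, load_eq_zero fun e he v hv => hY v (hw e he v hv), mul_zero]

end SignedMultigraph

namespace Graph

open SignedMultigraph

variable {α β : Type*} {G : Graph α β} {γ γ' : β → ZMod 2} {b : α}

/-! ### Shiftings, costs and odd components -/

/-- The labels of `γ'` arise from those of `γ` by shifting at the vertices `x` with `s x = 1`. -/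
def IsPotential (G : Graph α β) (γ γ' : β → ZMod 2) (s : α → ZMod 2) : Prop :=
  ∀ e x y, G.IsLink e x y → γ' e = γ e + (s x + s y)

open Classical in
theorem IsPotential.shiftAt {s : α → ZMod 2} (h : G.IsPotential γ γ' s) (v : α) :
    G.IsPotential γ (G.shiftAt v γ') fun x => s x + if x = v then 1 else 0 := by
  intro e x y he
  have := h e x y he
  simp only [Graph.shiftAt, he.isNonloopAt_iff, this]
  have h2 : (1 + 1 : ZMod 2) = 0 := rfl
  by_cases hx : x = v <;> by_cases hy : y = v <;> simp [hx, hy] <;> grind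

theorem IsShifting.exists_potential (h : G.IsShifting γ γ') : ∃ s, G.IsPotential γ γ' s := by
  classical
  induction h with
  | refl => exact ⟨0, fun e x y _ => by simp⟩
  | tail _ h ih =>
    obtain ⟨s, hs⟩ := ih
    obtain ⟨v, -, rfl⟩ := h
    exact ⟨_, hs.shiftAt v⟩

theorem exists_isShifting (hV : G.vertexSet.Finite) (γ : β → ZMod 2) (s : α → ZMod 2) :
    ∃ γ', G.IsShifting γ γ' ∧ G.IsPotential γ γ' s := by
  classical
  have key : ∀ A : Finset α, (∀ x ∈ A, x ∈ G.vertexSet) →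
      ∃ γ', G.IsShifting γ γ' ∧ G.IsPotential γ γ' fun x => if x ∈ A then 1 else 0 := by
    intro A
    induction A using Finset.induction_on with
    | empty => exact fun _ => ⟨γ, .refl, fun e x y _ => by simp⟩
    | insert v A hv ih =>
      intro hA
      obtain ⟨γ', h1, h2⟩ := ih fun x hx => hA x (Finset.mem_insert_of_mem hx)
      refine ⟨G.shiftAt v γ', h1.tail ⟨v, hA v (Finset.mem_insert_self _ _), rfl⟩, ?_⟩
      convert h2.shiftAt v using 2 with x
      by_cases hx : x = v
      · simp [hx, hv]
      · simp [hx]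
  obtain ⟨γ', h1, h2⟩ := key (hV.toFinset.filter fun x => s x = 1) (by simp +contextual)
  refine ⟨γ', h1, fun e x y h => ?_⟩
  have hs : ∀ x ∈ G.vertexSet, (if x ∈ hV.toFinset.filter (fun x => s x = 1) then 1 else 0) = s x := by
    intro x hx
    have : ∀ a : ZMod 2, (if a = 1 then 1 else 0) = a := by decide
    simpa [hx] using this (s x)
  rw [← hs x h.left_mem, ← hs y h.right_mem]
  exact h2 e x y h

open Classical in
/-- The size of a set of edges as a sum over all edges. -/
theorem ncard_eq_sum (hE : G.edgeSet.Finite) {F : Set β} (hF : F ⊆ G.edgeSet) :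
    F.ncard = ∑ e ∈ hE.toFinset, if e ∈ F then 1 else 0 := by
  have : F = (hE.toFinset.filter (· ∈ F) : Set β) := by
    ext e
    simpa using fun h => hF h
  conv_lhs => rw [this]
  rw [Set.ncard_coe_finset, Finset.card_filter]

theorem edgesWithin_subset (X : Set α) : G.edgesWithin X ⊆ G.edgeSet := by
  rintro e ⟨x, -, y, -, h⟩
  exact h.edge_mem

theorem edgeBoundary_subset (X : Set α) : G.edgeBoundary X ⊆ G.edgeSet := by
  rintro e ⟨x, -, y, -, h⟩
  exact h.edge_mem

theorem IsLink.mem_edgesWithin {e : β} {u v : α} (h : G.IsLink e u v) {X : Set α} :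
    e ∈ G.edgesWithin X ↔ u ∈ X ∧ v ∈ X := by
  constructor
  · rintro ⟨x, hx, y, hy, h'⟩
    rcases h.eq_and_eq_or_eq_and_eq h' with ⟨rfl, rfl⟩ | ⟨rfl, rfl⟩
    · exact ⟨hx, hy⟩
    · exact ⟨hy, hx⟩
  · exact fun ⟨hu, hv⟩ => ⟨u, hu, v, hv, h⟩

theorem IsLink.mem_edgeBoundary {e : β} {u v : α} (h : G.IsLink e u v) {X : Set α} :
    e ∈ G.edgeBoundary X ↔ (u ∈ X ∧ v ∉ X) ∨ (u ∉ X ∧ v ∈ X) := by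
  constructor
  · rintro ⟨x, hx, y, hy, h'⟩
    rcases h.eq_and_eq_or_eq_and_eq h' with ⟨rfl, rfl⟩ | ⟨rfl, rfl⟩
    · exact .inl ⟨hx, hy⟩
    · exact .inr ⟨hy, hx⟩
  · rintro (⟨hu, hv⟩ | ⟨hu, hv⟩)
    · exact ⟨u, hu, v, hv, h⟩
    · exact ⟨v, hv, u, hu, h.symm⟩

/-- The set `S` of vertices of the larger vertex set induces the set `X` of vertices of `G`. -/
def Induces (G : Graph α β) (S : Set (α ⊕ ℕ)) (X : Set α) : Prop :=
  ∀ x ∈ G.vertexSet, .inl x ∈ S ↔ x ∈ X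

theorem cost_edgeMultiset (hE : G.edgeSet.Finite) {s : α ⊕ ℕ → ZMod 2} {S : Set (α ⊕ ℕ)}
    {X : Set α} (hS : G.Induces S X) (hγ : G.IsPotential γ γ' (s ∘ .inl)) :
    cost S s (G.edgeMultiset hE γ) =
      2 * nonzeroCount γ' (G.edgesWithin X) + (G.edgeBoundary X).ncard := by
  classical
  rw [nonzeroCount, ncard_eq_sum hE (fun e he => edgesWithin_subset X he.1),
    ncard_eq_sum hE (edgeBoundary_subset X), Finset.mul_sum, ← Finset.sum_add_distrib, cost,
    edgeMultiset, Multiset.map_map]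
  refine Finset.sum_congr rfl fun e he => ?_
  obtain ⟨u, v, h⟩ := exists_isLink_of_mem_edgeSet (hE.mem_toFinset.1 he)
  have h1 := hγ e u v h
  have hval : ∀ a : ZMod 2, 2 * a.val = 2 * if a ≠ 0 then 1 else 0 := by decide
  simp only [Function.comp_apply] at h1
  simp only [Function.comp_apply, h.endPair_eq, edgeCost_mk, hS u h.left_mem, hS v h.right_mem,
    Set.mem_ofPred_eq, h.mem_edgesWithin, h.mem_edgeBoundary, ← h1, hval]
  by_cases hu : u ∈ X <;> by_cases hv : v ∈ X <;> simp [hu, hv]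

theorem load_edgeMultiset (hE : G.edgeSet.Finite) {s : α ⊕ ℕ → ZMod 2} {S : Set (α ⊕ ℕ)}
    {Y : Set α} (hS : G.Induces S Y) (hγ : G.IsPotential γ γ' (s ∘ .inl)) :
    load S s (G.edgeMultiset hE γ) =
      2 * (nonzeroCount γ' (G.edgesWithin Y ∪ G.edgeBoundary Y) : ZMod 4) +
        ((G.edgeBoundary Y).ncard : ZMod 4) := by
  classical
  rw [nonzeroCount, ncard_eq_sum hE (fun e he => (Set.union_subset (edgesWithin_subset Y)
    (edgeBoundary_subset Y)) he.1), ncard_eq_sum hE (edgeBoundary_subset Y), Nat.cast_sum,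
    Nat.cast_sum, Finset.mul_sum, ← Finset.sum_add_distrib, load,
    edgeMultiset, Multiset.map_map]
  refine Finset.sum_congr rfl fun e he => ?_
  obtain ⟨u, v, h⟩ := exists_isLink_of_mem_edgeSet (hE.mem_toFinset.1 he)
  have h1 := hγ e u v h
  have hval : ∀ a : ZMod 2, ((a.val : ℕ) : ZMod 4) = if a ≠ 0 then 1 else 0 := by decide
  simp only [Function.comp_apply] at h1
  simp only [Function.comp_apply, h.endPair_eq, edgeLoad_mk, hS u h.left_mem, hS v h.right_mem,
    Set.mem_ofPred_eq, Set.mem_union, h.mem_edgesWithin, h.mem_edgeBoundary, ← h1, hval]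
  by_cases hu : u ∈ Y <;> by_cases hv : v ∈ Y <;> simp [hu, hv]

theorem isOddSet_iff (hE : G.edgeSet.Finite) {s : α ⊕ ℕ → ZMod 2} {S : Set (α ⊕ ℕ)}
    {Y : Set α} (hS : G.Induces S Y) (hγ : G.IsPotential γ γ' (s ∘ .inl))
    (h : 2 * load S s (G.edgeMultiset hE γ) = 0) :
    G.IsOddSet γ' Y ↔ load S s (G.edgeMultiset hE γ) = 2 := by
  rw [load_edgeMultiset hE hS hγ] at h ⊢
  rw [IsOddSet]
  generalize nonzeroCount γ' (G.edgesWithin Y ∪ G.edgeBoundary Y) = c at *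
  generalize (G.edgeBoundary Y).ncard = d at *
  have h1 : (((2 * (2 * c + d) : ℕ) : ZMod 4)) = ((0 : ℕ) : ZMod 4) := by push_cast; exact h
  have h2 : (2 * (c : ZMod 4) + (d : ZMod 4) = 2) ↔
      (((2 * c + d : ℕ) : ZMod 4)) = ((2 : ℕ) : ZMod 4) := by push_cast; rfl
  rw [h2]
  rw [ZMod.natCast_eq_natCast_iff'] at *
  rw [Nat.ModEq]
  omega

theorem IsComponentSet.subset {H : Graph α β} {Y : Set α} (h : H.IsComponentSet Y) :
    Y ⊆ H.vertexSet := by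
  obtain ⟨v, hv, rfl⟩ := h
  intro w hw
  rcases Relation.ReflTransGen.cases_tail hw with rfl | ⟨_, -, h⟩
  · exact hv
  · exact h.right_mem

theorem IsComponentSet.eq_of_mem {H : Graph α β} {Y : Set α} (h : H.IsComponentSet Y) {w : α}
    (hw : w ∈ Y) : Y = {x | Relation.ReflTransGen H.Adj w x} := by
  have : Std.Symm H.Adj := ⟨fun _ _ h => h.symm⟩
  obtain ⟨v, hv, rfl⟩ := h
  have hvw : Relation.ReflTransGen H.Adj v w := hw
  ext x
  exact ⟨fun hx => (Std.Symm.symm _ _ hvw : Relation.ReflTransGen H.Adj w v).trans hx,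
    fun hx => hvw.trans hx⟩

theorem IsComponentSet.nonempty {H : Graph α β} {Y : Set α} (h : H.IsComponentSet Y) :
    Y.Nonempty := by
  obtain ⟨v, hv, rfl⟩ := h
  exact ⟨v, .refl⟩

theorem IsComponentSet.closed {X Y : Set α} (h : (G.deleteVerts X).IsComponentSet Y) {e : β}
    {u v : α} (he : G.IsLink e u v) (hu : u ∈ Y) : v ∈ Y ∨ v ∈ X := by
  by_cases hv : v ∈ X
  · exact .inr hv
  · left
    rw [h.eq_of_mem hu]
    have huX : u ∉ X := by
      have := h.subset hu
      rw [vertexSet_deleteVerts] at this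
      exact this.2
    exact .single ⟨e, by rw [deleteVerts_isLink]; exact ⟨he, huX, hv⟩⟩

theorem induces_image (X : Set α) : G.Induces (.inl '' X) X := fun x _ => by simp

theorem finite_components (hV : G.vertexSet.Finite) (γ : β → ZMod 2) (X : Set α) :
    {Y | (G.deleteVerts X).IsComponentSet Y ∧ G.IsOddSet γ Y}.Finite := by
  refine hV.finite_subsets.subset fun Y hY => hY.1.subset.trans ?_
  rw [vertexSet_deleteVerts]
  exact Set.sdiff_subset

/-- The odd components of `G - X` form an odd family. -/
theorem exists_isOddFamily (hV : G.vertexSet.Finite) (hE : G.edgeSet.Finite) {X : Set α}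
    (hb : b ∈ X) {s : α ⊕ ℕ → ZMod 2} (hγ : G.IsPotential γ γ' (s ∘ .inl))
    (h₀ : Flood {.inl b} (G.edgeMultiset hE γ) 0) :
    ∃ 𝒴, IsOddFamily (G.edgeMultiset hE γ) (.inl '' X) s 𝒴 ∧
      𝒴.card = G.oddComponents γ' X := by
  classical
  have hfin := finite_components hV γ' X (G := G)
  have hX : ∀ {Y}, (G.deleteVerts X).IsComponentSet Y → ∀ v ∈ Y, v ∉ X := fun hY v hv => by
    have := hY.subset hv
    rw [vertexSet_deleteVerts] at this
    exact this.2
  refine ⟨hfin.toFinset.image (Set.image .inl), ⟨?_, ?_, ?_, ?_⟩, ?_⟩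
  · simp only [Finset.forall_mem_image, Set.Finite.mem_toFinset, Set.mem_ofPred_eq]
    rintro Y ⟨hY, -⟩ _ ⟨v, hv, rfl⟩
    simpa using hX hY v hv
  · simp only [Finset.forall_mem_image, Set.Finite.mem_toFinset, Set.mem_ofPred_eq]
    rintro Y ⟨hY, -⟩ Y' ⟨hY', -⟩ _ ⟨v, hv, rfl⟩ hv'
    have hv' : v ∈ Y' := by simpa using hv'
    rw [hY.eq_of_mem hv, hY'.eq_of_mem hv']
  · simp only [Finset.forall_mem_image, Set.Finite.mem_toFinset, Set.mem_ofPred_eq]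
    rintro Y ⟨hY, -⟩ _ v a he ⟨x, hx, rfl⟩
    obtain ⟨f, x', y', h, he⟩ := mem_edgeMultiset.1 he
    rcases Sym2.eq_iff.1 (Prod.ext_iff.1 he).1 with ⟨h1, rfl⟩ | ⟨h1, rfl⟩
    · obtain rfl := Sum.inl_injective h1
      simpa using hY.closed h hx
    · obtain rfl := Sum.inl_injective h1
      simpa using hY.closed h.symm hx
  · simp only [Finset.forall_mem_image, Set.Finite.mem_toFinset, Set.mem_ofPred_eq]
    rintro Y ⟨hY, hodd⟩
    refine (isOddSet_iff hE (induces_image Y) hγ (h₀.two_mul_load ?_ s)).1 hodd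
    rintro _ rfl
    simpa using fun h => hX hY b h hb
  · rw [Finset.card_image_of_injective _ Sum.inl_injective.image_injective, oddComponents,
      Set.ncard_eq_toFinset_card _ hfin]

/-- An odd union of components of `G - X` contains an odd component. -/
theorem exists_odd_component (hE : G.edgeSet.Finite) {X : Set α} (hb : b ∈ X)
    {s : α ⊕ ℕ → ZMod 2} (hγ : G.IsPotential γ γ' (s ∘ .inl))
    (h₀ : Flood {.inl b} (G.edgeMultiset hE γ) 0) {A : Set α} (hA : A.Finite)
    (hAG : A ⊆ G.vertexSet) (hAX : ∀ v ∈ A, v ∉ X)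
    (hcl : ∀ e u v, G.IsLink e u v → u ∈ A → v ∈ A ∨ v ∈ X)
    (hodd : load (.inl '' A) s (G.edgeMultiset hE γ) = 2) :
    ∃ C ⊆ A, (G.deleteVerts X).IsComponentSet C ∧ G.IsOddSet γ' C := by
  induction hm : A.ncard using Nat.strong_induction_on generalizing A with
  | _ m ih =>
  subst hm
  obtain ⟨v, hv⟩ : A.Nonempty := by
    by_contra! hA
    rw [hA, Set.image_empty, load_eq_zero (by simp)] at hodd
    exact absurd hodd (by decide)
  set C : Set α := {w | Relation.ReflTransGen (G.deleteVerts X).Adj v w} with hC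
  have hcomp : (G.deleteVerts X).IsComponentSet C :=
    ⟨v, by rw [vertexSet_deleteVerts]; exact ⟨hAG hv, hAX v hv⟩, rfl⟩
  have hCA : C ⊆ A := by
    intro w hw
    induction (show Relation.ReflTransGen _ v w from hw) with
    | refl => exact hv
    | @tail x y hx h ih =>
      obtain ⟨e, h⟩ := h
      rw [deleteVerts_isLink] at h
      exact (hcl e x y h.1 (ih hx)).resolve_right h.2.2
  have h2 : 2 * load (.inl '' C) s (G.edgeMultiset hE γ) = 0 := by
    refine h₀.two_mul_load ?_ s
    rintro _ rfl
    simpa using fun h => hAX b (hCA h) hb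
  by_cases hCo : G.IsOddSet γ' C
  · exact ⟨C, hCA, hcomp, hCo⟩
  rw [isOddSet_iff hE (induces_image C) hγ h2] at hCo
  have hC0 : load (.inl '' C) s (G.edgeMultiset hE γ) = 0 :=
    (by decide : ∀ x : ZMod 4, 2 * x = 0 → x ≠ 2 → x = 0) _ h2 hCo
  have hunion : Sum.inl (β := ℕ) '' A = .inl '' C ∪ .inl '' (A \ C) := by
    rw [← Set.image_union, Set.union_sdiff_cancel hCA]
  have hcl' : ∀ e u w, G.IsLink e u w → u ∈ A \ C → w ∈ A \ C ∨ w ∈ X := by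
    rintro e u w h ⟨hu, huC⟩
    rcases hcl e u w h hu with hw | hw
    · left
      refine ⟨hw, fun hwC => ?_⟩
      exact (hcomp.closed h.symm hwC).elim huC (hAX u hu)
    · exact .inr hw
  rw [hunion, IsOddFamily.load_union, hC0, zero_add] at hodd
  rotate_left
  · rintro _ ⟨x, hx, rfl⟩ ⟨y, hy, h⟩
    obtain rfl := Sum.inl_injective h
    exact hy.2 hx
  · rintro _ w a he ⟨x, hx, rfl⟩ ⟨y, hy, rfl⟩
    obtain ⟨f, x', y', h, he⟩ := mem_edgeMultiset.1 he
    have h : G.IsLink f x y := by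
      rcases Sym2.eq_iff.1 (Prod.ext_iff.1 he).1 with ⟨h1, h2⟩ | ⟨h1, h2⟩
      · rwa [Sum.inl_injective h1, Sum.inl_injective h2]
      · rw [Sum.inl_injective h1, Sum.inl_injective h2]
        exact h.symm
    exact (hcomp.closed h hx).elim hy.2 (hAX y hy.1)
  obtain ⟨C', hC', h⟩ := ih (A \ C).ncard
    (Set.ncard_lt_ncard ⟨Set.sdiff_subset, fun h => (h hv).2 .refl⟩ hA)
    (hA.subset Set.sdiff_subset) (Set.sdiff_subset.trans hAG) (fun v hv => hAX v hv.1) hcl' hodd rfl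
  exact ⟨C', hC'.trans Set.sdiff_subset, h⟩

theorem card_le_oddComponents (hV : G.vertexSet.Finite) (hE : G.edgeSet.Finite)
    {X : Set α} {S : Set (α ⊕ ℕ)} (hS : G.Induces S X) (hb : b ∈ X)
    {s : α ⊕ ℕ → ZMod 2} (hγ : G.IsPotential γ γ' (s ∘ .inl))
    (h₀ : Flood {.inl b} (G.edgeMultiset hE γ) 0) {𝒴 : Finset (Set (α ⊕ ℕ))}
    (h : IsOddFamily (G.edgeMultiset hE γ) S s 𝒴) : 𝒴.card ≤ G.oddComponents γ' X := by
  classical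
  have key : ∀ Y ∈ 𝒴, ∃ C : Set α, (∀ x ∈ C, .inl x ∈ Y) ∧
      (G.deleteVerts X).IsComponentSet C ∧ G.IsOddSet γ' C := by
    intro Y hY
    have hA : G.vertexSet ∩ .inl ⁻¹' Y ⊆ G.vertexSet := Set.inter_subset_left
    refine (exists_odd_component hE hb hγ h₀ (hV.subset hA) hA ?_ ?_ ?_).imp
      fun C ⟨hC, hC'⟩ => ⟨fun x hx => (hC hx).2, hC'⟩
    · exact fun v hv hvX => h.notMem Y hY _ hv.2 ((hS v hv.1).2 hvX)
    · intro e u v he hu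
      have := h.closed Y hY _ _ _ (mem_edgeMultiset.2 ⟨e, u, v, he, rfl⟩) hu.2
      exact this.imp (fun h => ⟨he.right_mem, h⟩) (hS v he.right_mem).1
    · rw [← h.odd Y hY]
      refine load_congr (fun e he v hv => ?_) fun _ _ _ _ => rfl
      obtain ⟨f, x, y, hf, rfl⟩ := mem_edgeMultiset.1 he
      rcases Sym2.mem_iff.1 hv with rfl | rfl
      · simp [hf.left_mem]
      · simp [hf.right_mem]
  choose! f hf using key
  rw [oddComponents, ← Set.ncard_coe_finset]
  refine Set.ncard_le_ncard_of_injOn f (fun Y hY => (hf Y hY).2) ?_ (finite_components hV γ' X)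
  intro Y hY Y' hY' heq
  obtain ⟨x, hx⟩ := (hf Y hY).2.1.nonempty
  exact h.disjoint Y hY Y' hY' _ ((hf Y hY).1 x hx) ((hf Y' hY').1 x (heq ▸ hx))

/-- Every shifting and every set `X` bound the flooding number from above. -/
theorem two_mul_floodingNumber_le (hV : G.vertexSet.Finite) (hE : G.edgeSet.Finite)
    (hG : G.IsEulerian) (hb : b ∈ G.vertexSet) (hγ : G.IsShifting γ γ') {X : Set α} (hbX : b ∈ X) :
    2 * G.floodingNumber γ b + 2 * G.oddComponents γ' X ≤
      2 * nonzeroCount γ' (G.edgesWithin X) + (G.edgeBoundary X).ncard := by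
  obtain ⟨s, hs⟩ := hγ.exists_potential
  have hs' : G.IsPotential γ γ' (Sum.elim s (0 : ℕ → ZMod 2) ∘ .inl) := hs
  obtain ⟨𝒴, h1, h2⟩ := exists_isOddFamily hV hE hbX hs' (hG.flood hE hb)
  rw [← cost_edgeMultiset hE (induces_image X) hs', ← h2]
  exact (hG.flood_floodingNumber hE hb).le_cost (by simpa using hbX) (by simp) h1

/-- Some shifting and some set `X` attain the flooding number. -/
theorem exists_le_two_mul_floodingNumber (hV : G.vertexSet.Finite) (hE : G.edgeSet.Finite)
    (hG : G.IsEulerian) (γ : β → ZMod 2) (hb : b ∈ G.vertexSet) :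
    ∃ γ' X, G.IsShifting γ γ' ∧ X ⊆ G.vertexSet ∧ b ∈ X ∧
      2 * nonzeroCount γ' (G.edgesWithin X) + (G.edgeBoundary X).ncard ≤
        2 * G.floodingNumber γ b + 2 * G.oddComponents γ' X := by
  have h₀ := hG.flood (γ := γ) hE hb
  obtain ⟨k, hk, S, s, 𝒴, hS, -, h𝒴, hcost⟩ := h₀.exists_certificate (Set.finite_singleton _)
  obtain ⟨γ', hγ, hs⟩ := exists_isShifting hV γ (s ∘ .inl)
  have hX : G.Induces S (G.vertexSet ∩ .inl ⁻¹' S) := fun x hx => by simp [hx]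
  have hbX : b ∈ G.vertexSet ∩ .inl ⁻¹' S := ⟨hb, hS rfl⟩
  refine ⟨γ', _, hγ, Set.inter_subset_left, hbX, ?_⟩
  have h1 := card_le_oddComponents hV hE hX hbX hs h₀ h𝒴
  have h2 := le_floodingNumber hk
  rw [cost_edgeMultiset hE hX hs] at hcost
  omega

end Graph

theorem theorem1 {α β : Type*} (G : Graph α β)
    (hV : G.vertexSet.Finite) (hE : G.edgeSet.Finite) (hG : G.IsEulerian)
    (γ : β → ZMod 2) (b : α) (hb : b ∈ G.vertexSet) :
    IsLeast
      {r : ℚ | ∃ (γ' : β → ZMod 2) (X : Set α),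
        G.IsShifting γ γ' ∧ X ⊆ G.vertexSet ∧ b ∈ X ∧
        r = (Graph.nonzeroCount γ' (G.edgesWithin X) : ℚ)
              + ((G.edgeBoundary X).ncard : ℚ) / 2 - (G.oddComponents γ' X : ℚ)}
      (G.floodingNumber γ b : ℚ) := by
  constructor
  · obtain ⟨γ', X, hγ, hX, hbX, h⟩ := Graph.exists_le_two_mul_floodingNumber hV hE hG γ hb
    refine ⟨γ', X, hγ, hX, hbX, ?_⟩
    have h' := congrArg (Nat.cast (R := ℚ))
      (le_antisymm h (Graph.two_mul_floodingNumber_le hV hE hG hb hγ hbX))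
    push_cast at h'
    linarith
  · rintro r ⟨γ', X, hγ, -, hbX, rfl⟩
    have h := (Nat.cast_le (α := ℚ)).2 (Graph.two_mul_floodingNumber_le hV hE hG hb hγ hbX)
    push_cast at h
    linarith
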